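/- **Notation.** $\operatorname{mes}$ is Lebesgue measure on $\mathbb R$ and $a^+=\max\{0,a\}$. For an extended-real function $w$ near the circle $|z|=t$ put $$\mathsf M_w(t)=\sup_{0\le\theta<2\pi}w(te^{i\theta}),\qquad \mathsf C_w(t)=\frac1{2\pi}\int_0^{2\pi}w(te^{i\theta})\,d\theta,\qquad \mathsf M_w^+(t)=\bigl(\mathsf M_w(t)\bigr)^+ .$$ Let $U=u-v$ be $\delta$-subharmonic, $U\not\equiv\pm\infty$, on a domain $O\subset\mathbb C$, i.e. $u\not\equiv-\infty$ and $v\not\equiv-\infty$ are subharmonic on $O$ and $U(z)=u(z)-v(z)$ at all points $z\in O$ where $u(z),v(z)$ are not both $-\infty$ (at the remaining points $U(z)\in[-\infty,+\infty]$ is arbitrary). Let $\varDelta_u=\frac1{2\pi}\Delta u$, $\varDelta_v=\frac1{2\pi}\Delta v$ be the Riesz measures (in the sense of distributions on $O$), and let $\varDelta_U^-=\sup\{\varDelta_v,\varDelta_u\}-\varDelta_u$ be the lower variation of the Riesz charge $\varDelta_u-\varDelta_v$. For $0<s<R$ with $\{|z|\le R\}\subset O$ put $$\mathsf T_U(s,R)=\mathsf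 C_{U^+}(R)-\mathsf C_{U^+}(s)+\int_s^R\frac{\varDelta_U^-(\{|z|\le t\})}{t}\,dt .$$ For measurable $E\subset\mathbb R$ and measurable $g\colon E\to[-\infty,+\infty]$ let $\|g\|_p=\bigl(\int_E|g|^p\,d\operatorname{mes}\bigr)^{1/p}$ for $1<p<\infty$, and $\|g\|_\infty=\inf\{a\ge0 : \operatorname{mes}\{x\in E: g(x)>a\}=0\}$ (which is at most the usual $L^\infty$-norm of $g$). **Theorem.** Let $0<r_0\le r<+\infty$, $1<k<+\infty$, $1<p\le\infty$, $\frac1p+\frac1q=1$, let $E\subset[0,r]$ and $g\colon E\to[-\infty,+\infty]$ be Lebesgue measurable, and let $U\not\equiv\pm\infty$ be a $\delta$-subharmonic function on a domain containing the closed disc $\{|z|\le kr\}$ (for instance on $\mathbb C$). Then $\mathsf M_U^+\,g$ is Lebesgue measurable on $E$, the integral of its positive part over $E$ is finite whenever $\|g\|_p<\infty$, and $$\int_E\mathsf M_U^+(t)\,g(t)\,dt\ \le\ \frac{6qk}{k-1}\,\bigl(\mathsf T_U(r_0,kr)+\mathsf C_{U^+}(r_0)\bigr)\,\|g\|_p\,(\operatorname{mes}E)^{1/q}\,\ln\frac{4ekr}{\operatorname{mes}E}.$$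 (Here $0\cdot\infty=0$; in particular both sides are $0$ if $\operatorname{mes}E=0$. If $\|g\|_p=\infty$ and the left-hand integral has the form $\infty-\infty$, nothing is asserted about its value.) -/

import Mathlib

open MeasureTheory Set
open scoped ENNReal

noncomputable section

namespace DeltaSubharmonic

/-- Lebesgue integral of an extended real valued function: integral of the positive part minus
integral of the negative part. -/
def eintegral {α : Type*} [MeasurableSpace α] (μ : Measure α) (f : α → EReal) : EReal :=
  ((∫⁻ x, (f x).toENNReal ∂μ : ℝ≥0∞) : EReal) - ((∫⁻ x, (-f x).toENNReal ∂μ : ℝ≥0∞) : EReal)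

/-- The mean of `w` over the circle of radius `r` centred at `c`. -/
def circleMean (w : ℂ → EReal) (c : ℂ) (r : ℝ) : EReal :=
  (((2 * Real.pi)⁻¹ : ℝ) : EReal) *
    eintegral (volume.restrict (Ioc 0 (2 * Real.pi))) (fun θ => w (circleMap c r θ))

/-- The positive part of an extended real valued function. -/
def posPart {α : Type*} (w : α → EReal) : α → EReal := fun x => max 0 (w x)

/-- The maximal growth characteristic `M_w(r)`: the supremum of `w` over the circle `|z| = r`. -/
def maxChar (w : ℂ → EReal) (r : ℝ) : EReal :=
  ⨆ θ ∈ Ico (0 : ℝ) (2 * Real.pi), w (circleMap 0 r θ)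

/-- Subharmonic functions on a set `O` (the value `-∞` is allowed, also identically). -/
structure SubharmonicOn (u : ℂ → EReal) (O : Set ℂ) : Prop where
  usc : UpperSemicontinuousOn u O
  lt_top : ∀ z ∈ O, u z < ⊤
  submean : ∀ (z : ℂ) (ρ : ℝ), 0 < ρ → Metric.closedBall z ρ ⊆ O → u z ≤ circleMean u z ρ

/-- `μ` is the Riesz measure of `u` on `O`, i.e. `(1/2π) Δu` in the sense of distributions on `O`;
it is a Radon measure on `O`, regarded as a measure on the plane carried by `O`. -/
structure IsRieszMeasure (u : ℂ → EReal) (O : Set ℂ) (μ : Measure ℂ) : Prop where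
  carried : μ Oᶜ = 0
  finite_on_compacts : ∀ K : Set ℂ, IsCompact K → K ⊆ O → μ K < ⊤
  integral_eq : ∀ φ : ℂ → ℝ, ContDiff ℝ (⊤ : ℕ∞) φ → HasCompactSupport φ → tsupport φ ⊆ O →
    ∫ z, φ z ∂μ = (2 * Real.pi)⁻¹ * ∫ z, (u z).toReal * Laplacian.laplacian φ z

open Classical in
/-- The Riesz measure of a subharmonic function `u ≢ -∞` on a domain `O`. The defining properties
determine it uniquely. -/
def rieszMeasure (u : ℂ → EReal) (O : Set ℂ) : Measure ℂ :=
  if h : ∃ μ, IsRieszMeasure u O μ then h.choose else 0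

/-- `U = u - v` is a `δ`-subharmonic function, `U ≢ ±∞`, on the domain `O`. At the points where
`u = v = -∞` the difference is undefined, and the value of `U` there is arbitrary. -/
structure IsDeltaSubharmonicOn (U u v : ℂ → EReal) (O : Set ℂ) : Prop where
  isOpen : IsOpen O
  isConnected : IsConnected O
  subharmonic_left : SubharmonicOn u O
  left_ne_bot : ∃ z ∈ O, u z ≠ ⊥
  subharmonic_right : SubharmonicOn v O
  right_ne_bot : ∃ z ∈ O, v z ≠ ⊥
  eq_sub : ∀ z ∈ O, u z ≠ ⊥ ∨ v z ≠ ⊥ → U z = u z - v z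

/-- The lower variation of the Riesz charge `Δ_u - Δ_v` of `u - v`. Subtraction of measures is
truncated: the least measure `τ` with `Δ_v ≤ τ + Δ_u`, that is `sup {Δ_v, Δ_u} - Δ_u`. -/
def lowerRiesz (u v : ℂ → EReal) (O : Set ℂ) : Measure ℂ :=
  rieszMeasure v O - rieszMeasure u O

/-- `N_μ(r, R) = ∫_r^R μ(closed disc of radius t) / t dt`. -/
def radialN (μ : Measure ℂ) (r R : ℝ) : ℝ≥0∞ :=
  ∫⁻ t in Ioc r R, μ (Metric.closedBall 0 t) / ENNReal.ofReal t

/-- The difference Nevanlinna characteristic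
`T_U(r, R) = C_{U⁺}(R) - C_{U⁺}(r) + N_{Δ_U⁻}(r, R)` of `U = u - v`. -/
def nevanlinnaT (U u v : ℂ → EReal) (O : Set ℂ) (r R : ℝ) : EReal :=
  circleMean (posPart U) 0 R - circleMean (posPart U) 0 r
    + ((radialN (lowerRiesz u v O) r R : ℝ≥0∞) : EReal)

/-- `‖g‖_p` on `E`: for `p = ∞` it is the essential upper bound
`inf {a ≥ 0 | mes {x ∈ E | g x > a} = 0}`, and `(∫_E |g|^p)^(1/p)` for finite `p`. -/
def weightNorm (g : ℝ → EReal) (p : ℝ≥0∞) (E : Set ℝ) : ℝ≥0∞ :=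
  if p = ⊤ then sInf {a : ℝ≥0∞ | volume {x | x ∈ E ∧ (a : EReal) < g x} = 0}
  else (∫⁻ x in E, (g x).abs ^ p.toReal) ^ (1 / p.toReal)

open Complex in
theorem laplacian_eq_rotated (f : ℂ → ℝ) (x : ℂ) (θ : ℝ) :
    Laplacian.laplacian f x =
      fderiv ℝ (fderiv ℝ f) x (exp (θ * I)) (exp (θ * I))
        + fderiv ℝ (fderiv ℝ f) x (exp (θ * I) * I) (exp (θ * I) * I) := by
  rw [InnerProductSpace.laplacian_eq_iteratedFDeriv_complexPlane]
  simp only [iteratedFDeriv_two_apply, Matrix.cons_val_zero, Matrix.cons_val_one]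
  have h1 : exp (θ * I) = (Real.cos θ) • (1 : ℂ) + (Real.sin θ) • I := by
    rw [exp_mul_I, ← ofReal_cos, ← ofReal_sin]; simp
  have h2 : exp (θ * I) * I = (-Real.sin θ) • (1 : ℂ) + (Real.cos θ) • I := by
    rw [h1]; apply Complex.ext <;> simp
  rw [h2, h1]
  simp only [map_add, map_smul, add_apply, smul_apply, smul_eq_mul]
  linear_combination (-(fderiv ℝ (fderiv ℝ f) x 1 1) - (fderiv ℝ (fderiv ℝ f) x I I))
    * Real.sin_sq_add_cos_sq θ

theorem hasDerivAt_intervalIntegral_of_continuous {F F' : ℝ → ℝ → ℝ} {a b : ℝ}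
    (hF : ∀ s, Continuous (F s)) (hF' : Continuous (Function.uncurry F'))
    (h : ∀ s t, HasDerivAt (fun x => F x t) (F' s t) s) (s : ℝ) :
    HasDerivAt (fun x => ∫ t in a..b, F x t) (∫ t in a..b, F' s t) s := by
  obtain ⟨C, hC⟩ := ((isCompact_Icc (a := s - 1) (b := s + 1)).prod
    (isCompact_uIcc (a := a) (b := b))).exists_bound_of_continuousOn hF'.continuousOn
  refine (intervalIntegral.hasDerivAt_integral_of_dominated_loc_of_deriv_le
    (bound := fun _ => C) (s := Icc (s - 1) (s + 1)) (Icc_mem_nhds (by linarith) (by linarith))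
    (.of_forall fun x => (hF x).aestronglyMeasurable) ((hF s).intervalIntegrable _ _)
    (by fun_prop) (.of_forall fun t ht x hx => ?_) (by simp) (.of_forall fun t _ x _ => h x t)).2
  exact hC (x, t) ⟨hx, uIoc_subset_uIcc ht⟩

section radial

variable {f : ℂ → ℝ}

/-- The integral of `f` over the circle of radius `s` with respect to the angle. -/
def angularIntegral (f : ℂ → ℝ) (c : ℂ) (s : ℝ) : ℝ :=
  ∫ θ in (-Real.pi)..Real.pi, f (circleMap c s θ)

/-- The integral over a circle of the radial derivative of `f`. -/
def angularIntegralDeriv (f : ℂ → ℝ) (c : ℂ) (s : ℝ) : ℝ :=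
  ∫ θ in (-Real.pi)..Real.pi, fderiv ℝ f (circleMap c s θ) (Complex.exp (θ * Complex.I))

theorem continuous_uncurry_circleMap (c : ℂ) : Continuous fun p : ℝ × ℝ => circleMap c p.1 p.2 := by
  unfold circleMap; fun_prop

theorem hasDerivAt_circleMap_radius (c : ℂ) (s θ : ℝ) :
    HasDerivAt (fun x : ℝ => circleMap c x θ) (Complex.exp (θ * Complex.I)) s := by
  unfold circleMap
  have := ((Complex.ofRealCLM.hasDerivAt (x := s)).mul_const
    (Complex.exp (θ * Complex.I))).const_add c
  simpa using this

theorem continuous_laplacian (hf : ContDiff ℝ 2 f) : Continuous (Laplacian.laplacian f) := by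
  rw [InnerProductSpace.laplacian_eq_iteratedFDeriv_complexPlane]
  have := hf.continuous_iteratedFDeriv (m := 2) le_rfl
  fun_prop

theorem contDiff_one_fderiv (hf : ContDiff ℝ 2 f) : ContDiff ℝ 1 (fderiv ℝ f) := by
  apply hf.fderiv_right
  norm_num

theorem continuous_fderiv_fderiv (hf : ContDiff ℝ 2 f) : Continuous (fderiv ℝ (fderiv ℝ f)) :=
  (contDiff_one_fderiv hf).continuous_fderiv (by simp)

theorem hasDerivAt_angularIntegral (hf : ContDiff ℝ 2 f) (c : ℂ) (s : ℝ) :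
    HasDerivAt (angularIntegral f c) (angularIntegralDeriv f c s) s := by
  have hc := hf.continuous
  have hc' := hf.continuous_fderiv (by simp)
  have hm := continuous_uncurry_circleMap c
  refine hasDerivAt_intervalIntegral_of_continuous
    (F := fun s θ => f (circleMap c s θ))
    (F' := fun s θ => fderiv ℝ f (circleMap c s θ) (Complex.exp (θ * Complex.I)))
    (fun s => by fun_prop) ?_ (fun s θ => ?_) s
  · have h1 : Continuous fun p : ℝ × ℝ => fderiv ℝ f (circleMap c p.1 p.2) := hc'.comp hm
    have h2 : Continuous fun p : ℝ × ℝ => Complex.exp (p.2 * Complex.I) := by fun_prop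
    exact h1.clm_apply h2
  · exact ((hf.differentiable (by simp)) _).hasFDerivAt.comp_hasDerivAt s
      (hasDerivAt_circleMap_radius c s θ)

theorem hasDerivAt_angularIntegralDeriv (hf : ContDiff ℝ 2 f) (c : ℂ) (s : ℝ) :
    HasDerivAt (fun s => s * angularIntegralDeriv f c s)
      (s * angularIntegral (Laplacian.laplacian f) c s) s := by
  have hc' := hf.continuous_fderiv (by simp)
  have hd' := (contDiff_one_fderiv hf).differentiable (by simp)
  have hc2 := continuous_fderiv_fderiv hf
  have hm := continuous_uncurry_circleMap c
  have hm' : ∀ s, Continuous (circleMap c s) := fun s => by fun_prop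
  have he : Continuous fun t : ℝ => Complex.exp (t * Complex.I) := by fun_prop
  have hA : HasDerivAt (angularIntegralDeriv f c)
      (∫ θ in (-Real.pi)..Real.pi, fderiv ℝ (fderiv ℝ f) (circleMap c s θ)
        (Complex.exp (θ * Complex.I)) (Complex.exp (θ * Complex.I))) s := by
    refine hasDerivAt_intervalIntegral_of_continuous
      (F := fun s θ => fderiv ℝ f (circleMap c s θ) (Complex.exp (θ * Complex.I)))
      (F' := fun s θ => fderiv ℝ (fderiv ℝ f) (circleMap c s θ)
        (Complex.exp (θ * Complex.I)) (Complex.exp (θ * Complex.I)))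
      (fun s => (hc'.comp (hm' s)).clm_apply he) ?_ (fun s θ => ?_) s
    · exact ((hc2.comp hm).clm_apply (he.comp continuous_snd)).clm_apply (he.comp continuous_snd)
    · have h1 := (hd' (circleMap c s θ)).hasFDerivAt.comp_hasDerivAt s
        (hasDerivAt_circleMap_radius c s θ)
      simpa using h1.clm_apply (hasDerivAt_const s (Complex.exp (θ * Complex.I)))
  have hθ : ∀ θ : ℝ, HasDerivAt
      (fun θ : ℝ => fderiv ℝ f (circleMap c s θ) (Complex.exp (θ * Complex.I) * Complex.I))
      (s * fderiv ℝ (fderiv ℝ f) (circleMap c s θ) (Complex.exp (θ * Complex.I) * Complex.I)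
        (Complex.exp (θ * Complex.I) * Complex.I)
        - fderiv ℝ f (circleMap c s θ) (Complex.exp (θ * Complex.I))) θ := by
    intro θ
    have h1 := (hd' (circleMap c s θ)).hasFDerivAt.comp_hasDerivAt θ (hasDerivAt_circleMap c s θ)
    have h2 : HasDerivAt (fun θ : ℝ => Complex.exp (θ * Complex.I) * Complex.I)
        (-Complex.exp (θ * Complex.I)) θ := by
      have h3 := ((hasDerivAt_circleMap 0 1 θ).mul_const Complex.I)
      simp only [circleMap_zero, Complex.ofReal_one, one_mul, mul_assoc, Complex.I_mul_I,
        mul_neg, mul_one] at h3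
      convert h3 using 1
    have h4 := h1.clm_apply h2
    refine h4.congr_deriv ?_
    have h5 : circleMap 0 s θ * Complex.I = s • (Complex.exp (θ * Complex.I) * Complex.I) := by
      simp [circleMap, mul_assoc]
    rw [h5, map_smul, smul_apply, map_neg, smul_eq_mul, ← sub_eq_add_neg]
    rfl
  have hcont1 : Continuous fun θ : ℝ => fderiv ℝ (fderiv ℝ f) (circleMap c s θ)
      (Complex.exp (θ * Complex.I) * Complex.I) (Complex.exp (θ * Complex.I) * Complex.I) :=
    ((hc2.comp (hm' s)).clm_apply (he.mul continuous_const)).clm_apply (he.mul continuous_const)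
  have hcont2 : Continuous fun θ : ℝ =>
      fderiv ℝ f (circleMap c s θ) (Complex.exp (θ * Complex.I)) :=
    (hc'.comp (hm' s)).clm_apply he
  have hcont3 : Continuous fun θ : ℝ => fderiv ℝ (fderiv ℝ f) (circleMap c s θ)
      (Complex.exp (θ * Complex.I)) (Complex.exp (θ * Complex.I)) :=
    ((hc2.comp (hm' s)).clm_apply he).clm_apply he
  have hcont1s : Continuous fun θ : ℝ => s * fderiv ℝ (fderiv ℝ f) (circleMap c s θ)
      (Complex.exp (θ * Complex.I) * Complex.I) (Complex.exp (θ * Complex.I) * Complex.I) :=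
    continuous_const.mul hcont1
  have hzero := intervalIntegral.integral_eq_sub_of_hasDerivAt (a := -Real.pi) (b := Real.pi)
    (fun θ _ => hθ θ) ((hcont1s.sub hcont2).intervalIntegrable _ _)
  have hper : circleMap c s (-Real.pi) = circleMap c s Real.pi := by
    simp [circleMap, Complex.exp_neg]
  have hend : Complex.exp (((-Real.pi : ℝ) : ℂ) * Complex.I)
      = Complex.exp ((Real.pi : ℂ) * Complex.I) := by
    simp [Complex.exp_neg]
  rw [hper, hend, sub_self, intervalIntegral.integral_sub
    (hcont1s.intervalIntegrable _ _) (hcont2.intervalIntegrable _ _),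
    intervalIntegral.integral_const_mul] at hzero
  have hΔ : angularIntegral (Laplacian.laplacian f) c s =
      (∫ θ in (-Real.pi)..Real.pi, fderiv ℝ (fderiv ℝ f) (circleMap c s θ)
        (Complex.exp (θ * Complex.I)) (Complex.exp (θ * Complex.I))) +
      ∫ θ in (-Real.pi)..Real.pi, fderiv ℝ (fderiv ℝ f) (circleMap c s θ)
        (Complex.exp (θ * Complex.I) * Complex.I) (Complex.exp (θ * Complex.I) * Complex.I) := by
    rw [← intervalIntegral.integral_add (hcont3.intervalIntegrable _ _)
      (hcont1.intervalIntegrable _ _)]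
    exact intervalIntegral.integral_congr fun θ _ => laplacian_eq_rotated f _ θ
  refine ((hasDerivAt_id s).mul hA).congr_deriv ?_
  rw [hΔ, mul_add]
  simp only [id]
  rw [show angularIntegralDeriv f c s = _ from (sub_eq_zero.1 hzero).symm]
  ring

theorem continuous_angularIntegral_laplacian (hf : ContDiff ℝ 2 f) (c : ℂ) :
    Continuous (angularIntegral (Laplacian.laplacian f) c) := by
  unfold angularIntegral
  apply intervalIntegral.continuous_parametric_intervalIntegral_of_continuous'
  exact (continuous_laplacian hf).comp (continuous_uncurry_circleMap c)

/-- Integration by parts against the radial logarithm. -/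
theorem integral_radial_log_mul (hf : ContDiff ℝ 2 f) (c : ℂ) (a : ℝ) {A : ℝ} (hA : 0 ≤ A) :
    ∫ s in (0 : ℝ)..A, (s * Real.log s + a * s) * angularIntegral (Laplacian.laplacian f) c s
      = (Real.log A + a) * (A * angularIntegralDeriv f c A) - angularIntegral f c A
        + 2 * Real.pi * f c := by
  have hd1 := hasDerivAt_angularIntegral hf c
  have hd2 := hasDerivAt_angularIntegralDeriv hf c
  have hcA : Continuous (angularIntegralDeriv f c) := by
    unfold angularIntegralDeriv
    apply intervalIntegral.continuous_parametric_intervalIntegral_of_continuous'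
    have he : Continuous fun t : ℝ => Complex.exp (t * Complex.I) := by fun_prop
    exact ((hf.continuous_fderiv (by simp)).comp (continuous_uncurry_circleMap c)).clm_apply
      (he.comp continuous_snd)
  have hcm : Continuous (angularIntegral f c) :=
    continuous_iff_continuousAt.2 fun s => (hd1 s).continuousAt
  have h0 : angularIntegral f c 0 = 2 * Real.pi * f c := by
    simp only [angularIntegral, circleMap_zero_radius, Function.const_apply,
      intervalIntegral.integral_const, smul_eq_mul]
    ring
  have key := intervalIntegral.integral_eq_sub_of_hasDerivAt_of_le hA
    (f := fun s => (s * Real.log s + a * s) * angularIntegralDeriv f c s - angularIntegral f c s)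
    (f' := fun s => (s * Real.log s + a * s) * angularIntegral (Laplacian.laplacian f) c s)
    (Continuous.continuousOn (((Real.continuous_mul_log.add (by fun_prop)).mul hcA).sub hcm))
    (fun s hs => ?_)
    (Continuous.intervalIntegrable ((Real.continuous_mul_log.add (by fun_prop)).mul
      (continuous_angularIntegral_laplacian hf c)) _ _)
  · rw [key]
    simp only [h0, Real.log_zero]
    ring
  · have h1 : HasDerivAt (fun s => (Real.log s + a) * (s * angularIntegralDeriv f c s)
        - angularIntegral f c s)
        (s⁻¹ * (s * angularIntegralDeriv f c s) + (Real.log s + a)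
          * (s * angularIntegral (Laplacian.laplacian f) c s) - angularIntegralDeriv f c s) s :=
      (((Real.hasDerivAt_log hs.1.ne').add_const a).mul (hd2 s)).sub (hd1 s)
    refine (h1.congr_deriv ?_).congr_of_eventuallyEq (.of_forall fun x => ?_)
    · have := hs.1.ne'
      field_simp
      ring
    · simp only; ring

end radial

theorem hasCompactSupport_laplacian {f : ℂ → ℝ} (hs : HasCompactSupport f) :
    HasCompactSupport (Laplacian.laplacian f) := by
  refine hs.mono' ?_
  intro x hx
  by_contra h
  refine hx ?_
  have h2 : f =ᶠ[nhds x] fun _ => (0 : ℝ) := notMem_tsupport_iff_eventuallyEq.1 h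
  have h3 := InnerProductSpace.laplacian_congr_nhds h2
  rw [h3.eq_of_nhds]
  simp

theorem polarCoord_symm_eq_circleMap (p : ℝ × ℝ) :
    Complex.polarCoord.symm p = circleMap 0 p.1 p.2 := by
  rw [Complex.polarCoord_symm_apply, circleMap_zero, Complex.exp_mul_I]
  simp

/-- `(2π)⁻¹ log ‖·‖` is a fundamental solution of the Laplace equation in the plane. -/
theorem integral_log_mul_laplacian_zero {f : ℂ → ℝ} (hf : ContDiff ℝ 2 f)
    (hs : HasCompactSupport f) (a : ℝ) (c : ℂ) :
    ∫ w, (Real.log ‖w‖ + a) * Laplacian.laplacian f (c + w) = 2 * Real.pi * f c := by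
  obtain ⟨A, hA0, hA⟩ : ∃ A : ℝ, 0 < A ∧ ∀ w : ℂ, A ≤ ‖w‖ → c + w ∉ tsupport f := by
    obtain ⟨B, hB⟩ := hs.isCompact.isBounded.exists_norm_le
    refine ⟨|B| + ‖c‖ + 1, by positivity, fun w hw hmem => ?_⟩
    have h1 := hB _ hmem
    have h2 : ‖w‖ ≤ ‖c + w‖ + ‖c‖ := by
      simpa using norm_sub_le (c + w) c
    linarith [le_abs_self B]
  have hz : ∀ w : ℂ, A ≤ ‖w‖ → f =ᶠ[nhds (c + w)] 0 :=
    fun w hw => notMem_tsupport_iff_eventuallyEq.1 (hA w hw)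
  have hzΔ : ∀ w : ℂ, A ≤ ‖w‖ → Laplacian.laplacian f (c + w) = 0 := by
    intro w hw
    have h3 := InnerProductSpace.laplacian_congr_nhds (f₂ := fun _ => (0 : ℝ)) (hz w hw)
    rw [h3.eq_of_nhds]
    simp
  have hcirc : ∀ s θ : ℝ, c + circleMap 0 s θ = circleMap c s θ := by
    intro s θ; simp [circleMap]
  have hnorm : ∀ s θ : ℝ, 0 ≤ s → ‖circleMap 0 s θ‖ = s := by
    intro s θ hs; simp [abs_of_nonneg hs]
  rw [← Complex.integral_comp_polarCoord_symm]
  have hcont : Continuous fun p : ℝ × ℝ => (p.1 * Real.log p.1 + a * p.1)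
      * Laplacian.laplacian f (circleMap c p.1 p.2) :=
    ((Real.continuous_mul_log.comp continuous_fst).add (by fun_prop)).mul
      ((continuous_laplacian hf).comp (continuous_uncurry_circleMap c))
  have h1 : ∫ p in polarCoord.target, p.1 • ((Real.log ‖Complex.polarCoord.symm p‖ + a) *
      Laplacian.laplacian f (c + Complex.polarCoord.symm p))
      = ∫ p in Ioc 0 A ×ˢ Ioc (-Real.pi) Real.pi, (p.1 * Real.log p.1 + a * p.1)
        * Laplacian.laplacian f (circleMap c p.1 p.2) := by
    have hsub : Ioo 0 A ×ˢ Ioo (-Real.pi) Real.pi ⊆ polarCoord.target := by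
      rw [polarCoord_target]
      exact prod_mono (fun x hx => hx.1) subset_rfl
    have hae : (Ioo 0 A ×ˢ Ioo (-Real.pi) Real.pi : Set (ℝ × ℝ)) =ᵐ[volume]
        (Ioc 0 A ×ˢ Ioc (-Real.pi) Real.pi : Set (ℝ × ℝ)) :=
      Measure.set_prod_ae_eq Ioo_ae_eq_Ioc Ioo_ae_eq_Ioc
    rw [← setIntegral_congr_set hae]
    rw [← setIntegral_eq_of_subset_of_forall_sdiff_eq_zero
      (t := polarCoord.target) (s := Ioo 0 A ×ˢ Ioo (-Real.pi) Real.pi)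
      polarCoord.open_target.measurableSet hsub]
    · refine setIntegral_congr_fun polarCoord.open_target.measurableSet fun p hp => ?_
      rw [polarCoord_target] at hp
      have : 0 < p.1 := hp.1
      simp only [polarCoord_symm_eq_circleMap, hcirc, hnorm p.1 p.2 this.le, smul_eq_mul]
      ring
    · rintro p ⟨hp, hp'⟩
      rw [polarCoord_target] at hp
      have hpA : A ≤ p.1 := by
        by_contra hlt
        exact hp' ⟨⟨hp.1, not_le.1 hlt⟩, hp.2⟩
      rw [← hcirc, hzΔ _ (by rw [hnorm _ _ (le_of_lt hp.1)]; exact hpA)]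
      simp
  rw [h1, Measure.volume_eq_prod, setIntegral_prod]
  · have h2 := integral_radial_log_mul hf c a hA0.le
    have h3 : angularIntegralDeriv f c A = 0 := by
      unfold angularIntegralDeriv
      rw [intervalIntegral.integral_congr (g := fun _ => (0 : ℝ))]
      · simp
      · intro θ _
        have h4 := (hz (circleMap 0 A θ) (by rw [hnorm _ _ hA0.le])).fderiv_eq (𝕜 := ℝ)
        rw [hcirc] at h4
        simp [h4]
    have h5 : angularIntegral f c A = 0 := by
      unfold angularIntegral
      rw [intervalIntegral.integral_congr (g := fun _ => (0 : ℝ))]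
      · simp
      · intro θ _
        have h4 := (hz (circleMap 0 A θ) (by rw [hnorm _ _ hA0.le])).eq_of_nhds
        rw [hcirc] at h4
        simpa using h4
    rw [h3, h5, mul_zero, mul_zero, sub_zero, zero_add] at h2
    rw [← h2, intervalIntegral.integral_of_le hA0.le]
    refine setIntegral_congr_fun measurableSet_Ioc fun s _ => ?_
    simp only
    rw [integral_const_mul, angularIntegral,
      intervalIntegral.integral_of_le (by linarith [Real.pi_pos])]
  · rw [← Measure.volume_eq_prod]
    exact (hcont.continuousOn.integrableOn_compact
      (isCompact_Icc.prod isCompact_Icc)).mono_set (prod_mono Ioc_subset_Icc_self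
        Ioc_subset_Icc_self)

theorem integral_log_mul_laplacian {f : ℂ → ℝ} (hf : ContDiff ℝ 2 f)
    (hs : HasCompactSupport f) (a : ℝ) (c : ℂ) :
    ∫ w, (Real.log ‖w - c‖ + a) * Laplacian.laplacian f w = 2 * Real.pi * f c := by
  rw [← integral_log_mul_laplacian_zero hf hs a c,
    ← integral_add_left_eq_self (fun w => (Real.log ‖w - c‖ + a) * Laplacian.laplacian f w) c]
  simp

section polar

theorem setLIntegral_Ioo_neg_pi_pi_eq (k : ℂ → ℝ≥0∞) (c : ℂ) (s : ℝ) :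
    ∫⁻ θ in Ioo (-Real.pi) Real.pi, k (circleMap c s θ)
      = ∫⁻ θ in Ioc 0 (2 * Real.pi), k (circleMap c s θ) := by
  have hp : (0 : ℝ) < 2 * Real.pi := Real.two_pi_pos
  have h1 := (isAddFundamentalDomain_Ioc hp (-Real.pi) volume).setLIntegral_eq
    (isAddFundamentalDomain_Ioc hp 0 volume) (fun θ => k (circleMap c s θ)) ?_
  · rw [setLIntegral_congr Ioo_ae_eq_Ioc]
    rw [zero_add, show -Real.pi + 2 * Real.pi = Real.pi by ring] at h1
    exact h1
  · rintro ⟨g, hg⟩ x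
    obtain ⟨n, rfl⟩ := AddSubgroup.mem_zmultiples_iff.1 hg
    congr 1
    rw [AddSubgroup.mk_vadd, vadd_eq_add, add_comm]
    exact (periodic_circleMap c s).zsmul n x

theorem lintegral_polar {k : ℂ → ℝ≥0∞} (hk : Measurable k) (c : ℂ) :
    ∫⁻ w, k (c + w) = ∫⁻ s in Ioi (0 : ℝ), ENNReal.ofReal s *
      ∫⁻ θ in Ioc 0 (2 * Real.pi), k (circleMap c s θ) := by
  rw [← Complex.lintegral_comp_polarCoord_symm, polarCoord_target, Measure.volume_eq_prod,
    ← Measure.prod_restrict, lintegral_prod]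
  · refine lintegral_congr fun s => ?_
    simp only [polarCoord_symm_eq_circleMap]
    rw [← setLIntegral_Ioo_neg_pi_pi_eq, ← lintegral_const_mul]
    · simp only [circleMap, smul_eq_mul, zero_add]
    · exact hk.comp (by fun_prop)
  · simp only [polarCoord_symm_eq_circleMap]
    have := (continuous_uncurry_circleMap 0).measurable
    have h2 : Measurable fun p : ℝ × ℝ => k (c + circleMap 0 p.1 p.2) :=
      hk.comp (measurable_const.add this)
    have h3 : Measurable fun p : ℝ × ℝ => ENNReal.ofReal p.1 := by fun_prop
    exact (h3.smul h2).aemeasurable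

end polar

theorem integrableOn_log_norm_ball (A : ℝ) :
    IntegrableOn (fun w : ℂ => Real.log ‖w‖) (Metric.ball 0 A) := by
  have hm : Measurable fun w : ℂ => Real.log ‖w‖ := by fun_prop
  refine ⟨hm.aestronglyMeasurable, ?_⟩
  obtain ⟨C, hC⟩ := (isCompact_Icc (a := (0 : ℝ)) (b := A)).exists_bound_of_continuousOn
    Real.continuous_mul_log.continuousOn
  unfold HasFiniteIntegral
  rw [← lintegral_indicator Metric.isOpen_ball.measurableSet]
  have hm2 : Measurable ((Metric.ball (0 : ℂ) A).indicator fun w : ℂ => ‖Real.log ‖w‖‖ₑ) :=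
    (hm.enorm).indicator Metric.isOpen_ball.measurableSet
  have h1 := lintegral_polar hm2 0
  simp only [zero_add] at h1
  rw [h1]
  calc _ ≤ ∫⁻ s in Ioi (0 : ℝ), (Ioo 0 A).indicator
        (fun _ => ENNReal.ofReal C * ENNReal.ofReal (2 * Real.pi)) s := by
        refine setLIntegral_mono' measurableSet_Ioi fun s hs => ?_
        by_cases hsA : s < A
        · rw [indicator_of_mem (show s ∈ Ioo 0 A from ⟨hs, hsA⟩)]
          calc _ ≤ ENNReal.ofReal s * ∫⁻ θ in Ioc 0 (2 * Real.pi), ‖Real.log s‖ₑ := by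
                gcongr with θ
                refine (indicator_le_self _ _ _).trans ?_
                simp [abs_of_pos (show 0 < s from hs)]
            _ = ENNReal.ofReal (‖s * Real.log s‖) * ENNReal.ofReal (2 * Real.pi) := by
                rw [setLIntegral_const, Real.volume_Ioc, sub_zero, ← mul_assoc, norm_mul,
                  ENNReal.ofReal_mul (norm_nonneg _), Real.norm_of_nonneg (le_of_lt hs),
                  ofReal_norm]
            _ ≤ _ := by
                gcongr
                exact hC s ⟨le_of_lt hs, hsA.le⟩
        · have : ∀ θ, (Metric.ball (0 : ℂ) A).indicator (fun w : ℂ => ‖Real.log ‖w‖‖ₑ)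
              (circleMap 0 s θ) = 0 := by
            intro θ
            refine indicator_of_notMem ?_ _
            simp only [Metric.mem_ball, dist_zero_right, norm_circleMap_zero]
            exact not_lt.2 ((not_lt.1 hsA).trans (le_abs_self s))
          simp [this]
    _ < ⊤ := by
        refine (setLIntegral_le_lintegral _ _).trans_lt ?_
        rw [lintegral_indicator measurableSet_Ioo, setLIntegral_const]
        simp [ENNReal.mul_lt_top_iff]

section green

open ComplexConjugate

/-- Green's function of the disc `‖w‖ < R` with pole `z`, extended by zero outside the disc. -/
def green (R : ℝ) (z w : ℂ) : ℝ :=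
  Real.posLog (‖(R : ℂ) ^ 2 - conj z * w‖ / (R * ‖w - z‖))

/-- The regular part of Green's function. -/
def greenRegular (R : ℝ) (z w : ℂ) : ℝ :=
  Real.log (max (‖(R : ℂ) ^ 2 - conj z * w‖ / R) ‖w - z‖)

theorem norm_sq_sub_conj_mul (R : ℝ) (z w : ℂ) :
    ‖(R : ℂ) ^ 2 - conj z * w‖ ^ 2
      = R ^ 2 * ‖w - z‖ ^ 2 + (R ^ 2 - ‖z‖ ^ 2) * (R ^ 2 - ‖w‖ ^ 2) := by
  simp only [← Complex.normSq_eq_norm_sq, Complex.normSq_apply, ← Complex.ofReal_pow,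
    Complex.sub_re, Complex.sub_im, Complex.mul_re, Complex.mul_im, Complex.ofReal_re,
    Complex.ofReal_im, Complex.conj_re, Complex.conj_im]
  ring

theorem norm_sq_sub_conj_mul_comm (R : ℝ) (z w : ℂ) :
    ‖(R : ℂ) ^ 2 - conj z * w‖ = ‖(R : ℂ) ^ 2 - conj w * z‖ := by
  rw [← Complex.norm_conj]
  simp [mul_comm]

variable {R : ℝ} {z w : ℂ}

theorem le_norm_sq_sub_conj_mul (hR : 0 < R) (hz : ‖z‖ ≤ R) (hw : ‖w‖ ≤ R) :
    R * ‖w - z‖ ≤ ‖(R : ℂ) ^ 2 - conj z * w‖ := by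
  refine abs_le_of_sq_le_sq' ?_ (norm_nonneg _) |>.2
  rw [norm_sq_sub_conj_mul, mul_pow]
  have : 0 ≤ (R ^ 2 - ‖z‖ ^ 2) * (R ^ 2 - ‖w‖ ^ 2) :=
    mul_nonneg (by nlinarith [norm_nonneg z]) (by nlinarith [norm_nonneg w])
  linarith

theorem norm_sq_sub_conj_mul_le (hR : 0 < R) (hz : ‖z‖ ≤ R) (hw : R ≤ ‖w‖) :
    ‖(R : ℂ) ^ 2 - conj z * w‖ ≤ R * ‖w - z‖ := by
  refine abs_le_of_sq_le_sq' ?_ (by positivity) |>.2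
  rw [norm_sq_sub_conj_mul, mul_pow]
  have : 0 ≤ (R ^ 2 - ‖z‖ ^ 2) * (‖w‖ ^ 2 - R ^ 2) :=
    mul_nonneg (by nlinarith [norm_nonneg z]) (by nlinarith [norm_nonneg w])
  linarith

theorem max_green_pos (hR : 0 < R) (hz : ‖z‖ < R) (w : ℂ) :
    0 < max (‖(R : ℂ) ^ 2 - conj z * w‖ / R) ‖w - z‖ := by
  rcases eq_or_ne w z with rfl | h
  · refine lt_max_of_lt_left (div_pos (norm_pos_iff.2 fun h0 => ?_) hR)
    have h1 := norm_sq_sub_conj_mul R w w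
    rw [h0] at h1
    simp only [norm_zero, sub_self] at h1
    nlinarith [norm_nonneg w, sq_nonneg ‖w‖, mul_pos (sub_pos.2 hz)
      (by positivity : 0 < R + ‖w‖)]
  · exact lt_max_of_lt_right (norm_pos_iff.2 (sub_ne_zero.2 h))

theorem continuous_greenRegular (hR : 0 < R) (hz : ‖z‖ < R) : Continuous (greenRegular R z) := by
  unfold greenRegular
  refine Continuous.log (by fun_prop) fun w => (max_green_pos hR hz w).ne'

theorem green_eq (hR : 0 < R) (hz : ‖z‖ < R) (hw : w ≠ z) :
    green R z w = greenRegular R z w - Real.log ‖w - z‖ := by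
  have h0 : 0 < ‖w - z‖ := norm_pos_iff.2 (sub_ne_zero.2 hw)
  unfold green greenRegular
  rw [← Real.log_div (max_green_pos hR hz w).ne' h0.ne', ← max_div_div_right h0.le,
    div_self h0.ne', div_div, max_comm, Real.posLog_eq_log_max_one (by positivity)]

theorem green_nonneg (R : ℝ) (z w : ℂ) : 0 ≤ green R z w := Real.posLog_nonneg

theorem measurable_green (R : ℝ) (z : ℂ) : Measurable (green R z) := by
  unfold green
  have : Measurable Real.posLog := by unfold Real.posLog; fun_prop
  exact this.comp (by fun_prop)

theorem green_eq_zero (hR : 0 < R) (hz : ‖z‖ ≤ R) (hw : R ≤ ‖w‖) : green R z w = 0 := by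
  unfold green
  rw [Real.posLog_eq_zero_iff, abs_of_nonneg (by positivity)]
  exact div_le_one_of_le₀ (norm_sq_sub_conj_mul_le hR hz hw) (by positivity)

theorem circleAverage_poissonKernel_log (hR : 0 < R) (hz : ‖z‖ < R) (hw : ‖w‖ ≠ R) :
    Real.circleAverage (poissonKernel 0 z • fun ζ => Real.log ‖ζ - w‖) 0 R
      = greenRegular R z w := by
  have hzb : z ∈ Metric.ball (0 : ℂ) R := by simpa using hz
  rcases hw.lt_or_gt with hw | hw
  · have h1 : Set.EqOn (poissonKernel 0 z • fun ζ => Real.log ‖ζ - w‖)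
        (poissonKernel 0 z • fun ζ => Real.log ‖((R : ℂ) ^ 2 - conj w * ζ) / R‖)
        (Metric.sphere 0 |R|) := by
      intro ζ hζ
      rw [abs_of_pos hR] at hζ
      have hζ' : ‖ζ‖ = R := by simpa using hζ
      have h2 : ‖(R : ℂ) ^ 2 - conj w * ζ‖ = R * ‖ζ - w‖ :=
        le_antisymm (norm_sq_sub_conj_mul_le hR hw.le hζ'.ge)
          (le_norm_sq_sub_conj_mul hR hw.le hζ'.le)
      simp only [Pi.smul_apply', norm_div, h2, Complex.norm_real, Real.norm_of_nonneg hR.le,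
        mul_div_cancel_left₀ _ hR.ne']
    have hne : ∀ ζ : ℂ, ‖ζ‖ ≤ R → ((R : ℂ) ^ 2 - conj w * ζ) / R ≠ 0 := by
      intro ζ hζ h0
      rw [div_eq_zero_iff, or_iff_left (by exact_mod_cast hR.ne'), sub_eq_zero] at h0
      have h3 := congrArg norm h0
      simp only [norm_mul, norm_pow, Complex.norm_real, Real.norm_of_nonneg hR.le,
        RCLike.norm_conj] at h3
      nlinarith [norm_nonneg ζ, norm_nonneg w]
    rw [Real.circleAverage_congr_sphere h1,
      InnerProductSpace.HarmonicOnNhd.circleAverage_poissonKernel_smul ?_ hzb]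
    · unfold greenRegular
      rw [max_eq_left, norm_div, Complex.norm_real, Real.norm_of_nonneg hR.le,
        norm_sq_sub_conj_mul_comm]
      rw [le_div_iff₀ hR, mul_comm]
      exact le_norm_sq_sub_conj_mul hR hz.le hw.le
    · intro x hx
      exact AnalyticAt.harmonicAt_log_norm (by fun_prop) (hne x (by simpa using hx))
  · rw [InnerProductSpace.HarmonicOnNhd.circleAverage_poissonKernel_smul ?_ hzb]
    · unfold greenRegular
      rw [max_eq_right, norm_sub_rev]
      rw [div_le_iff₀ hR, mul_comm ‖w - z‖]
      exact norm_sq_sub_conj_mul_le hR hz.le hw.le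
    · intro x hx
      refine AnalyticAt.harmonicAt_log_norm (by fun_prop) (sub_ne_zero.2 ?_)
      rintro rfl
      have : ‖x‖ ≤ R := by simpa using hx
      linarith

theorem poissonKernel_circleMap_le (hz : ‖z‖ < R) (θ : ℝ) :
    poissonKernel 0 z (circleMap 0 R θ) ≤ (R + ‖z‖) / (R - ‖z‖) := by
  have h := re_herglotzRieszKernel_le (c := 0) (w := z) (R := R)
    (circleMap_mem_sphere 0 ((norm_nonneg z).trans hz.le) θ) (by simpa using hz)
  rw [poissonKernel_eq_re_herglotzRieszKernel]
  simpa [herglotzRieszKernel] using h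

theorem le_poissonKernel_circleMap (hz : ‖z‖ < R) (θ : ℝ) :
    (R - ‖z‖) / (R + ‖z‖) ≤ poissonKernel 0 z (circleMap 0 R θ) := by
  have h := le_re_herglotzRieszKernel (c := 0) (w := z) (R := R)
    (circleMap_mem_sphere 0 ((norm_nonneg z).trans hz.le) θ) (by simpa using hz)
  rw [poissonKernel_eq_re_herglotzRieszKernel]
  simpa [herglotzRieszKernel] using h

theorem poissonKernel_circleMap_nonneg (hz : ‖z‖ < R) (θ : ℝ) :
    0 ≤ poissonKernel 0 z (circleMap 0 R θ) :=
  (div_nonneg (by linarith) (by linarith [norm_nonneg z])).trans (le_poissonKernel_circleMap hz θ)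

theorem continuous_poissonKernel_circleMap (hR : 0 < R) (hz : ‖z‖ < R) :
    Continuous fun θ => poissonKernel 0 z (circleMap 0 R θ) := by
  unfold poissonKernel
  refine Continuous.div (by fun_prop) (by fun_prop) fun θ => ?_
  simp only [sub_zero]
  refine pow_ne_zero 2 (norm_ne_zero_iff.2 (sub_ne_zero.2 ?_))
  rintro h
  have := congrArg norm h
  rw [norm_circleMap_zero, abs_of_pos hR] at this
  linarith

end green

theorem locallyIntegrable_log_norm_sub (z : ℂ) :
    LocallyIntegrable fun w : ℂ => Real.log ‖w - z‖ := by
  intro x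
  refine ⟨Metric.ball z (‖x - z‖ + 1), Metric.isOpen_ball.mem_nhds (by simp [dist_eq_norm]), ?_⟩
  have h := integrableOn_log_norm_ball (‖x - z‖ + 1)
  rw [← integrable_indicator_iff Metric.isOpen_ball.measurableSet] at h ⊢
  have h2 := h.comp_sub_right z
  refine h2.congr (.of_forall fun w => ?_)
  simp only [indicator, Metric.mem_ball, dist_eq_norm, sub_zero]

theorem integrable_log_mul_laplacian {f : ℂ → ℝ} (hf : ContDiff ℝ 2 f)
    (hs : HasCompactSupport f) (z : ℂ) :
    Integrable fun w => Real.log ‖w - z‖ * Laplacian.laplacian f w := by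
  simpa [mul_comm] using (locallyIntegrable_log_norm_sub z).integrable_smul_left_of_hasCompactSupport
    (continuous_laplacian hf) (hasCompactSupport_laplacian hs)

theorem integral_norm_log_mul_laplacian_le {f : ℂ → ℝ} (hf : ContDiff ℝ 2 f)
    (hs : HasCompactSupport f) (R : ℝ) :
    ∃ C, ∀ c : ℂ, ‖c‖ ≤ R → ∫ w, ‖Real.log ‖w - c‖ * Laplacian.laplacian f w‖ ≤ C := by
  have hΔs := hasCompactSupport_laplacian hs
  obtain ⟨B, hB⟩ := hΔs.isCompact.isBounded.exists_norm_le
  obtain ⟨D, hD⟩ := (continuous_laplacian hf).bounded_above_of_compact_support hΔs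
  have hD0 : 0 ≤ D := (norm_nonneg _).trans (hD 0)
  refine ⟨∫ w in Metric.ball (0 : ℂ) (B + R + 1), ‖Real.log ‖w‖‖ * D, fun c hc => ?_⟩
  rw [← integral_add_left_eq_self (fun w => ‖Real.log ‖w - c‖ * Laplacian.laplacian f w‖) c,
    ← integral_indicator Metric.isOpen_ball.measurableSet]
  have hInt : Integrable ((Metric.ball (0 : ℂ) (B + R + 1)).indicator
      fun w : ℂ => ‖Real.log ‖w‖‖ * D) :=
    (integrable_indicator_iff Metric.isOpen_ball.measurableSet).2
      ((integrableOn_log_norm_ball _).norm.mul_const D)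
  refine integral_mono_of_nonneg (.of_forall fun w => norm_nonneg _) hInt
    (.of_forall fun w => ?_)
  simp only [add_sub_cancel_left]
  by_cases hw : w ∈ Metric.ball (0 : ℂ) (B + R + 1)
  · rw [indicator_of_mem hw, norm_mul]
    gcongr
    exact hD _
  · rw [indicator_of_notMem hw, image_eq_zero_of_notMem_tsupport (f := Laplacian.laplacian f), mul_zero, norm_zero]
    intro hmem
    have h1 := hB _ hmem
    have h2 : ‖w‖ ≤ ‖c + w‖ + ‖c‖ := by simpa using norm_sub_le (c + w) c
    have h3 : B + R + 1 ≤ ‖w‖ := by simpa using hw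
    linarith

/-- Green's representation of the defect between Poisson integral and value. -/
theorem integral_green_mul_laplacian {f : ℂ → ℝ} (hf : ContDiff ℝ 2 f)
    (hs : HasCompactSupport f) {R : ℝ} {z : ℂ} (hR : 0 < R) (hz : ‖z‖ < R) :
    ∫ w, green R z w * Laplacian.laplacian f w
      = 2 * Real.pi * (Real.circleAverage (poissonKernel 0 z • f) 0 R - f z) := by
  have hΔ := continuous_laplacian hf
  have hΔs := hasCompactSupport_laplacian hs
  have hcP := continuous_poissonKernel_circleMap hR hz
  have h1 : ∫ w, green R z w * Laplacian.laplacian f w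
      = (∫ w, greenRegular R z w * Laplacian.laplacian f w)
        - ∫ w, Real.log ‖w - z‖ * Laplacian.laplacian f w := by
    rw [← integral_sub]
    · refine integral_congr_ae ?_
      filter_upwards [compl_mem_ae_iff.2 (measure_singleton z)] with w hw
      rw [green_eq hR hz hw]
      ring
    · exact ((continuous_greenRegular hR hz).mul hΔ).integrable_of_hasCompactSupport
        hΔs.mul_left
    · exact integrable_log_mul_laplacian hf hs z
  have h2 := integral_log_mul_laplacian hf hs 0 z
  simp only [add_zero] at h2
  have hsphere : volume {w : ℂ | ‖w‖ = R} = 0 := by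
    have := Measure.addHaar_sphere (volume : Measure ℂ) 0 R
    convert this using 2
    ext w
    simp
  have hInt : Integrable (fun p : ℝ × ℂ => poissonKernel 0 z (circleMap 0 R p.1) *
      (Real.log ‖p.2 - circleMap 0 R p.1‖ * Laplacian.laplacian f p.2))
      ((volume.restrict (Ioc 0 (2 * Real.pi))).prod volume) := by
    have hmeas : AEStronglyMeasurable (fun p : ℝ × ℂ => poissonKernel 0 z (circleMap 0 R p.1) *
        (Real.log ‖p.2 - circleMap 0 R p.1‖ * Laplacian.laplacian f p.2))
        ((volume.restrict (Ioc 0 (2 * Real.pi))).prod volume) := by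
      refine Measurable.aestronglyMeasurable ?_
      have h1 : Measurable fun p : ℝ × ℂ => poissonKernel 0 z (circleMap 0 R p.1) :=
        hcP.measurable.comp measurable_fst
      have h2 : Measurable fun p : ℝ × ℂ => Laplacian.laplacian f p.2 :=
        hΔ.measurable.comp measurable_snd
      have h3 : Measurable fun p : ℝ × ℂ => circleMap 0 R p.1 :=
        (continuous_circleMap 0 R).measurable.comp measurable_fst
      have h4 : Measurable fun p : ℝ × ℂ => Real.log ‖p.2 - circleMap 0 R p.1‖ :=
        Real.measurable_log.comp (measurable_snd.sub h3).norm
      exact h1.mul (h4.mul h2)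
    obtain ⟨C, hC⟩ := integral_norm_log_mul_laplacian_le hf hs R
    rw [integrable_prod_iff hmeas]
    refine ⟨.of_forall fun θ => (integrable_log_mul_laplacian hf hs (circleMap 0 R θ)).const_mul
      (poissonKernel 0 z (circleMap 0 R θ)), ?_⟩
    refine Integrable.of_bound hmeas.norm.integral_prod_right' ((R + ‖z‖) / (R - ‖z‖) * C)
      (.of_forall fun θ => ?_)
    rw [Real.norm_of_nonneg (integral_nonneg fun _ => norm_nonneg _)]
    simp only [norm_mul (poissonKernel _ _ _)]
    rw [integral_const_mul, Real.norm_of_nonneg (poissonKernel_circleMap_nonneg hz θ)]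
    have h3 := hC (circleMap 0 R θ) (by simp [abs_of_pos hR])
    exact mul_le_mul (poissonKernel_circleMap_le hz θ) h3
      (integral_nonneg fun _ => norm_nonneg _)
      (div_nonneg (by linarith [norm_nonneg z]) (by linarith))
  have h3 : ∫ w, greenRegular R z w * Laplacian.laplacian f w
      = 2 * Real.pi * Real.circleAverage (poissonKernel 0 z • f) 0 R := by
    have h4 : ∀ᵐ w : ℂ, greenRegular R z w * Laplacian.laplacian f w
        = (2 * Real.pi)⁻¹ * ∫ θ in Ioc 0 (2 * Real.pi), poissonKernel 0 z (circleMap 0 R θ) *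
          (Real.log ‖w - circleMap 0 R θ‖ * Laplacian.laplacian f w) := by
      filter_upwards [compl_mem_ae_iff.2 hsphere] with w hw
      rw [← circleAverage_poissonKernel_log hR hz hw, Real.circleAverage_def,
        intervalIntegral.integral_of_le Real.two_pi_pos.le, smul_eq_mul, mul_assoc,
        ← integral_mul_const]
      simp only [Pi.smul_apply', smul_eq_mul, mul_assoc, norm_sub_rev w]
    rw [integral_congr_ae h4, integral_const_mul, ← integral_integral_swap hInt,
      Real.circleAverage_def, intervalIntegral.integral_of_le Real.two_pi_pos.le, smul_eq_mul]
    rw [← mul_assoc, mul_inv_cancel₀ Real.two_pi_pos.ne', one_mul, ← integral_const_mul]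
    refine integral_congr_ae (.of_forall fun θ => ?_)
    have h5 := integral_log_mul_laplacian hf hs 0 (circleMap 0 R θ)
    simp only [add_zero] at h5
    simp only [integral_const_mul, h5, Pi.smul_apply', smul_eq_mul]
    have := Real.pi_pos
    field_simp
  rw [h1, h2, h3]
  ring

section

/-- An unnormalised smooth radial bump function supported in the disc of radius `ε`. -/
def radialBump (ε : ℝ) (w : ℂ) : ℝ := Real.smoothTransition (1 - ‖w‖ ^ 2 / ε ^ 2)

/-- A smooth radial probability density supported in the disc of radius `ε`. -/
def mollifier (ε : ℝ) (w : ℂ) : ℝ := (∫ x, radialBump ε x)⁻¹ * radialBump ε w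

variable {ε : ℝ}

theorem contDiff_radialBump (ε : ℝ) : ContDiff ℝ (⊤ : ℕ∞) (radialBump ε) := by
  unfold radialBump
  refine Real.smoothTransition.contDiff.comp ?_
  exact contDiff_const.sub ((contDiff_norm_sq ℝ).div_const _)

theorem radialBump_nonneg (ε : ℝ) (w : ℂ) : 0 ≤ radialBump ε w := Real.smoothTransition.nonneg _

theorem radialBump_eq_zero (hε : 0 < ε) {w : ℂ} (hw : ε ≤ ‖w‖) : radialBump ε w = 0 := by
  refine Real.smoothTransition.zero_of_nonpos ?_
  rw [sub_nonpos, one_le_div (by positivity)]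
  gcongr

theorem hasCompactSupport_radialBump (hε : 0 < ε) : HasCompactSupport (radialBump ε) := by
  refine HasCompactSupport.intro (isCompact_closedBall (0 : ℂ) ε) fun w hw => ?_
  refine radialBump_eq_zero hε (le_of_lt ?_)
  simpa using hw

theorem integral_radialBump_pos (hε : 0 < ε) : 0 < ∫ x, radialBump ε x := by
  have hc := (contDiff_radialBump ε).continuous
  refine hc.integral_pos_of_hasCompactSupport_nonneg_nonzero (hasCompactSupport_radialBump hε)
    (radialBump_nonneg ε) (x := 0) ?_
  simp [radialBump]

theorem contDiff_mollifier (ε : ℝ) : ContDiff ℝ (⊤ : ℕ∞) (mollifier ε) :=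
  contDiff_const.mul (contDiff_radialBump ε)

theorem continuous_mollifier (ε : ℝ) : Continuous (mollifier ε) := (contDiff_mollifier ε).continuous

theorem mollifier_nonneg (ε : ℝ) (w : ℂ) : 0 ≤ mollifier ε w :=
  mul_nonneg (inv_nonneg.2 (integral_nonneg (radialBump_nonneg ε))) (radialBump_nonneg ε w)

theorem mollifier_eq_zero (hε : 0 < ε) {w : ℂ} (hw : ε ≤ ‖w‖) : mollifier ε w = 0 := by
  rw [mollifier, radialBump_eq_zero hε hw, mul_zero]

theorem hasCompactSupport_mollifier (hε : 0 < ε) : HasCompactSupport (mollifier ε) :=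
  (hasCompactSupport_radialBump hε).mul_left

theorem mollifier_congr_norm {w w' : ℂ} (h : ‖w‖ = ‖w'‖) : mollifier ε w = mollifier ε w' := by
  simp only [mollifier, radialBump, h]

theorem mollifier_neg (w : ℂ) : mollifier ε (-w) = mollifier ε w :=
  mollifier_congr_norm (norm_neg w)

theorem mollifier_sub_comm (w z : ℂ) : mollifier ε (w - z) = mollifier ε (z - w) :=
  mollifier_congr_norm (norm_sub_rev w z)

theorem integral_mollifier (hε : 0 < ε) : ∫ x, mollifier ε x = 1 := by
  unfold mollifier
  rw [integral_const_mul, inv_mul_cancel₀ (integral_radialBump_pos hε).ne']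

theorem measurable_ofReal_mollifier (ε : ℝ) : Measurable fun x => ENNReal.ofReal (mollifier ε x) :=
  ENNReal.measurable_ofReal.comp (continuous_mollifier ε).measurable

theorem lintegral_mollifier (hε : 0 < ε) : ∫⁻ x, ENNReal.ofReal (mollifier ε x) = 1 := by
  rw [← ofReal_integral_eq_lintegral_ofReal, integral_mollifier hε, ENNReal.ofReal_one]
  · exact (continuous_mollifier ε).integrable_of_hasCompactSupport (hasCompactSupport_mollifier hε)
  · exact .of_forall (mollifier_nonneg ε)

/-- The mollification of `k` at scale `ε`. -/
def smoothing (ε : ℝ) (k : ℂ → ℝ≥0∞) (w : ℂ) : ℝ≥0∞ :=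
  ∫⁻ x, k (w + x) * ENNReal.ofReal (mollifier ε x)

theorem smoothing_eq (ε : ℝ) (k : ℂ → ℝ≥0∞) (w : ℂ) :
    smoothing ε k w = ∫⁻ x, k x * ENNReal.ofReal (mollifier ε (x - w)) := by
  rw [smoothing, ← lintegral_add_left_eq_self
    (fun x => k x * ENNReal.ofReal (mollifier ε (x - w))) w]
  simp

theorem measurable_smoothing (ε : ℝ) {k : ℂ → ℝ≥0∞} (hk : Measurable k) :
    Measurable (smoothing ε k) := by
  unfold smoothing
  refine Measurable.lintegral_prod_right' (f := fun p : ℂ × ℂ =>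
    k (p.1 + p.2) * ENNReal.ofReal (mollifier ε p.2)) ?_
  exact (hk.comp (by fun_prop)).mul ((measurable_ofReal_mollifier ε).comp measurable_snd)

/-- Radial mollification does not increase a function satisfying the super-mean inequality. -/
theorem smoothing_le (hε : 0 < ε) {k : ℂ → ℝ≥0∞} (hk : Measurable k) {w : ℂ}
    (h : ∀ s, 0 < s → s < ε →
      ∫⁻ θ in Ioc 0 (2 * Real.pi), k (circleMap w s θ) ≤ ENNReal.ofReal (2 * Real.pi) * k w) :
    smoothing ε k w ≤ k w := by
  have hm : Measurable fun x : ℂ => ENNReal.ofReal (mollifier ε (x - w)) :=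
    (measurable_ofReal_mollifier ε).comp (by fun_prop)
  have h1 := lintegral_polar (hk.mul hm) w
  have h2 := lintegral_polar ((measurable_const (a := k w)).mul hm) w
  have hρ : ∀ s θ : ℝ, mollifier ε (circleMap w s θ - w) = mollifier ε s := by
    intro s θ
    refine mollifier_congr_norm ?_
    simp [circleMap]
  simp only [Pi.mul_apply, add_sub_cancel_left, hρ] at h1 h2
  calc smoothing ε k w = _ := h1
    _ ≤ _ := by
        refine setLIntegral_mono' measurableSet_Ioi fun s hs => ?_
        gcongr ENNReal.ofReal s * ?_
        rw [setLIntegral_const, lintegral_mul_const _ (f := fun θ => k (circleMap w s θ))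
          (hk.comp (continuous_circleMap w s).measurable), Real.volume_Ioc,
          sub_zero]
        by_cases hsε : s < ε
        · calc _ ≤ ENNReal.ofReal (2 * Real.pi) * k w * ENNReal.ofReal (mollifier ε s) := by
                gcongr
                exact h s hs hsε
            _ = _ := by ring
        · rw [mollifier_eq_zero hε]
          · simp
          · rw [Complex.norm_real, Real.norm_of_nonneg (le_of_lt hs)]
            exact not_lt.1 hsε
    _ = _ := h2.symm
    _ = k w := by
        rw [lintegral_const_mul _ (measurable_ofReal_mollifier ε), lintegral_mollifier hε, mul_one]

theorem le_smoothing (hε : 0 < ε) {k : ℂ → ℝ≥0∞} {w : ℂ} {a : ℝ≥0∞}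
    (h : ∀ x, ‖x‖ < ε → a ≤ k (w + x)) : a ≤ smoothing ε k w := by
  calc a = ∫⁻ x, a * ENNReal.ofReal (mollifier ε x) := by
        rw [lintegral_const_mul _ (measurable_ofReal_mollifier ε), lintegral_mollifier hε, mul_one]
    _ ≤ _ := by
        refine lintegral_mono fun x => ?_
        by_cases hx : ‖x‖ < ε
        · simp only
          gcongr
          exact h x hx
        · simp [mollifier_eq_zero hε (not_lt.1 hx)]

theorem smoothing_le_of_le (hε : 0 < ε) {k : ℂ → ℝ≥0∞} {w : ℂ} {a : ℝ≥0∞}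
    (h : ∀ x, ‖x‖ < ε → k (w + x) ≤ a) : smoothing ε k w ≤ a := by
  calc _ ≤ ∫⁻ x, a * ENNReal.ofReal (mollifier ε x) := by
        refine lintegral_mono fun x => ?_
        by_cases hx : ‖x‖ < ε
        · simp only
          gcongr
          exact h x hx
        · simp [mollifier_eq_zero hε (not_lt.1 hx)]
    _ = a := by
        rw [lintegral_const_mul _ (measurable_ofReal_mollifier ε), lintegral_mollifier hε, mul_one]

theorem le_liminf_smoothing {δ : ℕ → ℝ} (hδ : ∀ n, 0 < δ n)
    (hδ0 : Filter.Tendsto δ Filter.atTop (nhds 0)) {k : ℂ → ℝ≥0∞} {w : ℂ}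
    (hk : LowerSemicontinuousAt k w) :
    k w ≤ Filter.liminf (fun n => smoothing (δ n) k w) Filter.atTop := by
  refine le_of_forall_lt fun a ha => ?_
  obtain ⟨b, hab, hb⟩ := exists_between ha
  refine hab.trans_le (Filter.le_liminf_of_le (by isBoundedDefault) ?_)
  obtain ⟨r, hr, hrb⟩ := Metric.eventually_nhds_iff.1 (hk b hb)
  filter_upwards [hδ0.eventually_lt_const hr] with n hn
  refine le_smoothing (hδ n) fun x hx => (hrb ?_).le
  simpa using hx.trans hn

section convolution

open scoped Convolution

theorem laplacian_eq_fderiv {f : ℂ → ℝ} (hf : ContDiff ℝ 2 f) (x : ℂ) :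
    Laplacian.laplacian f x = fderiv ℝ (fun y => fderiv ℝ f y 1) x 1
      + fderiv ℝ (fun y => fderiv ℝ f y Complex.I) x Complex.I := by
  rw [InnerProductSpace.laplacian_eq_iteratedFDeriv_complexPlane]
  simp only [iteratedFDeriv_two_apply, Matrix.cons_val_zero, Matrix.cons_val_one]
  have hd := (contDiff_one_fderiv hf).differentiable (by simp) x
  rw [fderiv_clm_apply hd (by fun_prop), fderiv_clm_apply hd (by fun_prop)]
  simp

theorem fderiv_comp_neg_apply {f : ℂ → ℝ} (hf : Differentiable ℝ f) (x : ℂ) :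
    fderiv ℝ (fun y => f (-y)) x = -fderiv ℝ f (-x) := by
  have h := ((hf (-x)).hasFDerivAt.comp x (hasFDerivAt_id x).neg).fderiv
  refine Eq.trans h ?_
  ext y
  simp

theorem laplacian_comp_neg {f : ℂ → ℝ} (hf : ContDiff ℝ 2 f) (he : ∀ x, f (-x) = f x) (x : ℂ) :
    Laplacian.laplacian f (-x) = Laplacian.laplacian f x := by
  have h1 : ∀ y, fderiv ℝ f (-y) = -fderiv ℝ f y := by
    intro y
    have h := fderiv_comp_neg_apply (hf.differentiable (by simp)) y
    simp only [he] at h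
    rw [h, neg_neg]
  have h2 : ∀ e : ℂ, fderiv ℝ (fun y => fderiv ℝ f y e) (-x)
      = fderiv ℝ (fun y => fderiv ℝ f y e) x := by
    intro e
    have h := fderiv_comp_neg_apply (f := fun y => fderiv ℝ f y e)
      (((contDiff_one_fderiv hf).clm_apply contDiff_const).differentiable (by simp)) x
    simp only [h1, neg_apply] at h
    rw [fderiv_fun_neg] at h
    exact (neg_injective h).symm
  rw [laplacian_eq_fderiv hf, laplacian_eq_fderiv hf, h2, h2]

theorem laplacian_comp_sub_const (f : ℂ → ℝ) (c x : ℂ) :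
    Laplacian.laplacian (fun y => f (y - c)) x = Laplacian.laplacian f (x - c) := by
  simp only [InnerProductSpace.laplacian_eq_iteratedFDeriv_complexPlane, sub_eq_add_neg,
    iteratedFDeriv_comp_add_right]

theorem fderiv_convolution_apply {f g : ℂ → ℝ} (hf : LocallyIntegrable f)
    (hg : ContDiff ℝ 1 g) (hgs : HasCompactSupport g) (x e : ℂ) :
    fderiv ℝ (f ⋆[ContinuousLinearMap.lsmul ℝ ℝ, volume] g) x e
      = (f ⋆[ContinuousLinearMap.lsmul ℝ ℝ, volume] fun y => fderiv ℝ g y e) x := by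
  rw [(hgs.hasFDerivAt_convolution_right _ hf hg x).fderiv]
  exact convolution_precompR_apply (ContinuousLinearMap.lsmul ℝ ℝ) hf (hgs.fderiv ℝ)
    (hg.continuous_fderiv (by simp)) x e

theorem laplacian_convolution {f g : ℂ → ℝ} (hf : LocallyIntegrable f)
    (hg : ContDiff ℝ (⊤ : ℕ∞) g) (hgs : HasCompactSupport g) (x : ℂ) :
    Laplacian.laplacian (f ⋆[ContinuousLinearMap.lsmul ℝ ℝ, volume] g) x
      = ∫ t, f t * Laplacian.laplacian g (x - t) := by
  have hg1 : ContDiff ℝ 1 g := hg.of_le (by exact_mod_cast le_top)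
  have hg2 : ContDiff ℝ 2 g := hg.of_le (WithTop.coe_le_coe.2 le_top)
  have hF : ContDiff ℝ 2 (f ⋆[ContinuousLinearMap.lsmul ℝ ℝ, volume] g) :=
    (hgs.contDiff_convolution_right (n := (⊤ : ℕ∞)) _ hf hg).of_le (WithTop.coe_le_coe.2 le_top)
  have hD : ∀ e : ℂ, ContDiff ℝ 1 fun y => fderiv ℝ g y e := fun e =>
    (contDiff_one_fderiv hg2).clm_apply contDiff_const
  have hDs : ∀ e : ℂ, HasCompactSupport fun y => fderiv ℝ g y e := fun e =>
    (hgs.fderiv ℝ).comp_left (g := fun L : ℂ →L[ℝ] ℝ => L e) (by simp)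
  have h2 : ∀ e : ℂ, fderiv ℝ (fun y => fderiv ℝ
      (f ⋆[ContinuousLinearMap.lsmul ℝ ℝ, volume] g) y e) x e
      = ∫ t, f t * fderiv ℝ (fun y => fderiv ℝ g y e) (x - t) e := by
    intro e
    simp only [fderiv_convolution_apply hf hg1 hgs]
    rw [fderiv_convolution_apply hf (hD e) (hDs e)]
    simp [convolution_def]
  have hi : ∀ e : ℂ, Integrable fun t => f t * fderiv ℝ (fun y => fderiv ℝ g y e) (x - t) e := by
    intro e
    have hc : Continuous fun t => fderiv ℝ (fun y => fderiv ℝ g y e) t e :=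
      ((hD e).continuous_fderiv (by simp)).clm_apply continuous_const
    have hs : HasCompactSupport fun t => fderiv ℝ (fun y => fderiv ℝ g y e) t e :=
      ((hDs e).fderiv ℝ).comp_left (g := fun L : ℂ →L[ℝ] ℝ => L e) (by simp)
    exact (hs.convolutionExists_right (ContinuousLinearMap.lsmul ℝ ℝ) hf hc) x
  rw [laplacian_eq_fderiv hF, h2, h2, ← integral_add (hi _) (hi _)]
  refine integral_congr_ae (.of_forall fun t => ?_)
  simp only [laplacian_eq_fderiv hg2]
  ring

end convolution

end

section

/-- A nonnegative integrable function on the plane that is superharmonic on the open set `V`. -/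
structure PosSuperharmonicOn (h : ℂ → ℝ≥0∞) (V : Set ℂ) : Prop where
  isOpen : IsOpen V
  measurable : Measurable h
  lsc : ∀ z ∈ V, LowerSemicontinuousAt h z
  supermean : ∀ z s, 0 < s → Metric.closedBall z s ⊆ V →
    ∫⁻ θ in Ioc 0 (2 * Real.pi), h (circleMap z s θ) ≤ ENNReal.ofReal (2 * Real.pi) * h z
  lintegral_ne_top : ∫⁻ z, h z ≠ ⊤

/-- `μ` is `-(2π)⁻¹ Δh` on `V`, in the sense of distributions. -/
structure IsNegLaplacianOn (μ : Measure ℂ) (h : ℂ → ℝ≥0∞) (V : Set ℂ) : Prop where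
  finite_on_compacts : ∀ K : Set ℂ, IsCompact K → K ⊆ V → μ K < ⊤
  integral_eq : ∀ φ : ℂ → ℝ, ContDiff ℝ (⊤ : ℕ∞) φ → HasCompactSupport φ → tsupport φ ⊆ V →
    ∫ z, φ z ∂μ = -((2 * Real.pi)⁻¹ * ∫ z, (h z).toReal * Laplacian.laplacian φ z)

/-- Green's function of the disc `‖w‖ < R`, with its infinite value at the pole. -/
def greenE (R : ℝ) (z w : ℂ) : ℝ≥0∞ := if w = z then ⊤ else ENNReal.ofReal (green R z w)

/-- The Poisson integral of a nonnegative function on the circle of radius `R`. -/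
def poissonLIntegral (R : ℝ) (z : ℂ) (h : ℂ → ℝ≥0∞) : ℝ≥0∞ :=
  ENNReal.ofReal (2 * Real.pi)⁻¹ * ∫⁻ θ in Ioc 0 (2 * Real.pi),
    ENNReal.ofReal (poissonKernel 0 z (circleMap 0 R θ)) * h (circleMap 0 R θ)

variable {R : ℝ} {z : ℂ}

theorem measurable_greenE (R : ℝ) (z : ℂ) : Measurable (greenE R z) :=
  Measurable.ite (measurableSet_singleton z) measurable_const
    (ENNReal.measurable_ofReal.comp (measurable_green R z))

theorem greenE_ae_eq (R : ℝ) (z : ℂ) :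
    greenE R z =ᵐ[volume] fun w => ENNReal.ofReal (green R z w) := by
  filter_upwards [compl_mem_ae_iff.2 (measure_singleton z)] with w hw
  exact if_neg hw

theorem greenE_eq_zero (hR : 0 < R) (hz : ‖z‖ < R) {w : ℂ} (hw : R ≤ ‖w‖) : greenE R z w = 0 := by
  unfold greenE
  rw [if_neg, green_eq_zero hR hz.le hw, ENNReal.ofReal_zero]
  rintro rfl
  linarith

theorem locallyIntegrable_green (hR : 0 < R) (hz : ‖z‖ < R) : LocallyIntegrable (green R z) := by
  have h := (continuous_greenRegular hR hz).locallyIntegrable (μ := volume) |>.sub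
    (locallyIntegrable_log_norm_sub z)
  refine h.congr ?_
  filter_upwards [compl_mem_ae_iff.2 (measure_singleton z)] with w hw
  exact (green_eq hR hz hw).symm

theorem lowerSemicontinuousAt_greenE (hR : 0 < R) (hz : ‖z‖ < R) (w : ℂ) :
    LowerSemicontinuousAt (greenE R z) w := by
  have hreg := continuous_greenRegular hR hz
  rcases eq_or_ne w z with rfl | hw
  · intro a ha
    have ha' : a ≠ ⊤ := by
      rintro rfl
      exact not_top_lt ha
    have hlog : Filter.Tendsto (fun y => greenRegular R w y - Real.log ‖y - w‖)
        (nhdsWithin w {w}ᶜ) Filter.atTop := by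
      simp only [sub_eq_add_neg]
      refine Filter.Tendsto.add_atTop (hreg.continuousAt.continuousWithinAt)
        (Filter.tendsto_neg_atBot_atTop.comp (Real.tendsto_log_nhdsGT_zero.comp ?_))
      exact tendsto_norm_sub_self_nhdsNE w
    have h1 := hlog.eventually_gt_atTop a.toReal
    rw [eventually_nhdsWithin_iff] at h1
    filter_upwards [h1] with y hy
    unfold greenE
    split_ifs with hyw
    · exact ha'.lt_top
    · rw [green_eq hR hz hyw]
      exact (ENNReal.lt_ofReal_iff_toReal_lt ha').2 (hy hyw)
  · have hc : ContinuousAt (greenE R z) w := by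
      have h1 : ContinuousAt (fun y => ENNReal.ofReal (greenRegular R z y - Real.log ‖y - z‖)) w := by
        refine ENNReal.continuous_ofReal.continuousAt.comp ?_
        exact hreg.continuousAt.sub ((by fun_prop : ContinuousAt (fun y => ‖y - z‖) w).log
          (norm_ne_zero_iff.2 (sub_ne_zero.2 hw)))
      refine h1.congr ?_
      filter_upwards [isOpen_compl_singleton.mem_nhds hw] with y hy
      rw [greenE, if_neg (show y ≠ z from hy), green_eq hR hz hy]
    exact hc.lowerSemicontinuousAt

section mollified

open scoped Convolution

variable {ε : ℝ}

/-- The mollified Green function. -/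
def greenMollified (R : ℝ) (z : ℂ) (ε : ℝ) : ℂ → ℝ :=
  green R z ⋆[ContinuousLinearMap.lsmul ℝ ℝ, volume] mollifier ε

theorem greenMollified_apply (w : ℂ) :
    greenMollified R z ε w = ∫ t, green R z t * mollifier ε (t - w) := by
  simp only [greenMollified, convolution_def, ContinuousLinearMap.lsmul_apply, smul_eq_mul,
    mollifier_sub_comm w]

theorem contDiff_greenMollified (hR : 0 < R) (hz : ‖z‖ < R) (hε : 0 < ε) :
    ContDiff ℝ (⊤ : ℕ∞) (greenMollified R z ε) :=
  (hasCompactSupport_mollifier hε).contDiff_convolution_right _ (locallyIntegrable_green hR hz)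
    (contDiff_mollifier ε)

theorem greenMollified_nonneg (w : ℂ) : 0 ≤ greenMollified R z ε w := by
  rw [greenMollified_apply]
  exact integral_nonneg fun t => mul_nonneg (green_nonneg _ _ _) (mollifier_nonneg _ _)

theorem integrable_green_mul_mollifier (hR : 0 < R) (hz : ‖z‖ < R) (hε : 0 < ε) (w : ℂ) :
    Integrable fun t => green R z t * mollifier ε (t - w) := by
  have h := (hasCompactSupport_mollifier hε).convolutionExists_right
    (ContinuousLinearMap.lsmul ℝ ℝ) (locallyIntegrable_green hR hz) (continuous_mollifier ε) w
  refine h.congr (.of_forall fun t => ?_)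
  simp [mollifier_sub_comm w]

theorem ofReal_greenMollified (hR : 0 < R) (hz : ‖z‖ < R) (hε : 0 < ε) (w : ℂ) :
    ENNReal.ofReal (greenMollified R z ε w) = smoothing ε (greenE R z) w := by
  rw [greenMollified_apply, smoothing_eq, ofReal_integral_eq_lintegral_ofReal
    (integrable_green_mul_mollifier hR hz hε w)
    (.of_forall fun t => mul_nonneg (green_nonneg _ _ _) (mollifier_nonneg _ _))]
  refine lintegral_congr_ae ?_
  filter_upwards [greenE_ae_eq R z] with t ht
  rw [ht, ENNReal.ofReal_mul (green_nonneg _ _ _)]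

theorem greenMollified_eq_zero (hR : 0 < R) (hz : ‖z‖ < R) (hε : 0 < ε) {w : ℂ}
    (hw : R + ε ≤ ‖w‖) : greenMollified R z ε w = 0 := by
  rw [greenMollified_apply, integral_eq_zero_of_ae]
  refine .of_forall fun t => ?_
  rcases le_or_gt R ‖t‖ with ht | ht
  · simp [green_eq_zero hR hz.le ht]
  · simp only [Pi.zero_apply]
    rw [mollifier_eq_zero hε, mul_zero]
    have := norm_sub_norm_le w t
    rw [norm_sub_rev] at this
    linarith

theorem tsupport_greenMollified_subset (hR : 0 < R) (hz : ‖z‖ < R) (hε : 0 < ε) :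
    tsupport (greenMollified R z ε) ⊆ Metric.closedBall 0 (R + ε) := by
  refine closure_minimal (fun w hw => ?_) Metric.isClosed_closedBall
  by_contra hn
  refine hw (greenMollified_eq_zero hR hz hε (le_of_lt ?_))
  simpa using hn

theorem hasCompactSupport_greenMollified (hR : 0 < R) (hz : ‖z‖ < R) (hε : 0 < ε) :
    HasCompactSupport (greenMollified R z ε) :=
  (isCompact_closedBall _ _).of_isClosed_subset (isClosed_tsupport _)
    (tsupport_greenMollified_subset hR hz hε)

theorem laplacian_greenMollified (hR : 0 < R) (hz : ‖z‖ < R) (hε : 0 < ε) (w : ℂ) :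
    Laplacian.laplacian (greenMollified R z ε) w
      = 2 * Real.pi * (Real.circleAverage (poissonKernel 0 z • fun y => mollifier ε (y - w)) 0 R
          - mollifier ε (z - w)) := by
  have h2 : ContDiff ℝ 2 (mollifier ε) := (contDiff_mollifier ε).of_le (WithTop.coe_le_coe.2 le_top)
  rw [greenMollified, laplacian_convolution (locallyIntegrable_green hR hz) (contDiff_mollifier ε)
    (hasCompactSupport_mollifier hε)]
  rw [← integral_green_mul_laplacian (f := fun y => mollifier ε (y - w))
    (h2.comp (contDiff_id.sub contDiff_const)) ?_ hR hz]
  · refine integral_congr_ae (.of_forall fun t => ?_)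
    simp only [laplacian_comp_sub_const]
    rw [← laplacian_comp_neg h2 mollifier_neg (w - t), neg_sub]
  · exact (hasCompactSupport_mollifier hε).comp_homeomorph (Homeomorph.subRight w)

theorem ofReal_circleAverage_poissonKernel_smul (hR : 0 < R) (hz : ‖z‖ < R) {f : ℂ → ℝ}
    (hf : Continuous f) (hf0 : ∀ w, 0 ≤ f w) :
    ENNReal.ofReal (Real.circleAverage (poissonKernel 0 z • f) 0 R)
      = poissonLIntegral R z fun w => ENNReal.ofReal (f w) := by
  have hc : Continuous fun θ => poissonKernel 0 z (circleMap 0 R θ) * f (circleMap 0 R θ) :=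
    (continuous_poissonKernel_circleMap hR hz).mul (by fun_prop)
  rw [Real.circleAverage_def, intervalIntegral.integral_of_le Real.two_pi_pos.le, smul_eq_mul,
    ENNReal.ofReal_mul (by positivity), poissonLIntegral]
  congr 1
  rw [ofReal_integral_eq_lintegral_ofReal]
  · refine lintegral_congr fun θ => ?_
    rw [Pi.smul_apply', smul_eq_mul, ENNReal.ofReal_mul (poissonKernel_circleMap_nonneg hz θ)]
  · exact (hc.integrableOn_Icc).mono_set Ioc_subset_Icc_self
  · exact .of_forall fun θ => mul_nonneg (poissonKernel_circleMap_nonneg hz θ) (hf0 _)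

theorem lintegral_mul_poissonLIntegral {h : ℂ → ℝ≥0∞} (hh : Measurable h) (hR : 0 < R)
    (hz : ‖z‖ < R) :
    ∫⁻ w, h w * poissonLIntegral R z (fun y => ENNReal.ofReal (mollifier ε (y - w)))
      = poissonLIntegral R z (smoothing ε h) := by
  have hP : Measurable fun θ => ENNReal.ofReal (poissonKernel 0 z (circleMap 0 R θ)) :=
    ENNReal.measurable_ofReal.comp (continuous_poissonKernel_circleMap hR hz).measurable
  have hρ : Measurable fun p : ℂ × ℝ => ENNReal.ofReal (mollifier ε (circleMap 0 R p.2 - p.1)) :=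
    ENNReal.measurable_ofReal.comp ((continuous_mollifier ε).comp (by fun_prop)).measurable
  have hm : Measurable fun p : ℂ × ℝ => h p.1 *
      (ENNReal.ofReal (poissonKernel 0 z (circleMap 0 R p.2)) *
        ENNReal.ofReal (mollifier ε (circleMap 0 R p.2 - p.1))) :=
    (hh.comp measurable_fst).mul ((hP.comp measurable_snd).mul hρ)
  have h1 : ∀ w, h w * poissonLIntegral R z (fun y => ENNReal.ofReal (mollifier ε (y - w)))
      = ENNReal.ofReal (2 * Real.pi)⁻¹ * ∫⁻ θ in Ioc 0 (2 * Real.pi), h w *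
      (ENNReal.ofReal (poissonKernel 0 z (circleMap 0 R θ)) *
        ENNReal.ofReal (mollifier ε (circleMap 0 R θ - w))) := by
    intro w
    have h2 : Measurable fun θ => ENNReal.ofReal (poissonKernel 0 z (circleMap 0 R θ)) *
        ENNReal.ofReal (mollifier ε (circleMap 0 R θ - w)) :=
      hP.mul (ENNReal.measurable_ofReal.comp
        ((continuous_mollifier ε).comp (by fun_prop : Continuous fun θ => circleMap 0 R θ - w)).measurable)
    rw [lintegral_const_mul _ h2, poissonLIntegral]
    ring
  simp only [h1]
  rw [lintegral_const_mul _ hm.lintegral_prod_right', poissonLIntegral,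
    lintegral_lintegral_swap hm.aemeasurable]
  congr 1
  refine lintegral_congr fun θ => ?_
  rw [smoothing_eq, ← lintegral_const_mul]
  · refine lintegral_congr fun w => ?_
    rw [mollifier_sub_comm]
    ring
  · exact hh.mul ((measurable_ofReal_mollifier ε).comp (by fun_prop))

variable {h : ℂ → ℝ≥0∞} {V : Set ℂ} {μ : Measure ℂ}

/-- The Poisson–Jensen formula for the mollified function. -/
theorem smoothing_eq_poisson_add_green (hh : PosSuperharmonicOn h V) (hμ : IsNegLaplacianOn μ h V)
    (hR : 0 < R) (hz : ‖z‖ < R) (hε : 0 < ε) (hV : Metric.closedBall 0 (R + ε) ⊆ V) :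
    poissonLIntegral R z (smoothing ε h) + ∫⁻ w, smoothing ε (greenE R z) w ∂μ
      = smoothing ε h z := by
  set φ := greenMollified R z ε with hφ
  have hφs := hasCompactSupport_greenMollified hR hz hε
  have hφd := contDiff_greenMollified hR hz hε
  have hφd2 : ContDiff ℝ 2 φ := hφd.of_le (WithTop.coe_le_coe.2 le_top)
  have hφt := (tsupport_greenMollified_subset hR hz hε).trans hV
  have hI := hμ.integral_eq φ hφd hφs hφt
  have hφint : Integrable φ μ := by
    obtain ⟨D, hD⟩ := hφd.continuous.bounded_above_of_compact_support hφs
    refine (integrableOn_iff_integrable_of_support_subset (subset_tsupport φ)).1 ?_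
    exact Measure.integrableOn_of_bounded (M := D)
      (hμ.finite_on_compacts _ hφs.isCompact hφt).ne
      hφd.continuous.aestronglyMeasurable (.of_forall hD)
  set A : ℂ → ℝ := fun w =>
    Real.circleAverage (poissonKernel 0 z • fun y => mollifier ε (y - w)) 0 R with hA
  have hAeq : ∀ w, A w = (2 * Real.pi)⁻¹ * Laplacian.laplacian φ w + mollifier ε (z - w) := by
    intro w
    rw [hφ, laplacian_greenMollified hR hz hε, hA]
    have := Real.pi_pos
    field_simp
    ring
  have hΔ := continuous_laplacian hφd2
  obtain ⟨D, hD⟩ := hΔ.bounded_above_of_compact_support (hasCompactSupport_laplacian hφs)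
  obtain ⟨D', hD'⟩ := (continuous_mollifier ε).bounded_above_of_compact_support
    (hasCompactSupport_mollifier hε)
  have hρc : Continuous fun w => mollifier ε (z - w) := (continuous_mollifier ε).comp (by fun_prop)
  have hAc : Continuous A := by
    rw [show A = _ from funext hAeq]
    exact (continuous_const.mul hΔ).add hρc
  have hA0 : ∀ w, 0 ≤ A w := fun w => by
    rw [hA]
    simp only [Real.circleAverage_def]
    refine smul_nonneg (by positivity) (intervalIntegral.integral_nonneg Real.two_pi_pos.le
      fun θ _ => mul_nonneg (poissonKernel_circleMap_nonneg hz θ) (mollifier_nonneg _ _))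
  have hhR : Integrable fun w => (h w).toReal :=
    integrable_toReal_of_lintegral_ne_top hh.measurable.aemeasurable hh.lintegral_ne_top
  have hi1 : Integrable fun w => (h w).toReal * mollifier ε (z - w) :=
    hhR.mul_bdd hρc.aestronglyMeasurable (.of_forall fun w => hD' _)
  have hiΔ : Integrable fun w => (h w).toReal * Laplacian.laplacian φ w :=
    hhR.mul_bdd hΔ.aestronglyMeasurable (.of_forall hD)
  have hi2 : Integrable fun w => (h w).toReal * A w := by
    refine ((hiΔ.const_mul (2 * Real.pi)⁻¹).add hi1).congr (.of_forall fun w => ?_)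
    simp only [hAeq, Pi.add_apply]
    ring
  have hfin : ∀ᵐ w, h w < ⊤ := ae_lt_top hh.measurable hh.lintegral_ne_top
  have hS : ENNReal.ofReal (∫ w, (h w).toReal * mollifier ε (z - w)) = smoothing ε h z := by
    rw [ofReal_integral_eq_lintegral_ofReal hi1
      (.of_forall fun w => mul_nonneg ENNReal.toReal_nonneg (mollifier_nonneg _ _)), smoothing_eq]
    refine lintegral_congr_ae ?_
    filter_upwards [hfin] with w hw
    rw [ENNReal.ofReal_mul ENNReal.toReal_nonneg, ENNReal.ofReal_toReal hw.ne, mollifier_sub_comm]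
  have hQ : ENNReal.ofReal (∫ w, (h w).toReal * A w) = poissonLIntegral R z (smoothing ε h) := by
    rw [ofReal_integral_eq_lintegral_ofReal hi2
      (.of_forall fun w => mul_nonneg ENNReal.toReal_nonneg (hA0 w)),
      ← lintegral_mul_poissonLIntegral hh.measurable hR hz]
    refine lintegral_congr_ae ?_
    filter_upwards [hfin] with w hw
    rw [ENNReal.ofReal_mul ENNReal.toReal_nonneg, ENNReal.ofReal_toReal hw.ne, hA]
    simp only
    rw [ofReal_circleAverage_poissonKernel_smul (f := fun y => mollifier ε (y - w)) hR hz
      ((continuous_mollifier ε).comp (by fun_prop)) fun _ => mollifier_nonneg _ _]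
  have hG : ENNReal.ofReal (∫ w, φ w ∂μ) = ∫⁻ w, smoothing ε (greenE R z) w ∂μ := by
    rw [ofReal_integral_eq_lintegral_ofReal hφint (.of_forall greenMollified_nonneg)]
    exact lintegral_congr fun w => ofReal_greenMollified hR hz hε w
  have hsum : (∫ w, (h w).toReal * A w) + ∫ w, φ w ∂μ
      = ∫ w, (h w).toReal * mollifier ε (z - w) := by
    have : ∫ w, (h w).toReal * A w = (2 * Real.pi)⁻¹ * (∫ w, (h w).toReal *
        Laplacian.laplacian φ w) + ∫ w, (h w).toReal * mollifier ε (z - w) := by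
      rw [← integral_const_mul, ← integral_add (hiΔ.const_mul _) hi1]
      refine integral_congr_ae (.of_forall fun w => ?_)
      simp only [hAeq]
      ring
    rw [this, hI]
    ring
  rw [← hQ, ← hG, ← hS, ← hsum, ENNReal.ofReal_add]
  · exact integral_nonneg fun w => mul_nonneg ENNReal.toReal_nonneg (hA0 w)
  · exact integral_nonneg greenMollified_nonneg

end mollified

section limit

variable {h : ℂ → ℝ≥0∞} {V : Set ℂ} {μ : Measure ℂ} {ε : ℝ}

theorem poissonLIntegral_mono {h₁ h₂ : ℂ → ℝ≥0∞}
    (H : ∀ θ, h₁ (circleMap 0 R θ) ≤ h₂ (circleMap 0 R θ)) :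
    poissonLIntegral R z h₁ ≤ poissonLIntegral R z h₂ := by
  unfold poissonLIntegral
  gcongr with θ
  exact H θ

/-- The truncated logarithmic potential of a point mass. -/
def logPotential (a : ℝ) (z w : ℂ) : ℝ≥0∞ :=
  if w = z then ⊤ else ENNReal.ofReal (a - Real.log ‖w - z‖)

theorem measurable_logPotential (a : ℝ) (z : ℂ) : Measurable (logPotential a z) :=
  Measurable.ite (measurableSet_singleton z) measurable_const (by fun_prop)

theorem logPotential_supermean {a s : ℝ} {z w : ℂ} (hs : 0 < s)
    (ha : ∀ y ∈ Metric.closedBall w s, y ≠ z → Real.log ‖y - z‖ ≤ a) :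
    ∫⁻ θ in Ioc 0 (2 * Real.pi), logPotential a z (circleMap w s θ)
      ≤ ENNReal.ofReal (2 * Real.pi) * logPotential a z w := by
  rcases eq_or_ne w z with rfl | hw
  · rw [logPotential, if_pos rfl, ENNReal.mul_top]
    · exact le_top
    · simp [Real.pi_pos]
  have hmem : ∀ θ, circleMap w s θ ∈ Metric.closedBall w s := fun θ =>
    circleMap_mem_closedBall w hs.le θ
  have hfin : {θ ∈ Ioc 0 (2 * Real.pi) | circleMap w s θ = z}.Countable := by
    refine Set.Finite.countable (Set.Subsingleton.finite fun x hx y hy => ?_)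
    have hinj := injOn_circleMap_of_abs_sub_le hs.ne' (c := w) (a := 0) (b := 2 * Real.pi)
      (by simp [abs_of_pos Real.pi_pos])
    rw [uIoc_of_le Real.two_pi_pos.le] at hinj
    exact hinj hx.1 hy.1 (hx.2.trans hy.2.symm)
  have hci := circleIntegrable_log_norm_sub_const (a := z) (c := w) s
  have hci' : IntegrableOn (fun θ => Real.log ‖circleMap w s θ - z‖) (Ioc 0 (2 * Real.pi)) :=
    (intervalIntegrable_iff_integrableOn_Ioc_of_le Real.two_pi_pos.le).1 hci
  have hInt : IntegrableOn (fun θ => a - Real.log ‖circleMap w s θ - z‖) (Ioc 0 (2 * Real.pi)) :=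
    (integrable_const a).sub hci'
  have hne : ∀ᵐ θ ∂(volume.restrict (Ioc 0 (2 * Real.pi))), circleMap w s θ ≠ z := by
    rw [ae_restrict_iff' measurableSet_Ioc]
    filter_upwards [compl_mem_ae_iff.2 (hfin.measure_zero volume)] with θ hθ h1 h2
    exact hθ ⟨h1, h2⟩
  calc ∫⁻ θ in Ioc 0 (2 * Real.pi), logPotential a z (circleMap w s θ)
      = ∫⁻ θ in Ioc 0 (2 * Real.pi), ENNReal.ofReal (a - Real.log ‖circleMap w s θ - z‖) := by
        refine lintegral_congr_ae ?_
        filter_upwards [hne] with θ hθ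
        exact if_neg hθ
    _ = ENNReal.ofReal (∫ θ in Ioc 0 (2 * Real.pi), (a - Real.log ‖circleMap w s θ - z‖)) := by
        rw [ofReal_integral_eq_lintegral_ofReal hInt]
        filter_upwards [hne] with θ hθ
        exact sub_nonneg.2 (ha _ (hmem θ) hθ)
    _ ≤ ENNReal.ofReal (2 * Real.pi * (a - Real.log ‖w - z‖)) := by
        refine ENNReal.ofReal_le_ofReal ?_
        have hav := circleAverage_log_norm_sub_const_eq_log_radius_add_posLog (a := z) (c := w)
          hs.ne'
        have h1 : Real.log ‖w - z‖ ≤ Real.circleAverage (fun y => Real.log ‖y - z‖) w s := by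
          rw [hav]
          have h0 : 0 < ‖w - z‖ := norm_pos_iff.2 (sub_ne_zero.2 hw)
          have h2 : Real.log (s⁻¹ * ‖w - z‖) ≤ Real.posLog (s⁻¹ * ‖w - z‖) := le_max_right _ _
          rw [Real.log_mul (by positivity) h0.ne', Real.log_inv] at h2
          linarith
        rw [Real.circleAverage_def, intervalIntegral.integral_of_le Real.two_pi_pos.le,
          smul_eq_mul] at h1
        rw [integral_sub (integrable_const a) hci']
        simp only [integral_const, MeasurableSet.univ, measureReal_restrict_apply, univ_inter,
          Real.volume_real_Ioc_of_le Real.two_pi_pos.le, sub_zero, smul_eq_mul]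
        have hp := Real.two_pi_pos
        have h3 := mul_le_mul_of_nonneg_left h1 hp.le
        rw [← mul_assoc, mul_inv_cancel₀ hp.ne', one_mul] at h3
        linarith
    _ = _ := by
        rw [logPotential, if_neg hw, ENNReal.ofReal_mul Real.two_pi_pos.le]

/-- Mollification increases Green's function at most slightly. -/
theorem exists_smoothing_greenE_le (hR : 0 < R) (hz : ‖z‖ < R) {η : ℝ} (hη : 0 < η) (B : ℝ) :
    ∃ δ > 0, ∀ ε, 0 < ε → ε < δ → ∀ w, ‖w‖ ≤ B →
      smoothing ε (greenE R z) w ≤ greenE R z w + ENNReal.ofReal η := by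
  have hreg := continuous_greenRegular hR hz
  have hK := isCompact_closedBall (0 : ℂ) (B + 1)
  obtain ⟨a, ha⟩ := hK.exists_bound_of_continuousOn hreg.continuousOn
  have ha' : ∀ w : ℂ, ‖w‖ ≤ B + 1 → greenRegular R z w ≤ a := fun w hw =>
    (le_abs_self _).trans (ha w (by simpa using hw))
  have huc := hK.uniformContinuousOn_of_continuous hreg.continuousOn
  obtain ⟨δ, hδ, hδu⟩ := Metric.uniformContinuousOn_iff.1 huc η hη
  refine ⟨min δ 1, lt_min hδ one_pos, fun ε hε hεδ w hw => ?_⟩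
  have hεδ' : ε < δ := hεδ.trans_le (min_le_left _ _)
  have hε1 : ε < 1 := hεδ.trans_le (min_le_right _ _)
  have hin : ∀ x : ℂ, ‖x‖ < ε → ‖w + x‖ ≤ B + 1 := fun x hx =>
    (norm_add_le w x).trans (by linarith)
  set c : ℂ → ℝ≥0∞ := fun y => ENNReal.ofReal (a - greenRegular R z y) with hc
  have hcm : Measurable c := ENNReal.measurable_ofReal.comp
    (measurable_const.sub hreg.measurable)
  have hsum : ∀ y : ℂ, ‖y‖ ≤ B + 1 → greenE R z y + c y = logPotential a z y := by
    intro y hy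
    unfold greenE logPotential
    split_ifs with hyz
    · simp
    · rw [hc]
      simp only
      rw [← ENNReal.ofReal_add (green_nonneg _ _ _) (sub_nonneg.2 (ha' y hy)),
        green_eq hR hz hyz]
      ring_nf
  have hw1 : ‖w‖ ≤ B + 1 := by linarith
  have hnear : ∀ x : ℂ, ‖x‖ < ε → |greenRegular R z w - greenRegular R z (w + x)| < η := by
    intro x hx
    have := hδu w (by simpa using hw1) (w + x) (by simpa using hin x hx)
      (by simpa using hx.trans hεδ')
    simpa [Real.dist_eq] using this
  have h1 : smoothing ε (greenE R z) w + smoothing ε c w ≤ greenE R z w + c w := by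
    rw [hsum w hw1]
    have h2 : smoothing ε (greenE R z) w + smoothing ε c w = smoothing ε (logPotential a z) w := by
      unfold smoothing
      have h3 : Measurable fun x => greenE R z (w + x) * ENNReal.ofReal (mollifier ε x) :=
        ((measurable_greenE R z).comp (measurable_const_add w)).mul (measurable_ofReal_mollifier ε)
      rw [← lintegral_add_left h3]
      refine lintegral_congr fun x => ?_
      by_cases hx : ‖x‖ < ε
      · rw [← hsum _ (hin x hx), add_mul]
      · simp [mollifier_eq_zero hε (not_lt.1 hx)]
    rw [h2]
    refine smoothing_le hε (measurable_logPotential a z) fun s hs hsε => ?_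
    refine logPotential_supermean hs fun y hy hyz => ?_
    have hy1 : ‖y‖ ≤ B + 1 := by
      have h3 : ‖y - w‖ ≤ s := by simpa [dist_eq_norm] using hy
      have h4 := norm_add_le (y - w) w
      rw [sub_add_cancel] at h4
      linarith
    have h5 := green_nonneg R z y
    rw [green_eq hR hz hyz] at h5
    linarith [ha' y hy1]
  have h3 : c w ≤ smoothing ε c w + ENNReal.ofReal η := by
    have h4 : ENNReal.ofReal (a - greenRegular R z w - η) ≤ smoothing ε c w := by
      refine le_smoothing hε fun x hx => ENNReal.ofReal_le_ofReal ?_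
      have := abs_lt.1 (hnear x hx)
      linarith [this.1]
    calc c w = ENNReal.ofReal ((a - greenRegular R z w - η) + η) := by rw [hc]; ring_nf
      _ ≤ ENNReal.ofReal (a - greenRegular R z w - η) + ENNReal.ofReal η := ENNReal.ofReal_add_le
      _ ≤ _ := by gcongr
  have h5 : smoothing ε c w ≠ ⊤ := by
    refine ne_top_of_le_ne_top (ENNReal.ofReal_ne_top (r := a - greenRegular R z w + η))
      (smoothing_le_of_le hε fun x hx => ENNReal.ofReal_le_ofReal ?_)
    have := abs_lt.1 (hnear x hx)
    linarith [this.2]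
  refine (ENNReal.add_le_add_iff_right h5).1 (h1.trans ?_)
  calc greenE R z w + c w ≤ greenE R z w + (smoothing ε c w + ENNReal.ofReal η) := by gcongr
    _ = _ := by ring

theorem liminf_add_liminf_le {a b : ℕ → ℝ≥0∞} {c : ℝ≥0∞} (H : ∀ n, a n + b n ≤ c) :
    Filter.liminf a Filter.atTop + Filter.liminf b Filter.atTop ≤ c := by
  rw [Filter.liminf_eq_iSup_iInf_of_nat, Filter.liminf_eq_iSup_iInf_of_nat,
    ENNReal.iSup_add_iSup_of_monotone]
  · exact iSup_le fun n => (add_le_add (iInf₂_le n le_rfl) (iInf₂_le n le_rfl)).trans (H n)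
  · exact fun m n hmn => le_iInf₂ fun i hi => iInf₂_le i (hmn.trans hi)
  · exact fun m n hmn => le_iInf₂ fun i hi => iInf₂_le i (hmn.trans hi)

/-- The **Poisson–Jensen formula** for positive superharmonic functions. -/
theorem poissonJensen (hh : PosSuperharmonicOn h V) (hμ : IsNegLaplacianOn μ h V)
    (hR : 0 < R) (hz : ‖z‖ < R) (hV : Metric.closedBall 0 R ⊆ V) :
    h z = poissonLIntegral R z h + ∫⁻ w, greenE R z w ∂μ := by
  obtain ⟨δ, hδ, hδV⟩ : ∃ δ > 0, Metric.closedBall (0 : ℂ) (R + δ) ⊆ V := by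
    obtain ⟨δ, hδ, hδV⟩ := (isCompact_closedBall (0 : ℂ) R).exists_cthickening_subset_open
      hh.isOpen hV
    refine ⟨δ, hδ, ?_⟩
    rwa [cthickening_closedBall hδ.le hR.le, add_comm] at hδV
  set d : ℕ → ℝ := fun n => δ / (n + 1) with hd
  have hd0 : ∀ n, 0 < d n := fun n => by positivity
  have hdδ : ∀ n, d n ≤ δ := fun n => div_le_self hδ.le (by linarith [n.cast_nonneg (α := ℝ)])
  have hdlim : Filter.Tendsto d Filter.atTop (nhds 0) := by
    have := (tendsto_one_div_add_atTop_nhds_zero_nat (𝕜 := ℝ)).const_mul δ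
    simpa [hd, div_eq_mul_inv] using this
  have hball : ∀ y : ℂ, ‖y‖ ≤ R → ∀ s < δ, Metric.closedBall y s ⊆ V := by
    intro y hy s hs x hx
    refine hδV ?_
    have h3 : ‖x - y‖ ≤ s := by simpa [dist_eq_norm] using hx
    have h4 := norm_add_le (x - y) y
    rw [sub_add_cancel] at h4
    simp only [Metric.mem_closedBall, dist_zero_right]
    linarith
  have hle : ∀ n, ∀ y : ℂ, ‖y‖ ≤ R → smoothing (d n) h y ≤ h y := fun n y hy =>
    smoothing_le (hd0 n) hh.measurable fun s hs hsd =>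
      hh.supermean y s hs (hball y hy s (hsd.trans_le (hdδ n)))
  have hcirc : ∀ θ, ‖circleMap 0 R θ‖ = R := fun θ => by simp [abs_of_pos hR]
  have hformula : ∀ n, poissonLIntegral R z (smoothing (d n) h)
      + ∫⁻ w, smoothing (d n) (greenE R z) w ∂μ = smoothing (d n) h z := fun n =>
    smoothing_eq_poisson_add_green hh hμ hR hz (hd0 n)
      ((Metric.closedBall_subset_closedBall (by linarith [hdδ n])).trans hδV)
  have hlscle : ∀ y : ℂ, ‖y‖ ≤ R →
      h y ≤ Filter.liminf (fun n => smoothing (d n) h y) Filter.atTop := fun y hy =>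
    le_liminf_smoothing hd0 hdlim (hh.lsc y (hV (by simpa using hy)))
  refine le_antisymm ?_ ?_
  · refine (hlscle z hz.le).trans ?_
    have hK := hμ.finite_on_compacts _ (isCompact_closedBall (0 : ℂ) (R + δ)) hδV
    have hmain : ∀ η : ℝ, 0 < η → Filter.liminf (fun n => smoothing (d n) h z) Filter.atTop
        ≤ poissonLIntegral R z h + ∫⁻ w, greenE R z w ∂μ
          + ENNReal.ofReal η * μ (Metric.closedBall 0 (R + δ)) := by
      intro η hη
      obtain ⟨δ', hδ', hsm⟩ := exists_smoothing_greenE_le hR hz hη (R + δ)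
      refine Filter.liminf_le_of_frequently_le' (Filter.Eventually.frequently ?_)
      filter_upwards [hdlim.eventually_lt_const hδ'] with n hn
      rw [← hformula n, add_assoc]
      gcongr
      · exact poissonLIntegral_mono fun θ => hle n _ (hcirc θ).le
      · rw [← setLIntegral_const, ← lintegral_indicator Metric.isClosed_closedBall.measurableSet,
          ← lintegral_add_left (measurable_greenE R z)]
        refine lintegral_mono fun w => ?_
        by_cases hw : ‖w‖ ≤ R + δ
        · rw [indicator_of_mem (by simpa using hw)]
          exact hsm (d n) (hd0 n) hn w hw
        · rw [← ofReal_greenMollified hR hz (hd0 n),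
            greenMollified_eq_zero hR hz (hd0 n) (by linarith [hdδ n, not_le.1 hw])]
          simp
    rcases eq_or_ne (poissonLIntegral R z h + ∫⁻ w, greenE R z w ∂μ) ⊤ with htop | htop
    · rw [htop]
      exact le_top
    have hlim : Filter.Tendsto (fun η : ℝ => poissonLIntegral R z h + ∫⁻ w, greenE R z w ∂μ
          + ENNReal.ofReal η * μ (Metric.closedBall 0 (R + δ))) (nhdsWithin 0 (Ioi 0))
        (nhds (poissonLIntegral R z h + ∫⁻ w, greenE R z w ∂μ
          + ENNReal.ofReal 0 * μ (Metric.closedBall 0 (R + δ)))) := by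
      refine Filter.Tendsto.add tendsto_const_nhds (ENNReal.Tendsto.mul_const ?_ (.inr hK.ne))
      exact (ENNReal.continuous_ofReal.tendsto 0).mono_left nhdsWithin_le_nhds
    rw [ENNReal.ofReal_zero, zero_mul, add_zero] at hlim
    exact ge_of_tendsto hlim (eventually_nhdsWithin_of_forall fun η hη => hmain η hη)
  · have hP : Measurable fun θ => ENNReal.ofReal (poissonKernel 0 z (circleMap 0 R θ)) :=
      ENNReal.measurable_ofReal.comp (continuous_poissonKernel_circleMap hR hz).measurable
    have h1 : poissonLIntegral R z h
        ≤ Filter.liminf (fun n => poissonLIntegral R z (smoothing (d n) h)) Filter.atTop := by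
      unfold poissonLIntegral
      rw [ENNReal.liminf_const_mul_of_ne_top ENNReal.ofReal_ne_top]
      gcongr
      refine le_trans (lintegral_mono fun θ => ?_) (lintegral_liminf_le fun n =>
        hP.mul ((measurable_smoothing (d n) hh.measurable).comp
          (continuous_circleMap 0 R).measurable))
      rw [ENNReal.liminf_const_mul_of_ne_top ENNReal.ofReal_ne_top]
      gcongr
      exact hlscle _ (hcirc θ).le
    have h2 : ∫⁻ w, greenE R z w ∂μ
        ≤ Filter.liminf (fun n => ∫⁻ w, smoothing (d n) (greenE R z) w ∂μ) Filter.atTop := by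
      refine le_trans (lintegral_mono fun w => ?_) (lintegral_liminf_le fun n =>
        measurable_smoothing (d n) (measurable_greenE R z))
      exact le_liminf_smoothing hd0 hdlim (lowerSemicontinuousAt_greenE hR hz w)
    refine (add_le_add h1 h2).trans (liminf_add_liminf_le fun n => ?_)
    rw [hformula n]
    exact hle n z hz.le

end limit

end

theorem toENNReal_const_sub_add {b : ℝ} (hb : 0 ≤ b) {x : EReal} (hx : x ≤ b) :
    ((b : EReal) - x).toENNReal + x.toENNReal = ENNReal.ofReal b + (-x).toENNReal := by
  induction x with
  | bot => simp
  | top => simp at hx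
  | coe c =>
    have hcb : c ≤ b := by exact_mod_cast hx
    rw [← EReal.coe_sub, ← EReal.coe_neg, EReal.toENNReal_of_ne_top (EReal.coe_ne_top _),
      EReal.toENNReal_of_ne_top (EReal.coe_ne_top _), EReal.toENNReal_of_ne_top (EReal.coe_ne_top _)]
    simp only [EReal.toReal_coe]
    rcases le_total 0 c with hc | hc
    · rw [ENNReal.ofReal_of_nonpos (neg_nonpos.2 hc), add_zero, ← ENNReal.ofReal_add (by linarith) hc]
      ring_nf
    · rw [ENNReal.ofReal_of_nonpos hc, add_zero, ← ENNReal.ofReal_add hb (by linarith)]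
      ring_nf

theorem continuous_coe_sub (b : ℝ) : Continuous fun x : EReal => (b : EReal) - x := by
  refine continuous_iff_continuousAt.2 fun x => ?_
  have h1 : ContinuousAt (fun p : EReal × EReal => p.1 + p.2) ((b : EReal), -x) :=
    EReal.continuousAt_add (.inl (EReal.coe_ne_top b)) (.inl (EReal.coe_ne_bot b))
  exact h1.comp (f := fun x : EReal => ((b : EReal), -x)) (by fun_prop)

theorem antitone_coe_sub (b : ℝ) : Antitone fun x : EReal => (b : EReal) - x :=
  fun _ _ hxy => EReal.sub_le_sub le_rfl hxy

theorem upperSemicontinuousAt_of_mem {u : ℂ → EReal} {O : Set ℂ} (hu : UpperSemicontinuousOn u O)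
    (hO : IsOpen O) {z : ℂ} (hz : z ∈ O) : UpperSemicontinuousAt u z := by
  intro y hy
  have := hu z hz y hy
  rwa [hO.nhdsWithin_eq hz] at this

namespace SubharmonicOn

variable {u : ℂ → EReal} {O : Set ℂ}

theorem exists_bound (hu : SubharmonicOn u O) {K : Set ℂ} (hK : IsCompact K) (hKO : K ⊆ O) :
    ∃ b : ℝ, 0 ≤ b ∧ ∀ z ∈ K, u z ≤ b := by
  rcases K.eq_empty_or_nonempty with rfl | hne
  · exact ⟨0, le_rfl, by simp⟩
  obtain ⟨a, haK, ha⟩ := UpperSemicontinuousOn.exists_isMaxOn hne hK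
    (fun z hz => (hu.usc z (hKO hz)).mono hKO)
  refine ⟨max 0 (u a).toReal, le_max_left _ _, fun z hz => (ha hz).trans ?_⟩
  refine (EReal.le_coe_toReal (hu.lt_top a (hKO haK)).ne).trans ?_
  exact_mod_cast le_max_right _ _

theorem supermean_const_sub (hu : SubharmonicOn u O) {b : ℝ} (hb : 0 ≤ b) {z : ℂ} {s : ℝ}
    (hs : 0 < s) (hball : Metric.closedBall z s ⊆ O)
    (hub : ∀ θ, u (circleMap z s θ) ≤ b) :
    ∫⁻ θ in Ioc 0 (2 * Real.pi), ((b : EReal) - u (circleMap z s θ)).toENNReal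
      ≤ ENNReal.ofReal (2 * Real.pi) * ((b : EReal) - u z).toENNReal := by
  have hp := Real.two_pi_pos
  have hmem : ∀ θ, circleMap z s θ ∈ O := fun θ => hball (circleMap_mem_closedBall z hs.le θ)
  have hmeas : Measurable fun θ => u (circleMap z s θ) := by
    refine UpperSemicontinuous.measurable (upperSemicontinuousOn_univ_iff.1 ?_)
    exact hu.usc.comp (continuous_circleMap z s).continuousOn fun θ _ => hmem θ
  have hsub := hu.submean z s hs hball
  have huz := hu.lt_top z (hball (Metric.mem_closedBall_self hs.le))
  rcases eq_or_ne (u z) ⊥ with hbot | hbot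
  · rw [hbot, EReal.coe_sub_bot, EReal.toENNReal_top, ENNReal.mul_top (by simp [Real.pi_pos])]
    exact le_top
  unfold circleMean eintegral at hsub
  set A := ∫⁻ θ in Ioc 0 (2 * Real.pi), (u (circleMap z s θ)).toENNReal with hA
  set B := ∫⁻ θ in Ioc 0 (2 * Real.pi), (-u (circleMap z s θ)).toENNReal with hB
  set H := ∫⁻ θ in Ioc 0 (2 * Real.pi), ((b : EReal) - u (circleMap z s θ)).toENNReal with hH
  have hAtop : A ≠ ⊤ := by
    refine ne_top_of_le_ne_top (b := ENNReal.ofReal b * ENNReal.ofReal (2 * Real.pi))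
      (by finiteness) ?_
    calc A ≤ ∫⁻ θ in Ioc 0 (2 * Real.pi), ENNReal.ofReal b := by
          refine lintegral_mono fun θ => ?_
          refine (EReal.toENNReal_le_toENNReal (hub θ)).trans ?_
          rw [EReal.toENNReal_of_ne_top (EReal.coe_ne_top _), EReal.toReal_coe]
      _ = _ := by rw [setLIntegral_const, Real.volume_Ioc, sub_zero]
  have hsum : H + A = ENNReal.ofReal b * ENNReal.ofReal (2 * Real.pi) + B := by
    have hvol : ENNReal.ofReal (2 * Real.pi) = volume (Ioc 0 (2 * Real.pi)) := by
      rw [Real.volume_Ioc, sub_zero]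
    rw [hH, hA, hB, ← lintegral_add_right _ hmeas.ereal_toENNReal, hvol, ← setLIntegral_const,
      ← lintegral_add_left measurable_const]
    exact lintegral_congr fun θ => toENNReal_const_sub_add hb (hub θ)
  have hBtop : B ≠ ⊤ := by
    intro h
    rw [h, EReal.coe_ennreal_top, EReal.sub_top, EReal.coe_mul_bot_of_pos (by positivity)] at hsub
    exact hbot (le_bot_iff.1 hsub)
  have hHtop : H ≠ ⊤ := by
    intro h
    rw [h, top_add] at hsum
    exact (by finiteness : ENNReal.ofReal b * ENNReal.ofReal (2 * Real.pi) + B ≠ ⊤) hsum.symm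
  lift u z to ℝ using ⟨huz.ne, hbot⟩ with c
  rw [← EReal.coe_sub, EReal.toENNReal_of_ne_top (EReal.coe_ne_top _), EReal.toReal_coe,
    ← ENNReal.ofReal_mul hp.le]
  clear_value A B H
  lift A to NNReal using hAtop
  lift B to NNReal using hBtop
  lift H to NNReal using hHtop
  have h1 : c ≤ (2 * Real.pi)⁻¹ * ((A : ℝ) - B) := by
    rw [EReal.coe_nnreal_eq_coe_real, EReal.coe_nnreal_eq_coe_real] at hsub
    exact_mod_cast hsub
  have h2 : (H : ℝ) + A = b * (2 * Real.pi) + B := by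
    have := congrArg ENNReal.toReal hsum
    rw [ENNReal.toReal_add, ENNReal.toReal_add, ENNReal.toReal_mul, ENNReal.toReal_ofReal hb,
      ENNReal.toReal_ofReal hp.le] at this
    · simpa using this
    all_goals finiteness
  have h3 : 2 * Real.pi * c ≤ (A : ℝ) - B := by
    rw [← div_eq_inv_mul, le_div_iff₀ hp] at h1
    linarith
  rw [← ENNReal.ofReal_coe_nnreal]
  refine ENNReal.ofReal_le_ofReal ?_
  linarith

end SubharmonicOn

/-- The difference `b - u` on `V`, extended by zero. -/
def defect (u : ℂ → EReal) (V : Set ℂ) (b : ℝ) : ℂ → ℝ≥0∞ :=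
  V.indicator fun z => ((b : EReal) - u z).toENNReal

theorem defect_of_mem {u : ℂ → EReal} {V : Set ℂ} {b : ℝ} {z : ℂ} (hz : z ∈ V) :
    defect u V b z = ((b : EReal) - u z).toENNReal := indicator_of_mem hz _

namespace SubharmonicOn

variable {u : ℂ → EReal} {O V : Set ℂ} {b : ℝ}

theorem lowerSemicontinuous_defect (hu : SubharmonicOn u O) (hO : IsOpen O) (hV : IsOpen V)
    (hVO : V ⊆ O) : LowerSemicontinuous (defect u V b) := by
  intro z
  by_cases hz : z ∈ V
  · have h1 : LowerSemicontinuousAt (fun z => ((b : EReal) - u z).toENNReal) z :=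
      ContinuousAt.comp_upperSemicontinuousAt_antitone
        (g := fun x : EReal => ((b : EReal) - x).toENNReal)
        (EReal.continuous_toENNReal.comp (continuous_coe_sub b)).continuousAt
        (upperSemicontinuousAt_of_mem hu.usc hO (hVO hz))
        fun x y hxy => EReal.toENNReal_le_toENNReal (antitone_coe_sub b hxy)
    intro a ha
    rw [defect_of_mem hz] at ha
    filter_upwards [h1 a ha, hV.mem_nhds hz] with y hy hyV
    rwa [defect_of_mem hyV]
  · intro a ha
    rw [defect, indicator_of_notMem hz] at ha
    exact absurd ha not_lt_zero

theorem measurable_defect (hu : SubharmonicOn u O) (hO : IsOpen O) (hV : IsOpen V)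
    (hVO : V ⊆ O) : Measurable (defect u V b) :=
  (hu.lowerSemicontinuous_defect hO hV hVO).measurable

theorem supermean_defect (hu : SubharmonicOn u O) (hVO : V ⊆ O)
    (hb : 0 ≤ b) (hub : ∀ z ∈ V, u z ≤ b) {z : ℂ} {s : ℝ} (hs : 0 < s)
    (hball : Metric.closedBall z s ⊆ V) :
    ∫⁻ θ in Ioc 0 (2 * Real.pi), defect u V b (circleMap z s θ)
      ≤ ENNReal.ofReal (2 * Real.pi) * defect u V b z := by
  have hmem : ∀ θ, circleMap z s θ ∈ V := fun θ => hball (circleMap_mem_closedBall z hs.le θ)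
  rw [defect_of_mem (hball (Metric.mem_closedBall_self hs.le))]
  refine le_trans (lintegral_mono fun θ => (defect_of_mem (hmem θ)).le) ?_
  exact hu.supermean_const_sub hb hs (hball.trans hVO) fun θ => hub _ (hmem θ)

theorem neg_le_const_sub (hb : 0 ≤ b) (x : EReal) :
    (-x).toENNReal ≤ ((b : EReal) - x).toENNReal := by
  refine EReal.toENNReal_le_toENNReal ?_
  rw [sub_eq_add_neg]
  exact le_add_of_nonneg_left (by exact_mod_cast hb)

theorem lintegral_neg_ball_lt_top (hu : SubharmonicOn u O) (hO : IsOpen O) {z : ℂ} {ρ : ℝ}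
    (hball : Metric.closedBall z ρ ⊆ O) (hz : u z ≠ ⊥) :
    ∫⁻ w in Metric.ball z ρ, (-u w).toENNReal < ⊤ := by
  rcases le_or_gt ρ 0 with hρ | hρ
  · simp [Metric.ball_eq_empty.2 hρ]
  obtain ⟨b, hb, hub⟩ := hu.exists_bound (isCompact_closedBall z ρ) hball
  have hVO : Metric.ball z ρ ⊆ O := Metric.ball_subset_closedBall.trans hball
  have hzV : z ∈ Metric.ball z ρ := Metric.mem_ball_self hρ
  have hub' : ∀ w ∈ Metric.ball z ρ, u w ≤ b := fun w hw => hub w (Metric.ball_subset_closedBall hw)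
  calc ∫⁻ w in Metric.ball z ρ, (-u w).toENNReal
      ≤ ∫⁻ w, defect u (Metric.ball z ρ) b w := by
        rw [defect, lintegral_indicator Metric.isOpen_ball.measurableSet]
        exact lintegral_mono fun w => neg_le_const_sub hb _
    _ = ∫⁻ w, defect u (Metric.ball z ρ) b (z + w) := (lintegral_add_left_eq_self _ z).symm
    _ = _ := lintegral_polar (hu.measurable_defect hO Metric.isOpen_ball hVO) z
    _ ≤ ∫⁻ s in Ioi (0 : ℝ), (Ioo 0 ρ).indicator (fun _ => ENNReal.ofReal ρ *
          (ENNReal.ofReal (2 * Real.pi) * defect u (Metric.ball z ρ) b z)) s := by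
        refine setLIntegral_mono' measurableSet_Ioi fun s hs => ?_
        by_cases hsρ : s < ρ
        · rw [indicator_of_mem (show s ∈ Ioo 0 ρ from ⟨hs, hsρ⟩)]
          gcongr
          exact hu.supermean_defect hVO hb hub' hs (Metric.closedBall_subset_ball hsρ)
        · have : ∀ θ, defect u (Metric.ball z ρ) b (circleMap z s θ) = 0 := by
            intro θ
            refine indicator_of_notMem ?_ _
            simp only [Metric.mem_ball, dist_eq_norm, circleMap, add_sub_cancel_left]
            rw [norm_mul, Complex.norm_exp_ofReal_mul_I, mul_one, Complex.norm_real]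
            exact not_lt.2 ((not_lt.1 hsρ).trans (le_abs_self s))
          simp [this]
    _ < ⊤ := by
        refine (setLIntegral_le_lintegral _ _).trans_lt ?_
        rw [lintegral_indicator measurableSet_Ioo, setLIntegral_const, Real.volume_Ioo]
        have : defect u (Metric.ball z ρ) b z < ⊤ := by
          have hlt := hu.lt_top z (hVO hzV)
          rw [defect_of_mem hzV, lt_top_iff_ne_top, EReal.toENNReal_ne_top_iff]
          lift u z to ℝ using ⟨hlt.ne, hz⟩ with c
          exact EReal.coe_ne_top (b - c)
        finiteness

/-- A subharmonic function on a domain that is not identically `-∞` is locally integrable. -/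
theorem exists_ball_lintegral_neg_lt_top (hu : SubharmonicOn u O) (hO : IsOpen O)
    (hconn : IsConnected O) (hne : ∃ z ∈ O, u z ≠ ⊥) {z : ℂ} (hz : z ∈ O) :
    ∃ ε > 0, ∫⁻ w in Metric.ball z ε, (-u w).toENNReal < ⊤ := by
  set S : Set ℂ := {z | ∃ ε > 0, ∫⁻ w in Metric.ball z ε, (-u w).toENNReal < ⊤} with hS
  have hsub : ∀ {x y : ℂ} {ε : ℝ}, ∫⁻ w in Metric.ball x ε, (-u w).toENNReal < ⊤ →
      y ∈ Metric.ball x ε → y ∈ S := by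
    intro x y ε hfin hy
    refine ⟨ε - dist y x, sub_pos.2 hy, (lintegral_mono_set ?_).trans_lt hfin⟩
    exact Metric.ball_subset_ball' (by simp)
  have hSopen : IsOpen S := by
    rw [Metric.isOpen_iff]
    rintro x ⟨ε, hε, hfin⟩
    exact ⟨ε, hε, fun y hy => hsub hfin hy⟩
  have hpt : ∀ {y : ℂ} {ρ : ℝ}, 0 < ρ → Metric.closedBall y ρ ⊆ O → u y ≠ ⊥ →
      Metric.ball y ρ ⊆ S := fun {y ρ} _ hb hy x hx =>
    hsub (hu.lintegral_neg_ball_lt_top hO hb hy) hx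
  refine hconn.isPreconnected.subset_of_closure_inter_subset hSopen ?_ ?_ hz
  · obtain ⟨y, hyO, hy⟩ := hne
    obtain ⟨ρ, hρ, hb⟩ := Metric.nhds_basis_closedBall.mem_iff.1 (hO.mem_nhds hyO)
    exact ⟨y, hyO, hpt hρ hb hy (Metric.mem_ball_self hρ)⟩
  · rintro x ⟨hxS, hxO⟩
    obtain ⟨ρ, hρ, hb⟩ := Metric.nhds_basis_closedBall.mem_iff.1 (hO.mem_nhds hxO)
    obtain ⟨a, ⟨ε, hε, hfin⟩, hax⟩ := Metric.mem_closure_iff.1 hxS (ρ / 4) (by positivity)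
    obtain ⟨y, hy, hybot⟩ : ∃ y ∈ Metric.ball a (min ε (ρ / 4)), u y ≠ ⊥ := by
      by_contra! hall
      have h1 : ∫⁻ w in Metric.ball a (min ε (ρ / 4)), (-u w).toENNReal = ⊤ := by
        rw [setLIntegral_congr_fun (g := fun _ => ⊤) Metric.isOpen_ball.measurableSet
          fun w hw => by simp [hall w hw], setLIntegral_const, ENNReal.top_mul]
        exact (Metric.measure_ball_pos _ _ (by positivity)).ne'
      have h2 := (lintegral_mono_set (μ := volume) (f := fun w => (-u w).toENNReal)
        (Metric.ball_subset_ball (x := a) (min_le_left ε (ρ / 4)))).trans_lt hfin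
      exact h2.ne h1
    have hyx : dist x y < ρ / 2 := by
      have h3 : dist y a < ρ / 4 := (Metric.mem_ball.1 hy).trans_le (min_le_right _ _)
      have h4 := dist_triangle x a y
      rw [dist_comm a y] at h4
      linarith
    refine hpt (y := y) (ρ := ρ / 2) (by positivity) ?_ hybot hyx
    refine (Metric.closedBall_subset_closedBall' ?_).trans hb
    rw [dist_comm]
    linarith

theorem lintegral_neg_lt_top (hu : SubharmonicOn u O) (hO : IsOpen O)
    (hconn : IsConnected O) (hne : ∃ z ∈ O, u z ≠ ⊥) {K : Set ℂ} (hK : IsCompact K)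
    (hKO : K ⊆ O) : ∫⁻ w in K, (-u w).toENNReal < ⊤ := by
  refine hK.induction_on (p := fun s => ∫⁻ w in s, (-u w).toENNReal < ⊤) (by simp)
    (fun s t hst ht => (lintegral_mono_set hst).trans_lt ht)
    (fun s t hs ht => (lintegral_union_le _ s t).trans_lt (ENNReal.add_lt_top.2 ⟨hs, ht⟩))
    fun x hx => ?_
  obtain ⟨ε, hε, hfin⟩ := hu.exists_ball_lintegral_neg_lt_top hO hconn hne (hKO hx)
  exact ⟨_, mem_nhdsWithin_of_mem_nhds (Metric.ball_mem_nhds x hε), hfin⟩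

theorem posSuperharmonicOn_defect (hu : SubharmonicOn u O) (hO : IsOpen O)
    (hconn : IsConnected O) (hne : ∃ z ∈ O, u z ≠ ⊥) (hV : IsOpen V)
    (hVc : IsCompact (closure V)) (hVO : closure V ⊆ O) (hb : 0 ≤ b) (hub : ∀ z ∈ V, u z ≤ b) :
    PosSuperharmonicOn (defect u V b) V where
  isOpen := hV
  measurable := hu.measurable_defect hO hV (subset_closure.trans hVO)
  lsc z _ := hu.lowerSemicontinuous_defect hO hV (subset_closure.trans hVO) z
  supermean z s hs hball := hu.supermean_defect (subset_closure.trans hVO) hb hub hs hball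
  lintegral_ne_top := by
    have h1 := (lintegral_mono_set subset_closure).trans_lt
      (hu.lintegral_neg_lt_top hO hconn hne hVc hVO)
    have hVvol : volume V < ⊤ := (measure_mono subset_closure).trans_lt hVc.measure_lt_top
    rw [defect, lintegral_indicator hV.measurableSet]
    refine ne_top_of_le_ne_top (b := ENNReal.ofReal b * volume V
      + ∫⁻ w in V, (-u w).toENNReal) (by finiteness) ?_
    rw [← setLIntegral_const, ← lintegral_add_left measurable_const]
    refine setLIntegral_mono' hV.measurableSet fun w hw => ?_
    rw [← toENNReal_const_sub_add hb (hub w hw)]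
    exact le_self_add

end SubharmonicOn

theorem integral_laplacian_eq_zero {f : ℂ → ℝ} (hf : ContDiff ℝ 2 f)
    (hs : HasCompactSupport f) : ∫ w, Laplacian.laplacian f w = 0 := by
  have h0 := integral_log_mul_laplacian hf hs 0 0
  have h1 := integral_log_mul_laplacian hf hs 1 0
  have hi := integrable_log_mul_laplacian hf hs 0
  have hi' := (continuous_laplacian hf).integrable_of_hasCompactSupport (μ := volume)
    (hasCompactSupport_laplacian hs)
  simp only [add_zero, add_mul, one_mul] at h0 h1
  rw [integral_add hi hi', h0] at h1
  linarith

theorem laplacian_eq_zero_of_notMem_tsupport {f : ℂ → ℝ} {x : ℂ} (hx : x ∉ tsupport f) :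
    Laplacian.laplacian f x = 0 := by
  have h2 : f =ᶠ[nhds x] fun _ => (0 : ℝ) := notMem_tsupport_iff_eventuallyEq.1 hx
  rw [(InnerProductSpace.laplacian_congr_nhds h2).eq_of_nhds]
  simp

theorem toReal_mul_laplacian_ae_eq {u : ℂ → EReal} {V : Set ℂ} {b : ℝ}
    (hh : PosSuperharmonicOn (defect u V b) V) (hub : ∀ z ∈ V, u z ≤ b) {φ : ℂ → ℝ}
    (hφV : tsupport φ ⊆ V) :
    (fun z => (u z).toReal * Laplacian.laplacian φ z) =ᵐ[volume]
      fun z => b * Laplacian.laplacian φ z - (defect u V b z).toReal * Laplacian.laplacian φ z := by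
  filter_upwards [ae_lt_top hh.measurable hh.lintegral_ne_top] with z hz
  by_cases hzs : z ∈ tsupport φ
  · have hzV := hφV hzs
    rw [defect_of_mem hzV] at hz ⊢
    have hle := hub z hzV
    generalize u z = x at hz hle ⊢
    induction x with
    | bot => simp at hz
    | top => simp at hle
    | coe c =>
      have hcb : c ≤ b := by exact_mod_cast hle
      rw [← EReal.coe_sub, EReal.toENNReal_of_ne_top (EReal.coe_ne_top _), EReal.toReal_coe,
        EReal.toReal_coe, ENNReal.toReal_ofReal (by linarith)]
      ring
  · simp [laplacian_eq_zero_of_notMem_tsupport hzs]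

theorem integral_toReal_mul_laplacian {u : ℂ → EReal} {V : Set ℂ} {b : ℝ}
    (hh : PosSuperharmonicOn (defect u V b) V) (hub : ∀ z ∈ V, u z ≤ b) {φ : ℂ → ℝ}
    (hφ : ContDiff ℝ (⊤ : ℕ∞) φ) (hs : HasCompactSupport φ) (hφV : tsupport φ ⊆ V) :
    ∫ z, (u z).toReal * Laplacian.laplacian φ z
      = -∫ z, (defect u V b z).toReal * Laplacian.laplacian φ z := by
  have hφ2 : ContDiff ℝ 2 φ := hφ.of_le (WithTop.coe_le_coe.2 le_top)
  have hΔ := continuous_laplacian hφ2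
  have hΔs := hasCompactSupport_laplacian hs
  obtain ⟨D, hD⟩ := hΔ.bounded_above_of_compact_support hΔs
  have hhR : Integrable fun w => (defect u V b w).toReal :=
    integrable_toReal_of_lintegral_ne_top hh.measurable.aemeasurable hh.lintegral_ne_top
  have hiΔ : Integrable fun w => (defect u V b w).toReal * Laplacian.laplacian φ w :=
    hhR.mul_bdd hΔ.aestronglyMeasurable (.of_forall hD)
  rw [integral_congr_ae (toReal_mul_laplacian_ae_eq hh hub hφV),
    integral_sub ((hΔ.integrable_of_hasCompactSupport hΔs).const_mul b) hiΔ,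
    integral_const_mul, integral_laplacian_eq_zero hφ2 hs, mul_zero, zero_sub]

theorem IsRieszMeasure.isNegLaplacianOn {u : ℂ → EReal} {O V : Set ℂ} {b : ℝ} {μ : Measure ℂ}
    (hμ : IsRieszMeasure u O μ) (hVO : V ⊆ O)
    (hh : PosSuperharmonicOn (defect u V b) V) (hub : ∀ z ∈ V, u z ≤ b) :
    IsNegLaplacianOn μ (defect u V b) V where
  finite_on_compacts K hK hKV := hμ.finite_on_compacts K hK (hKV.trans hVO)
  integral_eq φ hφ hs hφV := by
    rw [hμ.integral_eq φ hφ hs (hφV.trans hVO), integral_toReal_mul_laplacian hh hub hφ hs hφV]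
    ring

section positivity

theorem green_zero_eq_zero {ρ : ℝ} (hρ : 0 < ρ) {w : ℂ} (hw : ρ ≤ ‖w‖) : green ρ 0 w = 0 :=
  green_eq_zero hρ (by simpa using hρ.le) hw

theorem integrable_green_zero {ρ : ℝ} (hρ : 0 < ρ) : Integrable (green ρ 0) := by
  have h := (locallyIntegrable_green (R := ρ) (z := 0) hρ (by simpa using hρ)).integrableOn_isCompact
    (isCompact_closedBall (0 : ℂ) ρ)
  refine (integrableOn_iff_integrable_of_support_subset fun w hw => ?_).1 h
  by_contra hn
  refine hw (green_zero_eq_zero hρ (le_of_lt ?_))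
  simpa using hn

theorem integral_green_zero_pos {ρ : ℝ} (hρ : 0 < ρ) : 0 < ∫ w, green ρ 0 w := by
  rw [integral_pos_iff_support_of_nonneg (green_nonneg ρ 0) (integrable_green_zero hρ)]
  have hsub : Metric.ball (0 : ℂ) ρ \ {0} ⊆ Function.support (green ρ 0) := by
    rintro w ⟨hw, hw0⟩
    have hw' : ‖w‖ < ρ := by simpa using hw
    have h0 : 0 < ‖w‖ := norm_pos_iff.2 hw0
    have h1 : 1 < ‖(ρ : ℂ) ^ 2 - (starRingEnd ℂ) 0 * w‖ / (ρ * ‖w - 0‖) := by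
      simp only [map_zero, zero_mul, sub_zero, norm_pow, Complex.norm_real,
        Real.norm_of_nonneg hρ.le]
      rw [one_lt_div (by positivity)]
      nlinarith
    refine ne_of_gt ?_
    unfold green
    rw [Real.posLog_eq_log (by rw [abs_of_pos (by linarith)]; exact h1.le)]
    exact Real.log_pos h1
  refine lt_of_lt_of_le ?_ (measure_mono hsub)
  rw [measure_sdiff_null (measure_singleton 0)]
  exact Metric.measure_ball_pos _ _ hρ

/-- The mean value defect of a test function on a circle. -/
theorem integral_green_zero_mul_laplacian {f : ℂ → ℝ} (hf : ContDiff ℝ 2 f)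
    (hs : HasCompactSupport f) {ρ : ℝ} (hρ : 0 < ρ) (z : ℂ) :
    ∫ w, green ρ 0 w * Laplacian.laplacian f (z + w)
      = 2 * Real.pi * (Real.circleAverage f z ρ - f z) := by
  have h := integral_green_mul_laplacian (f := fun y => f (y - (-z)))
    (hf.comp (contDiff_id.sub contDiff_const))
    (hs.comp_homeomorph (Homeomorph.subRight (-z))) hρ (z := 0) (by simpa using hρ)
  simp only [laplacian_comp_sub_const] at h
  simp only [sub_neg_eq_add, zero_add] at h
  simp only [add_comm z]
  rw [h]
  congr 2
  rw [← Real.circleAverage_map_add_const (f := f) (c := z)]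
  refine Real.circleAverage_congr_sphere fun ζ hζ => ?_
  have hζ' : ‖ζ‖ = ρ := by simpa [abs_of_pos hρ] using hζ
  simp only [Pi.smul_apply', poissonKernel, sub_zero, norm_zero, hζ', smul_eq_mul]
  field_simp
  ring

variable {h : ℂ → ℝ≥0∞} {V : Set ℂ} {φ : ℂ → ℝ}

theorem lintegral_mul_circleAverage_le (hh : PosSuperharmonicOn h V) (hφ : Continuous φ)
    (hφ0 : ∀ z, 0 ≤ φ z) {ρ : ℝ} (hρ : 0 < ρ)
    (hV : ∀ z ∈ tsupport φ, Metric.closedBall z ρ ⊆ V) :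
    ∫⁻ z, h z * ENNReal.ofReal (Real.circleAverage φ z ρ) ≤ ∫⁻ z, h z * ENNReal.ofReal (φ z) := by
  have hp := Real.two_pi_pos
  have hav : ∀ z, ENNReal.ofReal (Real.circleAverage φ z ρ) = ENNReal.ofReal (2 * Real.pi)⁻¹ *
      ∫⁻ θ in Ioc 0 (2 * Real.pi), ENNReal.ofReal (φ (z - circleMap 0 ρ θ)) := by
    intro z
    have hcm : ∀ θ, circleMap z (-ρ) θ = z - circleMap 0 ρ θ := fun θ => by
      simp [circleMap, sub_eq_add_neg]
    have hc : Continuous fun θ => φ (z - circleMap 0 ρ θ) := hφ.comp (by fun_prop)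
    rw [← Real.circleAverage_neg_radius, Real.circleAverage_def,
      intervalIntegral.integral_of_le hp.le, smul_eq_mul, ENNReal.ofReal_mul (by positivity)]
    simp only [hcm]
    rw [ofReal_integral_eq_lintegral_ofReal]
    · exact hc.integrableOn_Icc.mono_set Ioc_subset_Icc_self
    · exact .of_forall fun θ => hφ0 _
  have hm : Measurable fun p : ℂ × ℝ => h p.1 * ENNReal.ofReal (φ (p.1 - circleMap 0 ρ p.2)) :=
    (hh.measurable.comp measurable_fst).mul (ENNReal.measurable_ofReal.comp
      (hφ.comp (by fun_prop)).measurable)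
  have hm2 : Measurable fun p : ℝ × ℂ => h (p.2 + circleMap 0 ρ p.1) * ENNReal.ofReal (φ p.2) :=
    (hh.measurable.comp (by fun_prop)).mul (ENNReal.measurable_ofReal.comp
      (hφ.measurable.comp measurable_snd))
  have hmφ : ∀ z : ℂ, Measurable fun θ => ENNReal.ofReal (φ (z - circleMap 0 ρ θ)) := fun z =>
    ENNReal.measurable_ofReal.comp (hφ.comp (by fun_prop)).measurable
  calc ∫⁻ z, h z * ENNReal.ofReal (Real.circleAverage φ z ρ)
      = ENNReal.ofReal (2 * Real.pi)⁻¹ * ∫⁻ z, ∫⁻ θ in Ioc 0 (2 * Real.pi),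
          h z * ENNReal.ofReal (φ (z - circleMap 0 ρ θ)) := by
        rw [← lintegral_const_mul _ hm.lintegral_prod_right']
        refine lintegral_congr fun z => ?_
        simp only [hav]
        rw [lintegral_const_mul _ (hmφ z)]
        ring
    _ = ENNReal.ofReal (2 * Real.pi)⁻¹ * ∫⁻ θ in Ioc 0 (2 * Real.pi), ∫⁻ z,
          h (z + circleMap 0 ρ θ) * ENNReal.ofReal (φ z) := by
        rw [lintegral_lintegral_swap hm.aemeasurable]
        congr 1
        refine lintegral_congr fun θ => ?_
        rw [← lintegral_add_right_eq_self _ (circleMap 0 ρ θ)]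
        simp
    _ = ENNReal.ofReal (2 * Real.pi)⁻¹ * ∫⁻ z, ∫⁻ θ in Ioc 0 (2 * Real.pi),
          h (z + circleMap 0 ρ θ) * ENNReal.ofReal (φ z) := by
        rw [lintegral_lintegral_swap hm2.aemeasurable]
    _ ≤ ENNReal.ofReal (2 * Real.pi)⁻¹ * ∫⁻ z, ENNReal.ofReal (2 * Real.pi) *
          (h z * ENNReal.ofReal (φ z)) := by
        gcongr with z
        by_cases hz : z ∈ tsupport φ
        · have hsm := hh.supermean z ρ hρ (hV z hz)
          have hmz : Measurable fun θ => h (z + circleMap 0 ρ θ) := hh.measurable.comp (by fun_prop)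
          rw [lintegral_mul_const _ hmz, ← mul_assoc]
          gcongr
          refine le_trans (le_of_eq (lintegral_congr fun θ => ?_)) hsm
          simp [circleMap]
        · simp [image_eq_zero_of_notMem_tsupport hz]
    _ = _ := by
        rw [lintegral_const_mul' _ _ ENNReal.ofReal_ne_top, ← mul_assoc,
          ← ENNReal.ofReal_mul (by positivity), inv_mul_cancel₀ hp.ne', ENNReal.ofReal_one, one_mul]

theorem integral_mul_circleAverage_sub_nonpos (hh : PosSuperharmonicOn h V) (hφ : Continuous φ)
    (hφs : HasCompactSupport φ) (hφ0 : ∀ z, 0 ≤ φ z) {ρ : ℝ} (hρ : 0 < ρ)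
    (hV : ∀ z ∈ tsupport φ, Metric.closedBall z ρ ⊆ V) (hc : Continuous fun z => Real.circleAverage φ z ρ) :
    ∫ z, (h z).toReal * (Real.circleAverage φ z ρ - φ z) ≤ 0 := by
  obtain ⟨D, hD⟩ := hφ.bounded_above_of_compact_support hφs
  have hav0 : ∀ z, 0 ≤ Real.circleAverage φ z ρ := fun z =>
    Real.circleAverage_nonneg_of_nonneg fun w _ => hφ0 w
  have havD : ∀ z, ‖Real.circleAverage φ z ρ‖ ≤ D := fun z => by
    rw [Real.norm_of_nonneg (hav0 z)]
    exact Real.circleAverage_mono_on_of_le_circle (hφ.continuousOn.circleIntegrable')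
      fun w _ => (le_abs_self _).trans (hD w)
  have hhR : Integrable fun w => (h w).toReal :=
    integrable_toReal_of_lintegral_ne_top hh.measurable.aemeasurable hh.lintegral_ne_top
  have hi1 : Integrable fun z => (h z).toReal * Real.circleAverage φ z ρ :=
    hhR.mul_bdd hc.aestronglyMeasurable (.of_forall havD)
  have hi2 : Integrable fun z => (h z).toReal * φ z :=
    hhR.mul_bdd hφ.aestronglyMeasurable (.of_forall hD)
  have hconv : ∀ f : ℂ → ℝ, (∀ z, 0 ≤ f z) → Integrable (fun z => (h z).toReal * f z) →
      ENNReal.ofReal (∫ z, (h z).toReal * f z) = ∫⁻ z, h z * ENNReal.ofReal (f z) := by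
    intro f hf0 hf
    rw [ofReal_integral_eq_lintegral_ofReal hf
      (.of_forall fun w => mul_nonneg ENNReal.toReal_nonneg (hf0 w))]
    refine lintegral_congr_ae ?_
    filter_upwards [ae_lt_top hh.measurable hh.lintegral_ne_top] with w hw
    rw [ENNReal.ofReal_mul ENNReal.toReal_nonneg, ENNReal.ofReal_toReal hw.ne]
  have hle := lintegral_mul_circleAverage_le hh hφ hφ0 hρ hV
  rw [← hconv _ hav0 hi1, ← hconv _ hφ0 hi2, ENNReal.ofReal_le_ofReal_iff
    (integral_nonneg fun w => mul_nonneg ENNReal.toReal_nonneg (hφ0 w))] at hle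
  simp only [mul_sub]
  rw [integral_sub hi1 hi2]
  linarith

/-- The distributional Laplacian of a superharmonic function is nonpositive. -/
theorem integral_mul_laplacian_nonpos (hh : PosSuperharmonicOn h V)
    (hφ : ContDiff ℝ (⊤ : ℕ∞) φ) (hφs : HasCompactSupport φ) (hφV : tsupport φ ⊆ V)
    (hφ0 : ∀ z, 0 ≤ φ z) : ∫ z, (h z).toReal * Laplacian.laplacian φ z ≤ 0 := by
  have hφ2 : ContDiff ℝ 2 φ := hφ.of_le (WithTop.coe_le_coe.2 le_top)
  have hΔ := continuous_laplacian hφ2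
  have hΔs := hasCompactSupport_laplacian hφs
  obtain ⟨D, hD⟩ := hΔ.bounded_above_of_compact_support hΔs
  have hhR : Integrable fun w => (h w).toReal :=
    integrable_toReal_of_lintegral_ne_top hh.measurable.aemeasurable hh.lintegral_ne_top
  have hiΔ : Integrable fun w => (h w).toReal * Laplacian.laplacian φ w :=
    hhR.mul_bdd hΔ.aestronglyMeasurable (.of_forall hD)
  obtain ⟨δ, hδ, hδV⟩ := hφs.isCompact.exists_cthickening_subset_open hh.isOpen hφV
  have hball : ∀ ρ < δ, ∀ z ∈ tsupport φ, Metric.closedBall z ρ ⊆ V := fun ρ hρ z hz =>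
    (Metric.closedBall_subset_cthickening hz ρ).trans
      ((Metric.cthickening_mono hρ.le _).trans hδV)
  have huc : UniformContinuous (Laplacian.laplacian φ) :=
    hΔ.uniformContinuous_of_tendsto_cocompact (hΔs.is_zero_at_infty)
  set I := ∫ w, (h w).toReal
  have hI : 0 ≤ I := integral_nonneg fun _ => ENNReal.toReal_nonneg
  have key : ∀ η > 0, ∫ z, (h z).toReal * Laplacian.laplacian φ z ≤ η * I := by
    intro η hη
    obtain ⟨δ', hδ', hu⟩ := Metric.uniformContinuous_iff.1 huc η hη
    obtain ⟨ρ, hρ, hρm⟩ := exists_between (lt_min hδ hδ')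
    have hg := integrable_green_zero hρ
    have hgpos := integral_green_zero_pos hρ
    set c := ∫ w, green ρ 0 w
    have hgi : ∀ z, Integrable fun w => green ρ 0 w * Laplacian.laplacian φ (z + w) := fun z =>
      hg.mul_bdd (hΔ.comp (by fun_prop)).aestronglyMeasurable (.of_forall fun w => hD _)
    have hpt : ∀ z, c * Laplacian.laplacian φ z
        ≤ 2 * Real.pi * (Real.circleAverage φ z ρ - φ z) + c * η := by
      intro z
      rw [← integral_green_zero_mul_laplacian hφ2 hφs hρ, ← integral_mul_const,
        ← integral_mul_const, ← integral_add (hgi z) (hg.mul_const η)]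
      refine integral_mono (hg.mul_const _) ((hgi z).add (hg.mul_const η)) fun w => ?_
      rw [← mul_add]
      rcases lt_or_ge ‖w‖ ρ with hw | hw
      · refine mul_le_mul_of_nonneg_left ?_ (green_nonneg _ _ _)
        have h1 := hu (a := z) (b := z + w) (by simpa using hw.trans (hρm.trans_le (min_le_right _ _)))
        rw [Real.dist_eq] at h1
        linarith [(abs_lt.1 h1).2]
      · simp [green_zero_eq_zero hρ hw]
    have hcav : Continuous fun z => Real.circleAverage φ z ρ := by
      simp only [Real.circleAverage_def, smul_eq_mul]
      refine continuous_const.mul ?_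
      refine intervalIntegral.continuous_parametric_intervalIntegral_of_continuous' ?_ _ _
      refine hφ.continuous.comp ?_
      unfold circleMap
      fun_prop
    have hneg := integral_mul_circleAverage_sub_nonpos hh hφ.continuous hφs hφ0 hρ
      (hball ρ (hρm.trans_le (min_le_left _ _))) hcav
    have hi3 : Integrable fun z => (h z).toReal * (Real.circleAverage φ z ρ - φ z) := by
      obtain ⟨D', hD'⟩ := hφ.continuous.bounded_above_of_compact_support hφs
      have havD : ∀ z, ‖Real.circleAverage φ z ρ - φ z‖ ≤ D' + D' := fun z => by
        refine (norm_sub_le _ _).trans (add_le_add ?_ (hD' z))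
        rw [Real.norm_of_nonneg (Real.circleAverage_nonneg_of_nonneg fun w _ => hφ0 w)]
        exact Real.circleAverage_mono_on_of_le_circle
          (hφ.continuous.continuousOn.circleIntegrable') fun w _ => (le_abs_self _).trans (hD' w)
      exact hhR.mul_bdd (hcav.sub hφ.continuous).aestronglyMeasurable (.of_forall havD)
    have h2 : ∫ z, (h z).toReal * (c * Laplacian.laplacian φ z)
        ≤ ∫ z, (2 * Real.pi * ((h z).toReal * (Real.circleAverage φ z ρ - φ z))
          + (h z).toReal * (c * η)) := by
      refine integral_mono ?_ ((hi3.const_mul _).add (hhR.mul_const _)) fun z => ?_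
      · refine (hiΔ.const_mul c).congr (.of_forall fun z => ?_)
        simp only
        ring
      · simp only
        calc _ ≤ (h z).toReal * (2 * Real.pi * (Real.circleAverage φ z ρ - φ z) + c * η) :=
              mul_le_mul_of_nonneg_left (hpt z) ENNReal.toReal_nonneg
          _ = _ := by ring
    rw [integral_add (hi3.const_mul _) (hhR.mul_const _), integral_const_mul,
      integral_mul_const] at h2
    have h3 : ∫ z, (h z).toReal * (c * Laplacian.laplacian φ z)
        = c * ∫ z, (h z).toReal * Laplacian.laplacian φ z := by
      rw [← integral_const_mul]
      refine integral_congr_ae (.of_forall fun z => ?_)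
      simp only
      ring
    rw [h3] at h2
    have h4 : 2 * Real.pi * ∫ z, (h z).toReal * (Real.circleAverage φ z ρ - φ z) ≤ 0 :=
      mul_nonpos_of_nonneg_of_nonpos Real.two_pi_pos.le hneg
    have h5 : c * ∫ z, (h z).toReal * Laplacian.laplacian φ z ≤ c * (η * I) := by
      calc _ ≤ _ := h2
        _ ≤ I * (c * η) := by linarith
        _ = _ := by ring
    exact le_of_mul_le_mul_left h5 hgpos
  refine le_of_forall_pos_le_add fun ε hε => ?_
  rw [zero_add]
  refine (key (ε / (I + 1)) (by positivity)).trans ?_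
  rw [div_mul_eq_mul_div, div_le_iff₀ (by positivity)]
  nlinarith

end positivity

section existence

variable {u : ℂ → EReal} {O : Set ℂ}

/-- Test functions on `O`. -/
structure IsTestFunction (O : Set ℂ) (φ : ℂ → ℝ) : Prop where
  contDiff : ContDiff ℝ (⊤ : ℕ∞) φ
  hasCompactSupport : HasCompactSupport φ
  tsupport_subset : tsupport φ ⊆ O

theorem SubharmonicOn.exists_posSuperharmonicOn_defect (hu : SubharmonicOn u O) (hO : IsOpen O)
    (hconn : IsConnected O) (hne : ∃ z ∈ O, u z ≠ ⊥) {K : Set ℂ} (hK : IsCompact K) (hKO : K ⊆ O) :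
    ∃ (V : Set ℂ) (b : ℝ), K ⊆ V ∧ (∀ z ∈ V, u z ≤ b) ∧ PosSuperharmonicOn (defect u V b) V := by
  obtain ⟨V, hV, hKV, hVO, hVc⟩ := exists_open_between_and_isCompact_closure hK hO hKO
  obtain ⟨b, hb, hub⟩ := hu.exists_bound hVc hVO
  have hub' : ∀ z ∈ V, u z ≤ b := fun z hz => hub z (subset_closure hz)
  exact ⟨V, b, hKV, hub', hu.posSuperharmonicOn_defect hO hconn hne hV hVc hVO hb hub'⟩

theorem SubharmonicOn.integrable_toReal_mul_laplacian (hu : SubharmonicOn u O) (hO : IsOpen O)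
    (hconn : IsConnected O) (hne : ∃ z ∈ O, u z ≠ ⊥) {φ : ℂ → ℝ} (hφ : IsTestFunction O φ) :
    Integrable fun z => (u z).toReal * Laplacian.laplacian φ z := by
  obtain ⟨V, b, hKV, hub, hh⟩ := hu.exists_posSuperharmonicOn_defect hO hconn hne
    hφ.hasCompactSupport.isCompact hφ.tsupport_subset
  have hΔ := continuous_laplacian (hφ.contDiff.of_le (WithTop.coe_le_coe.2 le_top))
  have hΔs := hasCompactSupport_laplacian hφ.hasCompactSupport
  obtain ⟨D, hD⟩ := hΔ.bounded_above_of_compact_support hΔs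
  have hhR : Integrable fun w => (defect u V b w).toReal :=
    integrable_toReal_of_lintegral_ne_top hh.measurable.aemeasurable hh.lintegral_ne_top
  have hiΔ : Integrable fun w => (defect u V b w).toReal * Laplacian.laplacian φ w :=
    hhR.mul_bdd hΔ.aestronglyMeasurable (.of_forall hD)
  exact (((hΔ.integrable_of_hasCompactSupport hΔs).const_mul b).sub hiΔ).congr
    (toReal_mul_laplacian_ae_eq hh hub hKV).symm

theorem SubharmonicOn.integral_toReal_mul_laplacian_nonneg (hu : SubharmonicOn u O) (hO : IsOpen O)
    (hconn : IsConnected O) (hne : ∃ z ∈ O, u z ≠ ⊥) {φ : ℂ → ℝ} (hφ : IsTestFunction O φ)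
    (hφ0 : ∀ z, 0 ≤ φ z) : 0 ≤ ∫ z, (u z).toReal * Laplacian.laplacian φ z := by
  obtain ⟨V, b, hKV, hub, hh⟩ := hu.exists_posSuperharmonicOn_defect hO hconn hne
    hφ.hasCompactSupport.isCompact hφ.tsupport_subset
  rw [integral_toReal_mul_laplacian hh hub hφ.contDiff hφ.hasCompactSupport hKV]
  exact neg_nonneg.2 (integral_mul_laplacian_nonpos hh hφ.contDiff hφ.hasCompactSupport hKV hφ0)

open scoped CompactlySupported

/-- Extension by zero of functions on `O`. -/
def extendZero (O : Set ℂ) : (O → ℝ) →ₗ[ℝ] (ℂ → ℝ) :=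
  Function.ExtendByZero.linearMap ℝ (Subtype.val : O → ℂ)

theorem extendZero_coe (f : O → ℝ) (x : O) : extendZero O f x = f x :=
  Subtype.val_injective.extend_apply f 0 x

theorem extendZero_of_notMem (f : O → ℝ) {z : ℂ} (hz : z ∉ O) : extendZero O f z = 0 :=
  Function.extend_apply' _ _ _ (by rintro ⟨a, rfl⟩; exact hz a.2)

theorem support_extendZero_subset (f : C_c(O, ℝ)) :
    Function.support (extendZero O f) ⊆ Subtype.val '' tsupport f := by
  intro z hz
  by_cases hzO : z ∈ O
  · refine ⟨⟨z, hzO⟩, subset_tsupport _ ?_, rfl⟩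
    have := extendZero_coe f ⟨z, hzO⟩
    rwa [Function.mem_support, ← this]
  · exact absurd (extendZero_of_notMem f hzO) hz

theorem isCompact_image_tsupport (f : C_c(O, ℝ)) :
    IsCompact (Subtype.val '' tsupport f : Set ℂ) :=
  f.hasCompactSupport.isCompact.image continuous_subtype_val

theorem isTestFunction_extendZero (f : C_c(O, ℝ)) (hf : ContDiff ℝ (⊤ : ℕ∞) (extendZero O f)) :
    IsTestFunction O (extendZero O f) where
  contDiff := hf
  hasCompactSupport := .intro (isCompact_image_tsupport f) fun z hz => by
    by_contra hn
    exact hz (support_extendZero_subset f hn)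
  tsupport_subset := (closure_minimal (support_extendZero_subset f)
    (isCompact_image_tsupport f).isClosed).trans (by rintro _ ⟨x, -, rfl⟩; exact x.2)

theorem IsTestFunction.extendZero_restrict {φ : ℂ → ℝ} (hφ : IsTestFunction O φ) :
    extendZero O (fun x => φ x) = φ := by
  funext z
  by_cases hz : z ∈ O
  · exact extendZero_coe _ ⟨z, hz⟩
  · rw [extendZero_of_notMem _ hz,
      image_eq_zero_of_notMem_tsupport fun h => hz (hφ.tsupport_subset h)]

/-- The restriction to `O` of a test function on `O`. -/
def IsTestFunction.restrict {φ : ℂ → ℝ} (hφ : IsTestFunction O φ) : C_c(O, ℝ) where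
  toFun x := φ x
  continuous_toFun := hφ.contDiff.continuous.comp continuous_subtype_val
  hasCompactSupport' := by
    refine .intro (K := Subtype.val ⁻¹' tsupport φ) ?_ fun x hx =>
      image_eq_zero_of_notMem_tsupport hx
    exact (Topology.IsInducing.subtypeVal.isCompact_preimage_iff
      (by simpa using hφ.tsupport_subset)).2 hφ.hasCompactSupport.isCompact

/-- The compactly supported functions on `O` that are smooth. -/
def smoothSubmodule (O : Set ℂ) : Submodule ℝ C_c(O, ℝ) where
  carrier := {f | ContDiff ℝ (⊤ : ℕ∞) (extendZero O f)}
  add_mem' {f g} hf hg := by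
    simp only [mem_ofPred_eq, CompactlySupportedContinuousMap.coe_add, map_add] at *
    exact hf.add hg
  zero_mem' := by
    simp only [mem_ofPred_eq, CompactlySupportedContinuousMap.coe_zero, map_zero]
    exact contDiff_const
  smul_mem' c f hf := by
    simp only [mem_ofPred_eq, CompactlySupportedContinuousMap.coe_smul, map_smul] at *
    exact hf.const_smul c

theorem mem_smoothSubmodule {f : C_c(O, ℝ)} :
    f ∈ smoothSubmodule O ↔ ContDiff ℝ (⊤ : ℕ∞) (extendZero O f) := Iff.rfl

/-- The cone of nonnegative compactly supported functions on `O`. -/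
def nonnegCone (O : Set ℂ) : PointedCone ℝ C_c(O, ℝ) where
  carrier := {f | ∀ x, 0 ≤ f x}
  add_mem' hf hg x := add_nonneg (hf x) (hg x)
  zero_mem' _ := le_rfl
  smul_mem' c _ hf x := mul_nonneg c.2 (hf x)

theorem laplacian_const_smul (c : ℝ) {f : ℂ → ℝ} (hf : ContDiff ℝ 2 f) (z : ℂ) :
    Laplacian.laplacian (c • f) z = c * Laplacian.laplacian f z := by
  rw [InnerProductSpace.laplacian_smul c hf.contDiffAt]
  simp

/-- The distribution `(1/2π) Δu` as a linear functional. -/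
def laplacianFunctional (hu : SubharmonicOn u O) (hO : IsOpen O)
    (hconn : IsConnected O) (hne : ∃ z ∈ O, u z ≠ ⊥) : smoothSubmodule O →ₗ[ℝ] ℝ where
  toFun f := (2 * Real.pi)⁻¹ * ∫ z, (u z).toReal * Laplacian.laplacian (extendZero O f.1) z
  map_add' f g := by
    have h2 : ∀ f : smoothSubmodule O, ContDiff ℝ 2 (extendZero O f.1) := fun f =>
      (mem_smoothSubmodule.1 f.2).of_le (WithTop.coe_le_coe.2 le_top)
    rw [← mul_add, ← integral_add
      (hu.integrable_toReal_mul_laplacian hO hconn hne (isTestFunction_extendZero f.1 f.2))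
      (hu.integrable_toReal_mul_laplacian hO hconn hne (isTestFunction_extendZero g.1 g.2))]
    congr 2
    funext z
    rw [Submodule.coe_add, CompactlySupportedContinuousMap.coe_add, map_add,
      (h2 f).contDiffAt.laplacian_add (h2 g).contDiffAt, mul_add]
  map_smul' c f := by
    have h2 : ContDiff ℝ 2 (extendZero O f.1) :=
      (mem_smoothSubmodule.1 f.2).of_le (WithTop.coe_le_coe.2 le_top)
    rw [Submodule.coe_smul, CompactlySupportedContinuousMap.coe_smul, map_smul]
    simp only [laplacian_const_smul c h2, mul_left_comm _ c, integral_const_mul,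
      RingHom.id_apply, smul_eq_mul]

theorem exists_smooth_majorant (hO : IsOpen O) (f : C_c(O, ℝ)) :
    ∃ g ∈ smoothSubmodule O, g + f ∈ nonnegCone O := by
  obtain ⟨V, hV, hKV, hVO, hVc⟩ := exists_open_between_and_isCompact_closure
    (isCompact_image_tsupport f) hO (by rintro _ ⟨x, -, rfl⟩; exact x.2)
  obtain ⟨χ, hχs, hχ, hχr⟩ := hV.exists_contDiff_support_eq (n := ⊤)
  have hχ0 : ∀ z, 0 ≤ χ z := fun z => (hχr (mem_range_self z)).1
  have hts : tsupport χ = closure V := by rw [tsupport, hχs]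
  obtain ⟨D, hD⟩ : ∃ D, ∀ x, ‖f x‖ ≤ D := f.continuous.bounded_above_of_compact_support f.hasCompactSupport
  have hpos : ∀ z ∈ (Subtype.val '' tsupport f : Set ℂ), 0 < χ z := fun z hz =>
    (hχ0 z).lt_of_ne' (by have := hKV hz; rwa [← hχs] at this)
  obtain ⟨m, hm, hmle⟩ : ∃ m > 0, ∀ z ∈ (Subtype.val '' tsupport f : Set ℂ), m ≤ χ z := by
    rcases (Subtype.val '' tsupport f : Set ℂ).eq_empty_or_nonempty with he | hn
    · exact ⟨1, one_pos, by simp [he]⟩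
    · obtain ⟨a, ha, hmin⟩ := (isCompact_image_tsupport f).exists_isMinOn hn hχ.continuous.continuousOn
      exact ⟨χ a, hpos a ha, fun z hz => hmin hz⟩
  have htest : IsTestFunction O ((D / m) • χ) := by
    have hsub : tsupport ((D / m) • χ) ⊆ tsupport χ :=
      tsupport_smul_subset_right (fun _ => D / m) χ
    exact ⟨hχ.const_smul (D / m), (show IsCompact (tsupport χ) by rwa [hts]).of_isClosed_subset
      (isClosed_tsupport _) hsub, hsub.trans (hts ▸ hVO)⟩
  refine ⟨htest.restrict, ?_, fun x => ?_⟩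
  · rw [mem_smoothSubmodule]
    change ContDiff ℝ _ (extendZero O fun x => ((D / m) • χ) x)
    rw [htest.extendZero_restrict]
    exact htest.contDiff
  · change 0 ≤ D / m * χ x + f x
    by_cases hx : x ∈ tsupport f
    · have h1 := hmle _ (mem_image_of_mem _ hx)
      have h2 := hD x
      have hD0 : 0 ≤ D := (norm_nonneg _).trans h2
      have h3 : D ≤ D / m * χ x := by
        rw [div_mul_eq_mul_div, le_div_iff₀ hm]
        exact mul_le_mul_of_nonneg_left h1 hD0
      linarith [neg_abs_le (f x), Real.norm_eq_abs (f x)]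
    · have hD0 : 0 ≤ D := (norm_nonneg _).trans (hD x)
      rw [image_eq_zero_of_notMem_tsupport hx, add_zero]
      exact mul_nonneg (div_nonneg hD0 hm.le) (hχ0 _)

/-- A subharmonic function that is not identically `-∞` has a Riesz measure. -/
theorem SubharmonicOn.exists_isRieszMeasure (hu : SubharmonicOn u O) (hO : IsOpen O)
    (hconn : IsConnected O) (hne : ∃ z ∈ O, u z ≠ ⊥) : ∃ μ, IsRieszMeasure u O μ := by
  have : LocallyCompactSpace O := hO.locallyCompactSpace
  obtain ⟨Λ, hΛ, hΛ0⟩ := riesz_extension (nonnegCone O)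
    ⟨smoothSubmodule O, laplacianFunctional hu hO hconn hne⟩
    (fun f hf => by
      refine mul_nonneg (inv_nonneg.2 Real.two_pi_pos.le)
        (hu.integral_toReal_mul_laplacian_nonneg hO hconn hne
          (isTestFunction_extendZero f.1 f.2) fun z => ?_)
      by_cases hz : z ∈ O
      · rw [extendZero_coe _ ⟨z, hz⟩]
        exact hf ⟨z, hz⟩
      · rw [extendZero_of_notMem _ hz])
    (fun f => by
      obtain ⟨g, hg, hgf⟩ := exists_smooth_majorant hO f
      exact ⟨⟨g, hg⟩, hgf⟩)
  set Λ' : C_c(O, ℝ) →ₚ[ℝ] ℝ := PositiveLinearMap.mk₀ Λ fun f hf => hΛ0 f hf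
  have hemb : MeasurableEmbedding (Subtype.val : O → ℂ) := .subtype_coe hO.measurableSet
  refine ⟨(RealRMK.rieszMeasure Λ').map Subtype.val, ?_, fun K hK hKO => ?_, fun φ hφ hs hφO => ?_⟩
  · rw [hemb.map_apply]
    simp
  · rw [hemb.map_apply]
    exact ((Topology.IsInducing.subtypeVal.isCompact_preimage_iff
      (by simpa using hKO)).2 hK).measure_lt_top
  · have ht : IsTestFunction O φ := ⟨hφ, hs, hφO⟩
    have hmem : ht.restrict ∈ smoothSubmodule O := by
      rw [mem_smoothSubmodule]
      change ContDiff ℝ _ (extendZero O fun x => φ x)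
      rwa [ht.extendZero_restrict]
    rw [hemb.integral_map]
    refine (RealRMK.integral_rieszMeasure Λ' ht.restrict).trans ((hΛ ⟨_, hmem⟩).trans ?_)
    change (2 * Real.pi)⁻¹ * ∫ z, (u z).toReal *
      Laplacian.laplacian (extendZero O fun x => φ x) z = _
    rw [ht.extendZero_restrict]

theorem SubharmonicOn.isRieszMeasure_rieszMeasure (hu : SubharmonicOn u O) (hO : IsOpen O)
    (hconn : IsConnected O) (hne : ∃ z ∈ O, u z ≠ ⊥) : IsRieszMeasure u O (rieszMeasure u O) := by
  have h := hu.exists_isRieszMeasure hO hconn hne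
  rw [rieszMeasure, dif_pos h]
  exact h.choose_spec

end existence

/-- The supremum of the Green function of the disc of radius `R` over pairs of points of
moduli `t` and `s`. -/
def radialKernel (R t s : ℝ) : ℝ≥0∞ :=
  if R ≤ s then 0 else if t = s then ⊤ else
    ENNReal.ofReal (Real.log ((R ^ 2 - t * s) / (R * |t - s|)))

theorem measurable_radialKernel (R : ℝ) :
    Measurable fun p : ℝ × ℝ => radialKernel R p.1 p.2 := by
  unfold radialKernel
  refine Measurable.ite (measurableSet_le measurable_const measurable_snd) measurable_const ?_
  refine Measurable.ite (measurableSet_eq_fun measurable_fst measurable_snd) measurable_const ?_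
  refine ENNReal.measurable_ofReal.comp (Real.measurable_log.comp ?_)
  refine Measurable.div (by fun_prop) ?_
  exact measurable_const.mul (continuous_abs.measurable.comp (measurable_fst.sub measurable_snd))

theorem one_le_radial_ratio {R t s : ℝ} (hR : 0 < R) (ht0 : 0 ≤ t) (ht : t < R) (hs0 : 0 ≤ s)
    (hs : s < R) (hts : t ≠ s) : 1 ≤ (R ^ 2 - t * s) / (R * |t - s|) := by
  have hd : 0 < |t - s| := abs_pos.2 (sub_ne_zero.2 hts)
  rw [one_le_div (by positivity)]
  rcases abs_cases (t - s) with ⟨h, -⟩ | ⟨h, -⟩ <;> rw [h] <;> nlinarith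

theorem greenE_le_radialKernel {R : ℝ} (hR : 0 < R) {z w : ℂ} (hz : ‖z‖ < R) :
    greenE R z w ≤ radialKernel R ‖z‖ ‖w‖ := by
  rcases le_or_gt R ‖w‖ with hw | hw
  · rw [greenE_eq_zero hR hz hw]
    exact bot_le
  rw [radialKernel, if_neg hw.not_ge]
  by_cases hzw : ‖z‖ = ‖w‖
  · rw [if_pos hzw]
    exact le_top
  have hwz : w ≠ z := fun h => hzw (by rw [h])
  rw [if_neg hzw, greenE, if_neg hwz]
  refine ENNReal.ofReal_le_ofReal ?_
  have hQ := one_le_radial_ratio hR (norm_nonneg z) hz (norm_nonneg w) hw hzw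
  rw [← Real.posLog_eq_log (by rw [abs_of_nonneg (by linarith)]; exact hQ), green]
  have hδ : 0 < ‖w - z‖ := norm_pos_iff.2 (sub_ne_zero.2 hwz)
  have hd : 0 < |‖z‖ - ‖w‖| := abs_pos.2 (sub_ne_zero.2 hzw)
  have hdδ : |‖z‖ - ‖w‖| ≤ ‖w - z‖ := by
    rw [norm_sub_rev]
    exact abs_norm_sub_norm_le z w
  have hts : 0 ≤ R ^ 2 - ‖z‖ * ‖w‖ := by nlinarith [norm_nonneg z, norm_nonneg w]
  have hP : 0 ≤ (R ^ 2 - ‖z‖ ^ 2) * (R ^ 2 - ‖w‖ ^ 2) :=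
    mul_nonneg (by nlinarith [norm_nonneg z]) (by nlinarith [norm_nonneg w])
  refine Real.posLog_le_posLog (by positivity) ?_
  rw [div_le_div_iff₀ (by positivity) (by positivity)]
  have hle : ‖(R : ℂ) ^ 2 - (starRingEnd ℂ) z * w‖ * |‖z‖ - ‖w‖|
      ≤ (R ^ 2 - ‖z‖ * ‖w‖) * ‖w - z‖ := by
    refine le_of_sq_le_sq ?_ (by positivity)
    rw [mul_pow, mul_pow, norm_sq_sub_conj_mul, sq_abs]
    have h2 : (‖z‖ - ‖w‖) ^ 2 ≤ ‖w - z‖ ^ 2 := by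
      rw [← sq_abs]
      gcongr
    nlinarith [mul_le_mul_of_nonneg_left h2 hP]
  nlinarith [mul_le_mul_of_nonneg_left hle hR.le]

theorem radialKernel_le_log {R t s : ℝ} (hR : 0 < R) (ht0 : 0 ≤ t) (ht : t < R) (hs0 : 0 ≤ s)
    (hs : s < R) (hts : t ≠ s) : radialKernel R t s ≤ ENNReal.ofReal (Real.log (R / |t - s|)) := by
  rw [radialKernel, if_neg hs.not_ge, if_neg hts]
  have hd : 0 < |t - s| := abs_pos.2 (sub_ne_zero.2 hts)
  refine ENNReal.ofReal_le_ofReal (Real.log_le_log (by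
    linarith [one_le_radial_ratio hR ht0 ht hs0 hs hts]) ?_)
  rw [div_le_div_iff₀ (by positivity) hd]
  nlinarith [mul_nonneg (mul_nonneg ht0 hs0) hd.le]

theorem radialKernel_le_of_far {R r t s : ℝ} (hR : 0 < R) (hrR : r < R) (ht0 : 0 ≤ t) (ht : t ≤ r)
    (hs : s < R) (hfar : R - s ≤ 2 / 3 * (R - r)) :
    radialKernel R t s ≤ ENNReal.ofReal (6 * ((R - s) / (R - r))) := by
  have hd : (R - r) / 3 ≤ s - t := by linarith
  have hb : 0 < R - r := by linarith
  have hts : t ≠ s := by intro h; linarith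
  rw [radialKernel, if_neg hs.not_ge, if_neg hts, abs_sub_comm, abs_of_pos (by linarith)]
  refine ENNReal.ofReal_le_ofReal ?_
  have hd0 : 0 < s - t := by linarith
  have hpos : 0 < (R ^ 2 - t * s) / (R * (s - t)) := by
    refine div_pos ?_ (by positivity)
    nlinarith
  refine (Real.log_le_sub_one_of_pos hpos).trans ?_
  have : (R ^ 2 - t * s) / (R * (s - t)) - 1 = (R - s) * (R + t) / (R * (s - t)) := by
    field_simp
    ring
  rw [this, ← mul_div_assoc, div_le_div_iff₀ (by positivity) hb]
  have h1 : (R - s) * (R + t) ≤ (R - s) * (2 * R) :=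
    mul_le_mul_of_nonneg_left (by linarith) (by linarith)
  have h2 : 0 ≤ (R - s) * R := mul_nonneg (by linarith) hR.le
  nlinarith [mul_le_mul_of_nonneg_right h1 hb.le, mul_le_mul_of_nonneg_left hd h2]

theorem log_le_mul_rpow {Λ M y : ℝ} (hM : 0 < M) (hΛ : Λ ≤ M) (hy : 0 < y) :
    Λ + Real.log y ≤ M * y ^ (1 / M) := by
  have h := Real.log_le_sub_one_of_pos (Real.rpow_pos_of_pos hy (1 / M))
  rw [Real.log_rpow hy] at h
  have h2 := mul_le_mul_of_nonneg_left h hM.le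
  have h3 : M * (1 / M * Real.log y) = Real.log y := by field_simp
  rw [h3] at h2
  linarith

/-- The function `√(c / x)` on `(0, c]`, extended by zero. -/
def sqrtKernel (c : ℝ) : ℝ → ℝ≥0∞ :=
  (Ioc 0 c).indicator fun x => ENNReal.ofReal ((c / x) ^ (1 / 2 : ℝ))

theorem measurable_sqrtKernel (c : ℝ) : Measurable (sqrtKernel c) := by
  refine Measurable.indicator ?_ measurableSet_Ioc
  fun_prop

theorem lintegral_sqrtKernel {c : ℝ} (hc : 0 < c) :
    ∫⁻ x, sqrtKernel c x = ENNReal.ofReal (2 * c) := by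
  have h1 : ∀ x ∈ Ioc 0 c, ENNReal.ofReal ((c / x) ^ (1 / 2 : ℝ))
      = ENNReal.ofReal (c ^ (1 / 2 : ℝ) * x ^ (-(1 / 2) : ℝ)) := fun x hx => by
    rw [Real.div_rpow hc.le hx.1.le, Real.rpow_neg hx.1.le, div_eq_mul_inv]
  have hInt : IntervalIntegrable (fun x : ℝ => c ^ (1 / 2 : ℝ) * x ^ (-(1 / 2) : ℝ)) volume 0 c :=
    (intervalIntegral.intervalIntegrable_rpow' (by norm_num)).const_mul _
  rw [sqrtKernel, lintegral_indicator measurableSet_Ioc,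
    setLIntegral_congr_fun measurableSet_Ioc h1, ← ofReal_integral_eq_lintegral_ofReal
      ((intervalIntegrable_iff_integrableOn_Ioc_of_le hc.le).1 hInt)]
  · congr 1
    rw [← intervalIntegral.integral_of_le hc.le, intervalIntegral.integral_const_mul,
      integral_rpow (.inl (by norm_num))]
    have : (-(1 / 2) + 1 : ℝ) = 1 / 2 := by norm_num
    rw [this, Real.zero_rpow (by norm_num), sub_zero, ← mul_div_assoc, ← Real.rpow_add hc]
    norm_num
    ring
  · refine (ae_restrict_iff' measurableSet_Ioc).2 (.of_forall fun x hx => ?_)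
    have := hx.1
    positivity

theorem lintegral_radialKernel_rpow_le {R r s q m : ℝ} (hrR : r < R) (hs0 : 0 ≤ s)
    (hs : s < R) (hq : 1 ≤ q) {E : Set ℝ} (hE : NullMeasurableSet E) (hEr : E ⊆ Icc 0 r)
    (hm : 0 < m) (hmR : m ≤ R) (hmE : volume E = ENNReal.ofReal m) :
    ∫⁻ t in E, radialKernel R t s ^ q
      ≤ ENNReal.ofReal (3 * (Real.log (2 * R / m) + 2 * q) ^ q * m) := by
  have hR : 0 < R := hm.trans_le hmR
  have hΛ : 0 ≤ Real.log (2 * R / m) := Real.log_nonneg (by rw [le_div_iff₀ hm]; linarith)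
  set Λ := Real.log (2 * R / m)
  set M := Λ + 2 * q with hMdef
  have hM : 0 < M := by positivity
  have hq0 : 0 < q := by linarith
  have hne : ∀ᵐ t ∂(volume.restrict E), t ≠ s := by
    refine ae_restrict_of_ae ?_
    exact Measure.ae_ne volume s
  have hpt : ∀ᵐ t ∂(volume.restrict E), radialKernel R t s ^ q ≤
      ENNReal.ofReal (M ^ q) * (1 + sqrtKernel (m / 2) (t - s) + sqrtKernel (m / 2) (s - t)) := by
    filter_upwards [hne, ae_restrict_mem₀ hE] with t hts htE
    have htr := hEr htE
    have hd : 0 < |t - s| := abs_pos.2 (sub_ne_zero.2 hts)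
    have hy : 0 < m / 2 / |t - s| := by positivity
    have hker : radialKernel R t s ≤ ENNReal.ofReal (M * (m / 2 / |t - s|) ^ (1 / M)) := by
      refine (radialKernel_le_log hR htr.1 (by linarith [htr.2]) hs0 hs hts).trans
        (ENNReal.ofReal_le_ofReal ?_)
      have : R / |t - s| = 2 * R / m * (m / 2 / |t - s|) := by field_simp
      rw [this, Real.log_mul (by positivity) hy.ne']
      exact log_le_mul_rpow hM (by linarith) hy
    have hpow : radialKernel R t s ^ q
        ≤ ENNReal.ofReal (M ^ q) * ENNReal.ofReal ((m / 2 / |t - s|) ^ (q / M)) := by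
      refine (ENNReal.rpow_le_rpow hker hq0.le).trans (le_of_eq ?_)
      rw [ENNReal.ofReal_rpow_of_nonneg (by positivity) hq0.le,
        Real.mul_rpow hM.le (by positivity), ENNReal.ofReal_mul (by positivity),
        ← Real.rpow_mul hy.le]
      congr 3
      ring
    refine hpow.trans (mul_le_mul_right ?_ _)
    rcases le_or_gt (m / 2) |t - s| with hfar | hnear
    · refine le_trans ?_ (le_self_add.trans le_self_add)
      rw [← ENNReal.ofReal_one]
      refine ENNReal.ofReal_le_ofReal (Real.rpow_le_one hy.le ?_ (by positivity))
      exact div_le_one_of_le₀ hfar hd.le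
    · have h1 : (m / 2 / |t - s|) ^ (q / M) ≤ (m / 2 / |t - s|) ^ (1 / 2 : ℝ) := by
        refine Real.rpow_le_rpow_of_exponent_le ((one_le_div hd).2 hnear.le) ?_
        rw [div_le_div_iff₀ hM two_pos]
        linarith
      refine (ENNReal.ofReal_le_ofReal h1).trans ?_
      rcases lt_or_gt_of_ne hts with h | h
      · have habs : |t - s| = s - t := by rw [abs_sub_comm, abs_of_pos (by linarith)]
        refine le_trans (le_of_eq ?_) le_add_self
        rw [habs] at hnear ⊢
        rw [sqrtKernel, indicator_of_mem (show s - t ∈ Ioc 0 (m / 2) from ⟨by linarith, hnear.le⟩)]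
      · have habs : |t - s| = t - s := abs_of_pos (by linarith)
        refine le_trans (le_of_eq ?_) (le_add_self.trans le_self_add)
        rw [habs] at hnear ⊢
        rw [sqrtKernel, indicator_of_mem (show t - s ∈ Ioc 0 (m / 2) from ⟨by linarith, hnear.le⟩)]
  have hmk := measurable_sqrtKernel (m / 2)
  have hm1 : Measurable fun t => sqrtKernel (m / 2) (t - s) := hmk.comp (by fun_prop)
  have hm2 : Measurable fun t => sqrtKernel (m / 2) (s - t) := hmk.comp (by fun_prop)
  refine (lintegral_mono_ae hpt).trans ?_
  rw [lintegral_const_mul' _ _ ENNReal.ofReal_ne_top,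
    lintegral_add_right _ hm2, lintegral_add_right _ hm1, lintegral_const, one_mul,
    Measure.restrict_apply_univ, hmE]
  have hJ := lintegral_sqrtKernel (half_pos hm)
  have hI1 : ∫⁻ t in E, sqrtKernel (m / 2) (t - s) ≤ ENNReal.ofReal (2 * (m / 2)) := by
    refine (setLIntegral_le_lintegral _ _).trans ?_
    rw [lintegral_sub_right_eq_self (sqrtKernel (m / 2)) s, hJ]
  have hI2 : ∫⁻ t in E, sqrtKernel (m / 2) (s - t) ≤ ENNReal.ofReal (2 * (m / 2)) := by
    refine (setLIntegral_le_lintegral _ _).trans ?_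
    rw [lintegral_sub_left_eq_self (sqrtKernel (m / 2)) s, hJ]
  refine (mul_le_mul_right (add_le_add (add_le_add le_rfl hI1) hI2) _).trans (le_of_eq ?_)
  rw [← ENNReal.ofReal_add hm.le (by positivity), ← ENNReal.ofReal_add (by positivity)
    (by positivity), ← ENNReal.ofReal_mul (by positivity)]
  congr 1
  ring

theorem one_le_log_ratio {k r m : ℝ} (hk : 1 < k) (hm : 0 < m) (hmr : m ≤ r) :
    1 ≤ Real.log (4 * Real.exp 1 * k * r / m) := by
  rw [Real.le_log_iff_exp_le (by have := hm.trans_le hmr; positivity), le_div_iff₀ hm]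
  have he := Real.exp_pos 1
  have h1 : Real.exp 1 * m ≤ Real.exp 1 * (k * r) := by
    refine mul_le_mul_of_nonneg_left ?_ he.le
    nlinarith
  have h2 : 0 ≤ Real.exp 1 * (k * r) := le_trans (by positivity) h1
  linarith

theorem lintegral_rpow_radialKernel_le {k r r₀ s q m : ℝ} (hr₀ : 0 < r₀) (hr₀r : r₀ ≤ r)
    (hk : 1 < k) (hs0 : 0 ≤ s) (hs : s < k * r) (hq : 1 ≤ q) {E : Set ℝ}
    (hE : NullMeasurableSet E) (hEr : E ⊆ Icc 0 r) (hm : 0 < m) (hmr : m ≤ r)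
    (hmE : volume E = ENNReal.ofReal m) :
    (∫⁻ t in E, radialKernel (k * r) t s ^ q) ^ (1 / q)
      ≤ ENNReal.ofReal (6 * q * k / (k - 1) * (m ^ (1 / q)
          * Real.log (4 * Real.exp 1 * k * r / m))) *
        ENNReal.ofReal (Real.log (k * r / max s r₀)) := by
  have hr : 0 < r := hm.trans_le hmr
  have hk1 : 0 < k - 1 := by linarith
  have hR : 0 < k * r := by positivity
  have hrR : r < k * r := by nlinarith
  have hq0 : 0 < q := by linarith
  have hL := one_le_log_ratio hk hm hmr
  set L := Real.log (4 * Real.exp 1 * k * r / m) with hLdef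
  have hc : 0 ≤ 6 * q * k / (k - 1) * (m ^ (1 / q) * L) := by positivity
  have hlog : (k * r - max s r₀) / (k * r) ≤ Real.log (k * r / max s r₀) := by
    have hmax : 0 < max s r₀ := lt_max_of_lt_right hr₀
    refine le_trans (le_of_eq ?_) (Real.one_sub_inv_le_log_of_pos (div_pos hR hmax))
    rw [inv_div, sub_div, div_self hR.ne']
  rw [← ENNReal.ofReal_mul hc]
  have hmq : 0 < m ^ (1 / q) := by positivity
  by_cases hfar : k * r - s ≤ 2 / 3 * (k * r - r)
  · have hsr : r < s := by nlinarith
    rw [max_eq_left (by linarith)] at hlog ⊢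
    have h1 : (∫⁻ t in E, radialKernel (k * r) t s ^ q)
        ≤ ENNReal.ofReal (6 * ((k * r - s) / (k * r - r))) ^ q * ENNReal.ofReal m := by
      rw [← hmE, ← setLIntegral_const]
      refine lintegral_mono_ae ?_
      filter_upwards [ae_restrict_mem₀ hE] with t ht
      exact ENNReal.rpow_le_rpow (radialKernel_le_of_far hR hrR (hEr ht).1 (hEr ht).2 hs hfar) hq0.le
    refine (ENNReal.rpow_le_rpow h1 (by positivity)).trans ?_
    have hn : 0 ≤ 6 * ((k * r - s) / (k * r - r)) :=
      mul_nonneg (by norm_num) (div_nonneg (by linarith) (by linarith))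
    rw [ENNReal.mul_rpow_of_nonneg _ _ (by positivity), ← ENNReal.rpow_mul,
      mul_one_div_cancel hq0.ne', ENNReal.rpow_one, ENNReal.ofReal_rpow_of_nonneg hm.le
      (by positivity), ← ENNReal.ofReal_mul hn]
    refine ENNReal.ofReal_le_ofReal ?_
    refine le_trans ?_ (mul_le_mul_of_nonneg_left hlog hc)
    have he : 6 * q * k / (k - 1) * (m ^ (1 / q) * L) * ((k * r - s) / (k * r))
        = 6 * ((k * r - s) / (k * r - r)) * m ^ (1 / q) * (q * L) := by
      have : k * r - r ≠ 0 := by linarith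
      have : k * r - r = (k - 1) * r := by ring
      rw [this]
      field_simp
    rw [he]
    refine le_mul_of_one_le_right (by positivity) ?_
    nlinarith
  · have hmin : 2 / 3 * ((k - 1) / k) ≤ Real.log (k * r / max s r₀) := by
      refine le_trans ?_ hlog
      rw [← mul_div_assoc, div_le_div_iff₀ (by positivity) hR]
      have : max s r₀ ≤ k * r - 2 / 3 * (k * r - r) := max_le (by linarith) (by linarith)
      nlinarith [mul_le_mul_of_nonneg_left this (show 0 ≤ k by linarith)]
    have h1 := lintegral_radialKernel_rpow_le hrR hs0 hs hq hE hEr hm (hmr.trans hrR.le) hmE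
    refine (ENNReal.rpow_le_rpow h1 (by positivity)).trans ?_
    have hΛ : 0 ≤ Real.log (2 * (k * r) / m) :=
      Real.log_nonneg (by rw [le_div_iff₀ hm]; linarith)
    have hLΛ : L = Real.log (2 * (k * r) / m) + Real.log 2 + 1 := by
      have : 4 * Real.exp 1 * k * r / m = 2 * (k * r) / m * 2 * Real.exp 1 := by
        field_simp
        ring
      rw [hLdef, this, Real.log_mul (by positivity) (by positivity),
        Real.log_mul (by positivity) (by norm_num), Real.log_exp]
    set Λ := Real.log (2 * (k * r) / m)
    have hM : 0 < Λ + 2 * q := by positivity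
    rw [ENNReal.ofReal_rpow_of_nonneg (by positivity) (by positivity)]
    refine ENNReal.ofReal_le_ofReal ?_
    have h3 : (3 : ℝ) ^ (1 / q) ≤ 3 := by
      conv_rhs => rw [← Real.rpow_one 3]
      exact Real.rpow_le_rpow_of_exponent_le (by norm_num) ((div_le_one hq0).2 hq)
    rw [Real.mul_rpow (by positivity) hm.le, Real.mul_rpow (by norm_num) (by positivity),
      ← Real.rpow_mul hM.le, mul_one_div_cancel hq0.ne', Real.rpow_one]
    calc (3 : ℝ) ^ (1 / q) * (Λ + 2 * q) * m ^ (1 / q)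
        ≤ 3 * (Λ + 2 * q) * m ^ (1 / q) := by gcongr
      _ ≤ 4 * q * L * m ^ (1 / q) := by
          refine mul_le_mul_of_nonneg_right ?_ hmq.le
          rw [hLΛ]
          nlinarith [Real.log_two_gt_d9, mul_nonneg (by linarith : 0 ≤ q - 1) hΛ]
      _ = 6 * q * k / (k - 1) * (m ^ (1 / q) * L) * (2 / 3 * ((k - 1) / k)) := by
          field_simp
          ring
      _ ≤ _ := mul_le_mul_of_nonneg_left hmin hc

section potentials

variable {h : ℂ → ℝ≥0∞} {V : Set ℂ} {μ : Measure ℂ} {R r : ℝ}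

theorem poissonLIntegral_le {z : ℂ} (hz : ‖z‖ < R) (f : ℂ → ℝ≥0∞) :
    poissonLIntegral R z f ≤ ENNReal.ofReal ((R + ‖z‖) / (R - ‖z‖)) *
      (ENNReal.ofReal (2 * Real.pi)⁻¹ * ∫⁻ θ in Ioc 0 (2 * Real.pi), f (circleMap 0 R θ)) := by
  rw [poissonLIntegral, mul_left_comm,
    ← lintegral_const_mul' (ENNReal.ofReal ((R + ‖z‖) / (R - ‖z‖))) _ ENNReal.ofReal_ne_top]
  gcongr
  exact poissonKernel_circleMap_le hz _

theorem le_poissonLIntegral {z : ℂ} (hz : ‖z‖ < R) (f : ℂ → ℝ≥0∞) :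
    ENNReal.ofReal ((R - ‖z‖) / (R + ‖z‖)) *
      (ENNReal.ofReal (2 * Real.pi)⁻¹ * ∫⁻ θ in Ioc 0 (2 * Real.pi), f (circleMap 0 R θ))
      ≤ poissonLIntegral R z f := by
  rw [poissonLIntegral, mul_left_comm, ← lintegral_const_mul' _ _ ENNReal.ofReal_ne_top]
  gcongr
  exact le_poissonKernel_circleMap hz _

theorem lintegral_circle_ne_top (hh : PosSuperharmonicOn h V) (hμ : IsNegLaplacianOn μ h V)
    (hR : 0 < R) (hV : Metric.closedBall 0 R ⊆ V) :
    ∫⁻ θ in Ioc 0 (2 * Real.pi), h (circleMap 0 R θ) ≠ ⊤ := by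
  obtain ⟨z, hz, hhz⟩ : ∃ z : ℂ, ‖z‖ < R ∧ h z < ⊤ := by
    by_contra! hn
    have h0 : volume (Metric.ball (0 : ℂ) R) = 0 := by
      refine measure_mono_null (fun z hz => ?_) (ae_lt_top hh.measurable hh.lintegral_ne_top)
      simpa using hn z (by simpa using hz)
    exact (Metric.measure_ball_pos volume (0 : ℂ) hR).ne' h0
  intro htop
  have h1 := le_poissonLIntegral hz h
  have h2 := poissonJensen hh hμ hR hz hV
  have hp := Real.two_pi_pos
  rw [htop, ENNReal.mul_top (by simpa using inv_pos.2 hp), ENNReal.mul_top (by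
    simpa using div_pos (by linarith) (by linarith [norm_nonneg z]))] at h1
  rw [top_le_iff.1 h1, top_add] at h2
  exact hhz.ne h2

theorem measurable_radialKernel_norm (R : ℝ) :
    Measurable fun p : ℝ × ℂ => radialKernel R p.1 ‖p.2‖ :=
  (measurable_radialKernel R).comp (measurable_fst.prodMk measurable_snd.norm)

theorem lintegral_greenE_restrict (hR : 0 < R) {z : ℂ} (hz : ‖z‖ < R) (μ : Measure ℂ) :
    ∫⁻ w, greenE R z w ∂(μ.restrict (Metric.closedBall 0 R)) = ∫⁻ w, greenE R z w ∂μ := by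
  rw [← lintegral_indicator measurableSet_closedBall]
  refine lintegral_congr fun w => ?_
  by_cases hw : w ∈ Metric.closedBall (0 : ℂ) R
  · rw [indicator_of_mem hw]
  · rw [indicator_of_notMem hw, greenE_eq_zero hR hz]
    exact le_of_not_ge fun h => hw (by simpa using h)

theorem ae_forall_ne_top (hh : PosSuperharmonicOn h V) (hμ : IsNegLaplacianOn μ h V)
    (hr : 0 < r) (hrR : r < R) (hV : Metric.closedBall 0 R ⊆ V) :
    ∀ᵐ t ∂(volume.restrict (Icc 0 r)), ∀ z : ℂ, ‖z‖ = t → h z ≠ ⊤ := by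
  have hR : 0 < R := hr.trans hrR
  set ν := μ.restrict (Metric.closedBall 0 R) with hν
  have : IsFiniteMeasure ν :=
    ⟨by simpa [hν] using hμ.finite_on_compacts _ (isCompact_closedBall 0 R) hV⟩
  have hmk := measurable_radialKernel_norm R
  have hfin : ∫⁻ t in Icc 0 r, ∫⁻ w, radialKernel R t ‖w‖ ∂ν ≠ ⊤ := by
    rw [lintegral_lintegral_swap hmk.aemeasurable]
    refine ne_top_of_le_ne_top ?_ (lintegral_mono (g := fun _ =>
      ENNReal.ofReal (3 * (Real.log (2 * R / r) + 2 * 1) ^ (1 : ℝ) * r)) fun w => ?_)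
    · rw [lintegral_const]
      exact ENNReal.mul_ne_top ENNReal.ofReal_ne_top (measure_ne_top _ _)
    · rcases lt_or_ge ‖w‖ R with hw | hw
      · have h1 := lintegral_radialKernel_rpow_le hrR (norm_nonneg w) hw le_rfl
          (E := Icc 0 r) measurableSet_Icc.nullMeasurableSet le_rfl hr hrR.le (by simp)
        simpa only [ENNReal.rpow_one] using h1
      · simp [radialKernel, hw]
  filter_upwards [ae_lt_top hmk.lintegral_prod_right' hfin, ae_restrict_mem measurableSet_Icc]
    with t ht htr z hz htop
  have hzR : ‖z‖ < R := by rw [hz]; exact htr.2.trans_lt hrR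
  have h2 := poissonJensen hh hμ hR hzR hV
  have hP : poissonLIntegral R z h < ⊤ := by
    refine (poissonLIntegral_le hzR h).trans_lt ?_
    exact ENNReal.mul_lt_top ENNReal.ofReal_lt_top (ENNReal.mul_lt_top ENNReal.ofReal_lt_top
      (lintegral_circle_ne_top hh hμ hR hV).lt_top)
  have hG : ∫⁻ w, greenE R z w ∂μ < ⊤ := by
    rw [← lintegral_greenE_restrict hR hzR]
    refine lt_of_le_of_lt (lintegral_mono fun w => ?_) ht
    rw [← hz]
    exact greenE_le_radialKernel hR hzR
  rw [htop] at h2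
  exact (ENNReal.add_lt_top.2 ⟨hP, hG⟩).ne h2.symm

end potentials

section difference

variable {U : ℂ → EReal} {a c : ℂ → ℝ≥0∞} {V : Set ℂ} {μ ν τ : Measure ℂ} {R : ℝ}

theorem toENNReal_le_potential (ha : PosSuperharmonicOn a V) (hμ : IsNegLaplacianOn μ a V)
    (hc : PosSuperharmonicOn c V) (hν : IsNegLaplacianOn ν c V) (hR : 0 < R)
    (hV : Metric.closedBall 0 R ⊆ V)
    (hU : ∀ z ∈ V, c z ≠ ⊤ → (U z).toENNReal = c z - a z)
    (hτ : ν.restrict (Metric.closedBall 0 R) ≤ τ + μ) {z : ℂ} (hz : ‖z‖ < R) (hcz : c z ≠ ⊤) :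
    (U z).toENNReal ≤ poissonLIntegral R z (fun w => (U w).toENNReal)
      + ∫⁻ w, greenE R z w ∂τ := by
  have hzV : z ∈ V := hV (by simpa using hz.le)
  rw [hU z hzV hcz, tsub_le_iff_right, poissonJensen ha hμ hR hz hV,
    poissonJensen hc hν hR hz hV, add_add_add_comm]
  refine add_le_add ?_ ?_
  · have hm : Measurable fun θ => ENNReal.ofReal (poissonKernel 0 z (circleMap 0 R θ)) *
        a (circleMap 0 R θ) :=
      (ENNReal.measurable_ofReal.comp (continuous_poissonKernel_circleMap hR hz).measurable).mul
        (ha.measurable.comp (continuous_circleMap 0 R).measurable)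
    rw [poissonLIntegral, poissonLIntegral, poissonLIntegral, ← mul_add,
      ← lintegral_add_right _ hm]
    refine mul_le_mul_right (lintegral_mono_ae ?_) _
    have hfin := ae_lt_top (hc.measurable.comp (continuous_circleMap 0 R).measurable)
      (lintegral_circle_ne_top hc hν hR hV)
    filter_upwards [hfin] with θ hθ
    rw [← mul_add]
    gcongr
    rw [hU _ (hV (circleMap_mem_closedBall 0 hR.le θ)) hθ.ne]
    exact le_tsub_add
  · rw [← lintegral_greenE_restrict hR hz ν, ← lintegral_add_measure]
    exact lintegral_mono' hτ le_rfl

theorem lintegral_toENNReal_circle_ne_top (hc : PosSuperharmonicOn c V)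
    (hν : IsNegLaplacianOn ν c V) (hR : 0 < R) (hV : Metric.closedBall 0 R ⊆ V)
    (hU : ∀ z ∈ V, c z ≠ ⊤ → (U z).toENNReal = c z - a z) :
    ∫⁻ θ in Ioc 0 (2 * Real.pi), (U (circleMap 0 R θ)).toENNReal ≠ ⊤ := by
  have h := lintegral_circle_ne_top hc hν hR hV
  refine ne_top_of_le_ne_top h (lintegral_mono_ae ?_)
  filter_upwards [ae_lt_top (hc.measurable.comp (continuous_circleMap 0 R).measurable) h] with θ hθ
  rw [hU _ (hV (circleMap_mem_closedBall 0 hR.le θ)) hθ.ne]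
  exact tsub_le_self

theorem restrict_le_restrict_sub_add {α : Type*} [MeasurableSpace α] {μ ν : Measure α} {B : Set α}
    (hB : MeasurableSet B) (hμ : μ B < ⊤) (hν : ν B < ⊤) :
    ν.restrict B ≤ (ν - μ).restrict B + μ.restrict B := by
  have : IsFiniteMeasure (μ.restrict B) := ⟨by simpa using hμ⟩
  have : IsFiniteMeasure (ν.restrict B) := ⟨by simpa using hν⟩
  rw [Measure.restrict_sub_eq_restrict_sub_restrict hB]
  exact Measure.sub_le_iff_le_add.1 le_rfl

end difference

theorem toENNReal_sub_eq_tsub {b : ℝ} {x y : EReal} (hx : x ≤ b) (hy : y ≤ b) (hyb : y ≠ ⊥) :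
    (x - y).toENNReal = ((b : EReal) - y).toENNReal - ((b : EReal) - x).toENNReal := by
  induction y with
  | bot => exact absurd rfl hyb
  | top => simp at hy
  | coe y =>
    induction x with
    | bot => simp
    | top => simp at hx
    | coe x =>
      have hxb : x ≤ b := by exact_mod_cast hx
      simp only [← EReal.coe_sub]
      rw [EReal.toENNReal_of_ne_top (EReal.coe_ne_top _),
        EReal.toENNReal_of_ne_top (EReal.coe_ne_top _),
        EReal.toENNReal_of_ne_top (EReal.coe_ne_top _), EReal.toReal_coe, EReal.toReal_coe,
        EReal.toReal_coe, ← ENNReal.ofReal_sub _ (by linarith)]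
      congr 1
      ring

section measurability

theorem lt_sub_iff_exists_rat {a x y : EReal} (hx : x ≠ ⊤) (hy : y ≠ ⊤) :
    a < x - y ↔ ∃ p q : ℚ, a < (((q - p : ℚ) : ℝ) : EReal) ∧ ((q : ℝ) : EReal) ≤ x ∧
      y < ((p : ℝ) : EReal) := by
  constructor
  · intro h
    obtain ⟨n, han, hn⟩ := EReal.lt_iff_exists_rat_btwn.1 h
    induction x with
    | top => exact absurd rfl hx
    | bot => simp at hn
    | coe x =>
      induction y with
      | top => exact absurd rfl hy
      | bot =>
        obtain ⟨q, hq⟩ := exists_rat_lt x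
        exact ⟨q - n, q, by simpa using han, by exact_mod_cast hq.le, EReal.bot_lt_coe _⟩
      | coe y =>
        have hn' : (n : ℝ) < x - y := by exact_mod_cast hn
        obtain ⟨q, hq1, hq2⟩ := exists_rat_btwn (show (n : ℝ) + y < x by linarith)
        refine ⟨q - n, q, by simpa using han, by exact_mod_cast hq2.le, ?_⟩
        have : y < ((q - n : ℚ) : ℝ) := by push_cast; linarith
        exact_mod_cast this
  · rintro ⟨p, q, ha, hq, hp⟩
    refine ha.trans_le ?_
    have := EReal.sub_le_sub hq hp.le
    rwa [← EReal.coe_sub, ← Rat.cast_sub] at this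

theorem exists_circleMap_eq {z : ℂ} {t : ℝ} (hz : ‖z‖ = |t|) :
    ∃ θ ∈ Ico (0 : ℝ) (2 * Real.pi), circleMap 0 t θ = z := by
  have h : z ∈ circleMap 0 t '' Ioc 0 (2 * Real.pi) := by
    rw [image_circleMap_Ioc]
    simpa using hz
  obtain ⟨θ, hθ, rfl⟩ := h
  rcases hθ.2.lt_or_eq with h1 | h1
  · exact ⟨θ, ⟨hθ.1.le, h1⟩, rfl⟩
  · refine ⟨0, ⟨le_rfl, Real.two_pi_pos⟩, ?_⟩
    rw [h1, circleMap, circleMap]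
    simp

theorem lt_maxChar_iff {w : ℂ → EReal} {a : EReal} {t : ℝ} :
    a < maxChar w t ↔ ∃ z, ‖z‖ = |t| ∧ a < w z := by
  simp only [maxChar, lt_iSup_iff]
  constructor
  · rintro ⟨θ, -, h⟩
    exact ⟨_, by simp, h⟩
  · rintro ⟨z, hz, h⟩
    obtain ⟨θ, hθ, rfl⟩ := exists_circleMap_eq hz
    exact ⟨θ, hθ, h⟩

variable {U u v : ℂ → EReal} {O : Set ℂ} {r : ℝ}

open Classical in
theorem measurable_maxChar_sub (hO : IsOpen O) (hu : SubharmonicOn u O) (hv : SubharmonicOn v O)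
    (hrO : Metric.closedBall 0 r ⊆ O) :
    Measurable (maxChar fun z => if z ∈ Metric.closedBall 0 r then u z - v z else ⊥) := by
  refine measurable_of_Ioi fun a => ?_
  have hset : maxChar (fun z => if z ∈ Metric.closedBall 0 r then u z - v z else ⊥) ⁻¹' Ioi a
      = ⋃ (p : ℚ) (q : ℚ) (_ : a < (((q - p : ℚ) : ℝ) : EReal)),
        abs ⁻¹' (norm '' ((Metric.closedBall 0 r ∩ u ⁻¹' Ici ((q : ℝ) : EReal)) ∩
          (O ∩ v ⁻¹' Iio ((p : ℝ) : EReal)))) := by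
    ext t
    simp only [mem_preimage, mem_Ioi, lt_maxChar_iff, mem_iUnion, mem_image, mem_inter_iff,
      mem_Ici, mem_Iio, exists_prop]
    constructor
    · rintro ⟨z, hz, h⟩
      split_ifs at h with hzr
      · obtain ⟨p, q, h1, h2, h3⟩ := (lt_sub_iff_exists_rat (hu.lt_top z (hrO hzr)).ne
          (hv.lt_top z (hrO hzr)).ne).1 h
        exact ⟨p, q, h1, z, ⟨⟨hzr, h2⟩, hrO hzr, h3⟩, hz⟩
      · simp at h
    · rintro ⟨p, q, h1, z, ⟨⟨hzr, h2⟩, -, h3⟩, hz⟩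
      refine ⟨z, hz, ?_⟩
      rw [if_pos hzr]
      exact (lt_sub_iff_exists_rat (hu.lt_top z (hrO hzr)).ne
          (hv.lt_top z (hrO hzr)).ne).2 ⟨p, q, h1, h2, h3⟩
  rw [hset]
  refine .iUnion fun p => .iUnion fun q => .iUnion fun _ => ?_
  refine continuous_abs.measurable ?_
  obtain ⟨G, hG, hGe⟩ := upperSemicontinuousOn_iff_preimage_Iio.1 hv.usc ((p : ℝ) : EReal)
  obtain ⟨F, hF, hFe⟩ := upperSemicontinuousOn_iff_preimage_Ici.1 hu.usc ((q : ℝ) : EReal)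
  rw [hGe]
  obtain ⟨C, hC, -, hCe, -⟩ := (hO.inter hG).exists_iUnion_isClosed
  have hK : IsCompact (Metric.closedBall 0 r ∩ u ⁻¹' Ici ((q : ℝ) : EReal)) := by
    have : Metric.closedBall 0 r ∩ u ⁻¹' Ici ((q : ℝ) : EReal) = Metric.closedBall 0 r ∩ F := by
      rw [← inter_eq_left.2 hrO, inter_assoc, hFe, ← inter_assoc]
    rw [this]
    exact (isCompact_closedBall 0 r).inter_right hF
  rw [← hCe, inter_iUnion, image_iUnion]
  exact .iUnion fun n => ((hK.inter_right (hC n)).image continuous_norm).measurableSet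

open Classical in
theorem aemeasurable_maxChar (hU : IsDeltaSubharmonicOn U u v O)
    (hrO : Metric.closedBall 0 r ⊆ O)
    (hgood : ∀ᵐ t ∂(volume.restrict (Icc 0 r)), ∀ z : ℂ, ‖z‖ = t → v z ≠ ⊥) :
    AEMeasurable (maxChar U) (volume.restrict (Icc 0 r)) := by
  refine ⟨_, measurable_maxChar_sub hU.isOpen hU.subharmonic_left hU.subharmonic_right hrO, ?_⟩
  filter_upwards [hgood, ae_restrict_mem measurableSet_Icc] with t ht htr
  unfold maxChar
  refine iSup_congr fun θ => iSup_congr fun _ => ?_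
  have hn : ‖circleMap 0 t θ‖ = t := by simp [abs_of_nonneg htr.1]
  have hmem : circleMap 0 t θ ∈ Metric.closedBall (0 : ℂ) r := by
    rw [mem_closedBall_zero_iff, hn]
    exact htr.2
  rw [hU.eq_sub _ (hrO hmem) (.inr (ht _ hn))]
  exact (if_pos hmem).symm

end measurability

theorem toENNReal_max_zero (x : EReal) : (max 0 x).toENNReal = x.toENNReal := by
  rcases le_total 0 x with h | h
  · rw [max_eq_right h]
  · rw [max_eq_left h, EReal.toENNReal_of_nonpos h, EReal.toENNReal_zero]

theorem eintegral_posPart {α : Type*} [MeasurableSpace α] (μ : Measure α) (f : α → EReal) :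
    eintegral μ (fun x => max 0 (f x)) = ((∫⁻ x, (f x).toENNReal ∂μ : ℝ≥0∞) : EReal) := by
  have h : ∀ x, (-(max 0 (f x))).toENNReal = 0 := fun x =>
    EReal.toENNReal_of_nonpos (by rw [EReal.neg_le, neg_zero]; exact le_max_left _ _)
  simp only [eintegral, toENNReal_max_zero, h, lintegral_zero, EReal.coe_ennreal_zero, sub_zero]

/-- The mean of the positive part of `w` over the circle of radius `R`. -/
def posMean (w : ℂ → EReal) (R : ℝ) : ℝ≥0∞ :=
  ENNReal.ofReal (2 * Real.pi)⁻¹ * ∫⁻ θ in Ioc 0 (2 * Real.pi), (w (circleMap 0 R θ)).toENNReal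

theorem coe_ennreal_ofReal_of_nonneg {x : ℝ} (hx : 0 ≤ x) :
    ((ENNReal.ofReal x : ℝ≥0∞) : EReal) = (x : EReal) := by
  rw [EReal.coe_ennreal_ofReal, max_eq_left hx]

theorem circleMean_posPart (w : ℂ → EReal) (R : ℝ) :
    circleMean (posPart w) 0 R = (posMean w R : EReal) := by
  unfold circleMean posPart posMean
  rw [eintegral_posPart, EReal.coe_ennreal_mul,
    coe_ennreal_ofReal_of_nonneg (inv_nonneg.2 Real.two_pi_pos.le)]

theorem lintegral_inv_Ioc {x R : ℝ} (hx : 0 < x) (hxR : x ≤ R) :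
    ∫⁻ t in Ioc x R, ENNReal.ofReal t⁻¹ = ENNReal.ofReal (Real.log (R / x)) := by
  have hInt : IntervalIntegrable (fun t : ℝ => t⁻¹) volume x R :=
    intervalIntegral.intervalIntegrable_inv (fun t ht => by
      rw [uIcc_of_le hxR] at ht
      exact (hx.trans_le ht.1).ne') continuousOn_id
  rw [← ofReal_integral_eq_lintegral_ofReal
      ((intervalIntegrable_iff_integrableOn_Ioc_of_le hxR).1 hInt),
    ← intervalIntegral.integral_of_le hxR, integral_inv_of_pos hx (hx.trans_le hxR)]
  refine (ae_restrict_iff' measurableSet_Ioc).2 (.of_forall fun t ht => ?_)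
  exact inv_nonneg.2 (hx.trans ht.1).le

theorem lintegral_log_le_radialN {σ : Measure ℂ} [SFinite σ] {r₀ R : ℝ} (hr₀ : 0 < r₀)
    (hr₀R : r₀ ≤ R) : ∫⁻ w in Metric.closedBall 0 R,
      ENNReal.ofReal (Real.log (R / max ‖w‖ r₀)) ∂σ ≤ radialN σ r₀ R := by
  have hm : Measurable fun p : ℂ × ℝ => (Iic p.2).indicator (fun _ => ENNReal.ofReal p.2⁻¹) ‖p.1‖ := by
    have : (fun p : ℂ × ℝ => (Iic p.2).indicator (fun _ => ENNReal.ofReal p.2⁻¹) ‖p.1‖)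
        = {p : ℂ × ℝ | ‖p.1‖ ≤ p.2}.indicator fun p => ENNReal.ofReal p.2⁻¹ := by
      funext p
      simp only [indicator, mem_Iic]
      rfl
    rw [this]
    refine Measurable.indicator (by fun_prop) ?_
    exact measurableSet_le measurable_fst.norm measurable_snd
  calc _ ≤ ∫⁻ w in Metric.closedBall 0 R, (∫⁻ t in Ioc r₀ R,
        (Iic t).indicator (fun _ => ENNReal.ofReal t⁻¹) ‖w‖) ∂σ := by
        refine setLIntegral_mono' measurableSet_closedBall fun w hw => ?_
        rw [← lintegral_inv_Ioc (lt_max_of_lt_right hr₀)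
          (max_le (by simpa using hw) hr₀R), ← lintegral_indicator measurableSet_Ioc,
          ← lintegral_indicator measurableSet_Ioc]
        refine lintegral_mono fun t => ?_
        by_cases ht : t ∈ Ioc (max ‖w‖ r₀) R
        · have h1 := max_lt_iff.1 ht.1
          rw [indicator_of_mem ht, indicator_of_mem (show t ∈ Ioc r₀ R from ⟨h1.2, ht.2⟩),
            indicator_of_mem (show ‖w‖ ∈ Iic t from h1.1.le)]
        · rw [indicator_of_notMem ht]
          exact bot_le
    _ = ∫⁻ t in Ioc r₀ R, ∫⁻ w in Metric.closedBall 0 R,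
        (Iic t).indicator (fun _ => ENNReal.ofReal t⁻¹) ‖w‖ ∂σ :=
      lintegral_lintegral_swap hm.aemeasurable
    _ ≤ radialN σ r₀ R := by
        refine setLIntegral_mono' measurableSet_Ioc fun t ht => ?_
        have h2 : (fun w : ℂ => (Iic t).indicator (fun _ => ENNReal.ofReal t⁻¹) ‖w‖)
            = (Metric.closedBall (0 : ℂ) t).indicator fun _ => ENNReal.ofReal t⁻¹ := by
          funext w
          simp [indicator]
        rw [h2]
        refine (setLIntegral_le_lintegral _ _).trans ?_
        rw [lintegral_indicator_const measurableSet_closedBall,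
          ENNReal.ofReal_inv_of_pos (hr₀.trans ht.1), mul_comm, ENNReal.div_eq_inv_mul, mul_comm]

theorem radialN_mono {σ τ : Measure ℂ} (h : σ ≤ τ) (r R : ℝ) : radialN σ r R ≤ radialN τ r R := by
  unfold radialN
  gcongr

theorem radialN_ne_top {τ : Measure ℂ} {r R : ℝ} (hr : 0 < r)
    (hτ : τ (Metric.closedBall 0 R) ≠ ⊤) : radialN τ r R ≠ ⊤ := by
  refine ne_top_of_le_ne_top ?_ (setLIntegral_mono' measurableSet_Ioc
    (g := fun _ => τ (Metric.closedBall 0 R) / ENNReal.ofReal r) fun t ht => ?_)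
  · rw [setLIntegral_const]
    exact ENNReal.mul_ne_top (ENNReal.div_ne_top hτ (by simpa using hr)) (by simp)
  · gcongr
    · exact ht.2
    · exact ht.1.le

theorem toENNReal_le_abs (x : EReal) : x.toENNReal ≤ x.abs := by
  induction x with
  | bot => simp
  | top => simp
  | coe x =>
    rw [EReal.real_coe_toENNReal, EReal.abs_def]
    exact ENNReal.ofReal_le_ofReal (le_abs_self x)

theorem ne_top_of_conj {p q : ℝ≥0∞} (hp : 1 < p) (hpq : 1 / p + 1 / q = 1) : q ≠ ⊤ := by
  rintro rfl
  rw [ENNReal.div_top, add_zero, one_div, ENNReal.inv_eq_one] at hpq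
  exact hp.ne' hpq

theorem one_le_of_conj {p q : ℝ≥0∞} (hpq : 1 / p + 1 / q = 1) : 1 ≤ q := by
  rw [one_div, one_div] at hpq
  exact ENNReal.inv_le_one.1 (hpq ▸ le_add_self)

theorem lintegral_mul_toENNReal_le {p q : ℝ≥0∞} (hp : 1 < p) (hpq : 1 / p + 1 / q = 1)
    {E : Set ℝ} (hE : NullMeasurableSet E) {g : ℝ → EReal}
    (hg : AEMeasurable g (volume.restrict E)) {f : ℝ → ℝ≥0∞}
    (hf : AEMeasurable f (volume.restrict E)) :
    ∫⁻ t in E, f t * (g t).toENNReal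
      ≤ (∫⁻ t in E, f t ^ q.toReal) ^ (1 / q.toReal) * weightNorm g p E := by
  by_cases hpt : p = ⊤
  · have hq : q = 1 := by
      rw [hpt, one_div, ENNReal.inv_top, zero_add, one_div, ENNReal.inv_eq_one] at hpq
      exact hpq
    have hW : weightNorm g p E = essSup (fun t => (g t).toENNReal) (volume.restrict E) := by
      rw [weightNorm, if_pos hpt, essSup_eq_sInf]
      congr 1
      ext a
      simp only [mem_ofPred_eq]
      rw [Measure.restrict_apply₀' hE]
      have : {x | x ∈ E ∧ (a : EReal) < g x} = {x | a < (g x).toENNReal} ∩ E := by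
        ext x
        simp only [mem_ofPred_eq, mem_inter_iff, and_comm (a := x ∈ E)]
        refine and_congr_left fun _ => ?_
        rw [← EReal.coe_ennreal_lt_coe_ennreal_iff, EReal.coe_toENNReal_eq_max, lt_max_iff,
          or_iff_right (EReal.coe_ennreal_nonneg a).not_gt]
      rw [this]
    rw [hW, hq]
    simp only [ENNReal.toReal_one, ENNReal.rpow_one, div_one]
    rw [← lintegral_mul_const'' _ hf]
    refine lintegral_mono_ae ?_
    filter_upwards [ENNReal.ae_le_essSup (μ := volume.restrict E) fun t => (g t).toENNReal] with t ht
    gcongr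
  · rw [weightNorm, if_neg hpt]
    have hconj : p.toReal.HolderConjugate q.toReal := by
      have : p.HolderConjugate q := ENNReal.holderConjugate_iff.2 (by simpa using hpq)
      exact ENNReal.HolderConjugate.toReal_of_ne_top hpt (ne_top_of_conj hp hpq)
    have hgm : AEMeasurable (fun t => (g t).toENNReal) (volume.restrict E) :=
      EReal.continuous_toENNReal.measurable.comp_aemeasurable hg
    refine (ENNReal.lintegral_mul_le_Lp_mul_Lq (volume.restrict E) hconj.symm hf hgm).trans ?_
    gcongr with t
    exact toENNReal_le_abs _

theorem IsDeltaSubharmonicOn.exists_defects {U u v : ℂ → EReal} {O : Set ℂ}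
    (hU : IsDeltaSubharmonicOn U u v O) {K : Set ℂ} (hK : IsCompact K) (hKO : K ⊆ O) :
    ∃ (V : Set ℂ) (a c : ℂ → ℝ≥0∞), K ⊆ V ∧ PosSuperharmonicOn a V ∧
      IsNegLaplacianOn (rieszMeasure u O) a V ∧ PosSuperharmonicOn c V ∧
      IsNegLaplacianOn (rieszMeasure v O) c V ∧
      (∀ z ∈ V, c z ≠ ⊤ → v z ≠ ⊥ ∧ (U z).toENNReal = c z - a z) := by
  obtain ⟨V, hV, hKV, hVO, hVc⟩ := exists_open_between_and_isCompact_closure hK hU.isOpen hKO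
  obtain ⟨b₁, hb₁, hub₁⟩ := hU.subharmonic_left.exists_bound hVc hVO
  obtain ⟨b₂, hb₂, hub₂⟩ := hU.subharmonic_right.exists_bound hVc hVO
  set b := max b₁ b₂
  have hb : 0 ≤ b := hb₁.trans (le_max_left _ _)
  have hu : ∀ z ∈ V, u z ≤ b := fun z hz => (hub₁ z (subset_closure hz)).trans
    (by exact_mod_cast le_max_left b₁ b₂)
  have hv : ∀ z ∈ V, v z ≤ b := fun z hz => (hub₂ z (subset_closure hz)).trans
    (by exact_mod_cast le_max_right b₁ b₂)
  have hVO' : V ⊆ O := subset_closure.trans hVO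
  have ha := hU.subharmonic_left.posSuperharmonicOn_defect hU.isOpen hU.isConnected
    hU.left_ne_bot hV hVc hVO hb hu
  have hc := hU.subharmonic_right.posSuperharmonicOn_defect hU.isOpen hU.isConnected
    hU.right_ne_bot hV hVc hVO hb hv
  have hμ := hU.subharmonic_left.isRieszMeasure_rieszMeasure hU.isOpen hU.isConnected
    hU.left_ne_bot
  have hν := hU.subharmonic_right.isRieszMeasure_rieszMeasure hU.isOpen hU.isConnected
    hU.right_ne_bot
  refine ⟨V, defect u V b, defect v V b, hKV, ha, hμ.isNegLaplacianOn hVO' ha hu, hc,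
    hν.isNegLaplacianOn hVO' hc hv, fun z hz hcz => ?_⟩
  have hvz : v z ≠ ⊥ := by
    intro h
    rw [defect_of_mem hz, h] at hcz
    simp at hcz
  refine ⟨hvz, ?_⟩
  rw [hU.eq_sub z (hVO' hz) (.inr hvz), defect_of_mem hz, defect_of_mem hz,
    toENNReal_sub_eq_tsub (hu z hz) (hv z hz) hvz]

theorem toENNReal_maxChar_le {w : ℂ → EReal} {t : ℝ} {A : ℝ≥0∞}
    (h : ∀ z, ‖z‖ = |t| → (w z).toENNReal ≤ A) : (maxChar w t).toENNReal ≤ A := by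
  have : maxChar w t ≤ (A : EReal) := by
    refine le_of_forall_lt fun a ha => ?_
    obtain ⟨z, hz, haz⟩ := lt_maxChar_iff.1 ha
    refine haz.trans_le ((le_max_right 0 _).trans ?_)
    rw [← EReal.coe_toENNReal_eq_max]
    exact EReal.coe_ennreal_le_coe_ennreal_iff.2 (h z hz)
  simpa using EReal.toENNReal_le_toENNReal this

section main

variable {U u v : ℂ → EReal} {O : Set ℂ} {r₀ r k : ℝ}

theorem ae_toENNReal_maxChar_le {V : Set ℂ} {a c : ℂ → ℝ≥0∞} {μ ν : Measure ℂ}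
    (hr : 0 < r) (hk : 1 < k) (hV : Metric.closedBall 0 (k * r) ⊆ V)
    (ha : PosSuperharmonicOn a V) (hμ : IsNegLaplacianOn μ a V) (hc : PosSuperharmonicOn c V)
    (hν : IsNegLaplacianOn ν c V) (hU : ∀ z ∈ V, c z ≠ ⊤ → (U z).toENNReal = c z - a z) :
    ∀ᵐ t ∂(volume.restrict (Icc 0 r)), (maxChar U t).toENNReal ≤
      ENNReal.ofReal ((k + 1) / (k - 1)) * posMean U (k * r) +
        ∫⁻ w, radialKernel (k * r) t ‖w‖ ∂((ν - μ).restrict (Metric.closedBall 0 (k * r))) := by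
  have hrR : r < k * r := by nlinarith
  have hR : 0 < k * r := hr.trans hrR
  have hball := isCompact_closedBall (0 : ℂ) (k * r)
  have hτ : ν.restrict (Metric.closedBall 0 (k * r)) ≤
      (ν - μ).restrict (Metric.closedBall 0 (k * r)) + μ :=
    (restrict_le_restrict_sub_add measurableSet_closedBall (hμ.finite_on_compacts _ hball hV)
      (hν.finite_on_compacts _ hball hV)).trans (add_le_add le_rfl Measure.restrict_le_self)
  filter_upwards [ae_forall_ne_top hc hν hr hrR hV, ae_restrict_mem measurableSet_Icc]
    with t ht htr
  refine toENNReal_maxChar_le fun z hz => ?_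
  rw [abs_of_nonneg htr.1] at hz
  have hzR : ‖z‖ < k * r := hz ▸ htr.2.trans_lt hrR
  refine (toENNReal_le_potential ha hμ hc hν hR hV hU hτ hzR (ht z hz)).trans ?_
  gcongr with w
  · refine (poissonLIntegral_le hzR _).trans ?_
    rw [posMean]
    refine mul_le_mul_left (ENNReal.ofReal_le_ofReal ?_) _
    rw [hz, div_le_div_iff₀ (by linarith [htr.2]) (by linarith)]
    nlinarith [htr.2]
  · rw [← hz]
    exact greenE_le_radialKernel hR hzR

theorem lintegral_radialKernel_mul_le {p q : ℝ≥0∞} (hp : 1 < p) (hpq : 1 / p + 1 / q = 1)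
    (hr₀ : 0 < r₀) (hr₀r : r₀ ≤ r) (hk : 1 < k) {E : Set ℝ} (hE : NullMeasurableSet E)
    (hEr : E ⊆ Icc 0 r) {m : ℝ} (hm : 0 < m) (hmr : m ≤ r) (hmE : volume E = ENNReal.ofReal m)
    {g : ℝ → EReal} (hg : AEMeasurable g (volume.restrict E)) (τ : Measure ℂ)
    (hτ : τ (Metric.closedBall 0 (k * r)) ≠ ⊤) :
    ∫⁻ t in E, (∫⁻ w, radialKernel (k * r) t ‖w‖ ∂(τ.restrict (Metric.closedBall 0 (k * r)))) *
        (g t).toENNReal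
      ≤ ENNReal.ofReal (6 * q.toReal * k / (k - 1) * (m ^ (1 / q.toReal)
          * Real.log (4 * Real.exp 1 * k * r / m))) * radialN τ r₀ (k * r) * weightNorm g p E := by
  have hr : 0 < r := hr₀.trans_le hr₀r
  have hrR : r < k * r := by nlinarith
  have hq1 : 1 ≤ q.toReal := by
    simpa using ENNReal.toReal_mono (ne_top_of_conj hp hpq) (one_le_of_conj hpq)
  set B := Metric.closedBall (0 : ℂ) (k * r) with hB
  have : IsFiniteMeasure (τ.restrict B) := ⟨by simpa using hτ.lt_top⟩
  have hmk := measurable_radialKernel_norm (k * r)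
  have hmt : ∀ w : ℂ, Measurable fun t => radialKernel (k * r) t ‖w‖ := fun w =>
    hmk.comp (measurable_id.prodMk measurable_const)
  have hmw : ∀ t : ℝ, Measurable fun w : ℂ => radialKernel (k * r) t ‖w‖ := fun t =>
    hmk.comp (measurable_const.prodMk measurable_id)
  have hgm : AEMeasurable (fun t => (g t).toENNReal) (volume.restrict E) :=
    EReal.continuous_toENNReal.measurable.comp_aemeasurable hg
  set c := ENNReal.ofReal (6 * q.toReal * k / (k - 1) * (m ^ (1 / q.toReal)
          * Real.log (4 * Real.exp 1 * k * r / m)))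
  calc _ = ∫⁻ t in E, ∫⁻ w, radialKernel (k * r) t ‖w‖ * (g t).toENNReal ∂(τ.restrict B) := by
        refine lintegral_congr fun t => ?_
        rw [lintegral_mul_const _ (hmw t)]
    _ = ∫⁻ w, (∫⁻ t in E, radialKernel (k * r) t ‖w‖ * (g t).toENNReal) ∂(τ.restrict B) :=
        lintegral_lintegral_swap (hmk.aemeasurable.mul
          (hgm.comp_quasiMeasurePreserving Measure.quasiMeasurePreserving_fst))
    _ ≤ ∫⁻ w, c * ENNReal.ofReal (Real.log (k * r / max ‖w‖ r₀)) * weightNorm g p E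
          ∂(τ.restrict B) := by
        refine lintegral_mono fun w => ?_
        refine (lintegral_mul_toENNReal_le hp hpq hE hg (hmt w).aemeasurable).trans ?_
        refine mul_le_mul_left ?_ _
        rcases lt_or_ge ‖w‖ (k * r) with hw | hw
        · exact lintegral_rpow_radialKernel_le hr₀ hr₀r hk (norm_nonneg w) hw hq1 hE hEr hm hmr hmE
        · have hq0 : 0 < q.toReal := by linarith
          simp [radialKernel, hw, hq0]
    _ = c * (∫⁻ w in B, ENNReal.ofReal (Real.log (k * r / max ‖w‖ r₀)) ∂(τ.restrict B)) *
          weightNorm g p E := by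
        have hml : Measurable fun w : ℂ => ENNReal.ofReal (Real.log (k * r / max ‖w‖ r₀)) := by
          fun_prop
        rw [lintegral_mul_const _ (hml.const_mul c), lintegral_const_mul _ hml,
          Measure.restrict_restrict measurableSet_closedBall, inter_self]
    _ ≤ _ := by
        gcongr
        exact (lintegral_log_le_radialN hr₀ (hr₀r.trans hrR.le)).trans
          (radialN_mono Measure.restrict_le_self _ _)

theorem lintegral_maxChar_mul_le {p q : ℝ≥0∞} (hp : 1 < p) (hpq : 1 / p + 1 / q = 1)
    (hr₀ : 0 < r₀) (hr₀r : r₀ ≤ r) (hk : 1 < k) {E : Set ℝ} (hE : NullMeasurableSet E)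
    (hEr : E ⊆ Icc 0 r) {g : ℝ → EReal} (hg : AEMeasurable g (volume.restrict E)) {τ : Measure ℂ}
    (hτ : τ (Metric.closedBall 0 (k * r)) ≠ ⊤)
    (hM : ∀ᵐ t ∂(volume.restrict (Icc 0 r)), (maxChar U t).toENNReal ≤
      ENNReal.ofReal ((k + 1) / (k - 1)) * posMean U (k * r) +
        ∫⁻ w, radialKernel (k * r) t ‖w‖ ∂(τ.restrict (Metric.closedBall 0 (k * r)))) :
    ∫⁻ t in E, (max 0 (maxChar U t) * g t).toENNReal ≤
      ENNReal.ofReal (6 * q.toReal * k / (k - 1)) * (posMean U (k * r) + radialN τ r₀ (k * r)) *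
        weightNorm g p E * ENNReal.ofReal ((volume E).toReal ^ (1 / q.toReal)
          * Real.log (4 * Real.exp 1 * k * r / (volume E).toReal)) := by
  have hr : 0 < r := hr₀.trans_le hr₀r
  have hq1 : 1 ≤ q.toReal := by
    simpa using ENNReal.toReal_mono (ne_top_of_conj hp hpq) (one_le_of_conj hpq)
  have hq0 : 0 < q.toReal := by linarith
  have hvol : volume E ≤ ENNReal.ofReal r := (measure_mono hEr).trans (by simp)
  have hmE : volume E = ENNReal.ofReal (volume E).toReal :=
    (ENNReal.ofReal_toReal (ne_top_of_le_ne_top ENNReal.ofReal_ne_top hvol)).symm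
  rcases (ENNReal.toReal_nonneg (a := volume E)).eq_or_lt with hm | hm
  · rw [← hm, ENNReal.ofReal_zero] at hmE
    rw [Measure.restrict_eq_zero.2 hmE, lintegral_zero_measure]
    exact bot_le
  set m := (volume E).toReal
  have hmr : m ≤ r := ENNReal.toReal_le_of_le_ofReal hr.le hvol
  have hL := one_le_log_ratio hk hm hmr
  have hk1 : 0 < k - 1 := by linarith
  have hgm : AEMeasurable (fun t => (g t).toENNReal) (volume.restrict E) :=
    EReal.continuous_toENNReal.measurable.comp_aemeasurable hg
  have hone := lintegral_mul_toENNReal_le hp hpq hE hg (f := fun _ => 1) aemeasurable_const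
  simp only [one_mul, ENNReal.one_rpow, lintegral_const, Measure.restrict_apply_univ] at hone
  rw [hmE, ENNReal.ofReal_rpow_of_nonneg hm.le (by positivity)] at hone
  have hker := lintegral_radialKernel_mul_le hp hpq hr₀ hr₀r hk hE hEr hm hmr hmE hg τ hτ
  have hcoef : ENNReal.ofReal ((k + 1) / (k - 1)) * ENNReal.ofReal (m ^ (1 / q.toReal)) ≤
      ENNReal.ofReal (6 * q.toReal * k / (k - 1) * (m ^ (1 / q.toReal)
          * Real.log (4 * Real.exp 1 * k * r / m))) := by
    rw [← ENNReal.ofReal_mul (by positivity)]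
    refine ENNReal.ofReal_le_ofReal ?_
    refine mul_le_mul ?_ (le_mul_of_one_le_right (by positivity) hL) (by positivity)
      (by positivity)
    gcongr
    nlinarith
  have hsplit : ENNReal.ofReal (6 * q.toReal * k / (k - 1) * (m ^ (1 / q.toReal)
          * Real.log (4 * Real.exp 1 * k * r / m))) = ENNReal.ofReal (6 * q.toReal * k / (k - 1)) *
        ENNReal.ofReal (m ^ (1 / q.toReal) * Real.log (4 * Real.exp 1 * k * r / m)) :=
    ENNReal.ofReal_mul (by positivity)
  set c := ENNReal.ofReal (6 * q.toReal * k / (k - 1) * (m ^ (1 / q.toReal)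
          * Real.log (4 * Real.exp 1 * k * r / m)))
  set D := ENNReal.ofReal ((k + 1) / (k - 1)) * posMean U (k * r)
  calc ∫⁻ t in E, (max 0 (maxChar U t) * g t).toENNReal
      ≤ ∫⁻ t in E, (D * (g t).toENNReal + (∫⁻ w, radialKernel (k * r) t ‖w‖
          ∂(τ.restrict (Metric.closedBall 0 (k * r)))) * (g t).toENNReal) := by
        refine lintegral_mono_ae ?_
        filter_upwards [ae_mono (Measure.restrict_mono hEr le_rfl) hM] with t ht
        rw [EReal.toENNReal_mul (le_max_left _ _), toENNReal_max_zero, ← add_mul]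
        gcongr
    _ = D * (∫⁻ t in E, (g t).toENNReal) + ∫⁻ t in E, (∫⁻ w, radialKernel (k * r) t ‖w‖
          ∂(τ.restrict (Metric.closedBall 0 (k * r)))) * (g t).toENNReal := by
        rw [lintegral_add_left' (hgm.const_mul D), lintegral_const_mul'' D hgm]
    _ ≤ D * (ENNReal.ofReal (m ^ (1 / q.toReal)) * weightNorm g p E) +
          c * radialN τ r₀ (k * r) * weightNorm g p E := by gcongr
    _ = (ENNReal.ofReal ((k + 1) / (k - 1)) * ENNReal.ofReal (m ^ (1 / q.toReal))) *
          posMean U (k * r) * weightNorm g p E + c * radialN τ r₀ (k * r) * weightNorm g p E := by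
        ring
    _ ≤ c * posMean U (k * r) * weightNorm g p E + c * radialN τ r₀ (k * r) * weightNorm g p E := by
        gcongr
    _ = _ := by
        rw [hsplit]
        ring

theorem coe_sub_add_add_coe {x y z : ℝ≥0∞} (hy : y ≠ ⊤) :
    (x : EReal) - (y : EReal) + (z : EReal) + (y : EReal) = ((x + z : ℝ≥0∞) : EReal) := by
  lift y to NNReal using hy
  rw [EReal.coe_ennreal_add, add_right_comm, EReal.coe_nnreal_eq_coe_real, EReal.sub_add_cancel]

end main

end DeltaSubharmonic

end

theorem mainTheorem2
    (r₀ r k : ℝ) (hr₀ : 0 < r₀) (hr₀r : r₀ ≤ r) (hk : 1 < k)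
    (p q : ENNReal) (hp : 1 < p) (hpq : 1 / p + 1 / q = 1)
    (E : Set ℝ) (hE : MeasureTheory.NullMeasurableSet E MeasureTheory.volume)
    (hEr : E ⊆ Set.Icc 0 r)
    (g : ℝ → EReal) (hg : AEMeasurable g (MeasureTheory.volume.restrict E))
    (O : Set ℂ) (hO : Metric.closedBall 0 (k * r) ⊆ O)
    (U u v : ℂ → EReal) (hU : DeltaSubharmonic.IsDeltaSubharmonicOn U u v O) :
    AEMeasurable (fun t => max 0 (DeltaSubharmonic.maxChar U t) * g t)
        (MeasureTheory.volume.restrict E) ∧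
    (DeltaSubharmonic.weightNorm g p E < ⊤ →
      ∫⁻ t in E, (max 0 (DeltaSubharmonic.maxChar U t) * g t).toENNReal < ⊤) ∧
    DeltaSubharmonic.eintegral (MeasureTheory.volume.restrict E)
        (fun t => max 0 (DeltaSubharmonic.maxChar U t) * g t) ≤
      ((6 * q.toReal * k / (k - 1) : ℝ) : EReal)
        * (DeltaSubharmonic.nevanlinnaT U u v O r₀ (k * r)
            + DeltaSubharmonic.circleMean (DeltaSubharmonic.posPart U) 0 r₀)
        * (DeltaSubharmonic.weightNorm g p E : EReal)
        * (((MeasureTheory.volume E).toReal ^ (1 / q.toReal)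
            * Real.log (4 * Real.exp 1 * k * r / (MeasureTheory.volume E).toReal) : ℝ) : EReal) := by
  have hr : 0 < r := hr₀.trans_le hr₀r
  have hrR : r < k * r := by nlinarith
  have hR : 0 < k * r := hr.trans hrR
  have hk1 : 0 < k - 1 := by linarith
  obtain ⟨V, a, c, hV, ha, hμ, hc, hν, hdef⟩ :=
    hU.exists_defects (isCompact_closedBall (0 : ℂ) (k * r)) hO
  have hUd : ∀ z ∈ V, c z ≠ ⊤ → (U z).toENNReal = c z - a z := fun z hz h => (hdef z hz h).2
  have hsub : ∀ {s : ℝ}, s ≤ k * r → Metric.closedBall (0 : ℂ) s ⊆ Metric.closedBall 0 (k * r) :=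
    fun h => Metric.closedBall_subset_closedBall h
  have hgood : ∀ᵐ t ∂(MeasureTheory.volume.restrict (Set.Icc 0 r)), ∀ z : ℂ, ‖z‖ = t → v z ≠ ⊥ := by
    filter_upwards [DeltaSubharmonic.ae_forall_ne_top hc hν hr hrR hV,
      MeasureTheory.ae_restrict_mem measurableSet_Icc] with t ht htr z hz
    refine (hdef z (hV ?_) (ht z hz)).1
    rw [mem_closedBall_zero_iff, hz]
    exact htr.2.trans hrR.le
  have hmeas : AEMeasurable (DeltaSubharmonic.maxChar U) (MeasureTheory.volume.restrict E) :=
    (DeltaSubharmonic.aemeasurable_maxChar hU ((hsub hrR.le).trans hO) hgood).mono_measure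
      (MeasureTheory.Measure.restrict_mono hEr le_rfl)
  have hτ : DeltaSubharmonic.lowerRiesz u v O (Metric.closedBall 0 (k * r)) ≠ ⊤ :=
    ((MeasureTheory.Measure.sub_le _).trans_lt
      (hν.finite_on_compacts _ (isCompact_closedBall _ _) hV)).ne
  have hfin : ∀ s, 0 < s → s ≤ k * r → DeltaSubharmonic.posMean U s ≠ ⊤ := fun s hs hsR =>
    ENNReal.mul_ne_top ENNReal.ofReal_ne_top
      (DeltaSubharmonic.lintegral_toENNReal_circle_ne_top hc hν hs ((hsub hsR).trans hV) hUd)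
  have hkey := DeltaSubharmonic.lintegral_maxChar_mul_le hp hpq hr₀ hr₀r hk hE hEr hg hτ
    (DeltaSubharmonic.ae_toENNReal_maxChar_le hr hk hV ha hμ hc hν hUd)
  have hN := DeltaSubharmonic.radialN_ne_top hr₀ hτ
  refine ⟨(measurable_const.max measurable_id).comp_aemeasurable hmeas |>.mul hg,
    fun hW => hkey.trans_lt ?_, ?_⟩
  · refine ENNReal.mul_lt_top (ENNReal.mul_lt_top (ENNReal.mul_lt_top ENNReal.ofReal_lt_top ?_) hW)
      ENNReal.ofReal_lt_top
    exact ENNReal.add_lt_top.2 ⟨(hfin _ hR le_rfl).lt_top, hN.lt_top⟩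
  · have hcoef : 0 ≤ 6 * q.toReal * k / (k - 1) :=
      div_nonneg (by positivity) hk1.le
    have hlog : 0 ≤ (MeasureTheory.volume E).toReal ^ (1 / q.toReal)
        * Real.log (4 * Real.exp 1 * k * r / (MeasureTheory.volume E).toReal) := by
      rcases (ENNReal.toReal_nonneg (a := MeasureTheory.volume E)).eq_or_lt with hm | hm
      · rw [← hm]
        simp
      · have hmr : (MeasureTheory.volume E).toReal ≤ r :=
          ENNReal.toReal_le_of_le_ofReal hr.le ((MeasureTheory.measure_mono hEr).trans (by simp))
        have := DeltaSubharmonic.one_le_log_ratio hk hm hmr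
        positivity
    rw [DeltaSubharmonic.nevanlinnaT, DeltaSubharmonic.circleMean_posPart,
      DeltaSubharmonic.circleMean_posPart,
      DeltaSubharmonic.coe_sub_add_add_coe (hfin r₀ hr₀ (hr₀r.trans hrR.le)),
      ← DeltaSubharmonic.coe_ennreal_ofReal_of_nonneg hcoef,
      ← DeltaSubharmonic.coe_ennreal_ofReal_of_nonneg hlog, ← EReal.coe_ennreal_mul,
      ← EReal.coe_ennreal_mul, ← EReal.coe_ennreal_mul]
    refine le_trans ?_ (EReal.coe_ennreal_le_coe_ennreal_iff.2 hkey)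
    rw [DeltaSubharmonic.eintegral]
    exact EReal.sub_le_of_le_add (le_add_of_nonneg_right (EReal.coe_ennreal_nonneg _))
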